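/- Let $s>1/2$. For a family $f$ of real functions in $L^2(\mathbb R^3)$ put $\|f\|_{H^s}^2=\int_{\mathbb R^3}(1+|\xi|^2)^s|\hat f(\xi)|^2\,d\xi$ and $\|f\|_{L^\infty_vL^2_h}=\operatorname{ess\,sup}_{x_3\in\mathbb R}\big(\int_{\mathbb R^2}|f(x_h,x_3)|^2\,dx_h\big)^{1/2}$, where $x=(x_h,x_3)$, $x_h=(x_1,x_2)$, and let $\nabla_h=(\partial_1,\partial_2)$. There is a constant $C>0$, depending only on $s$, such that for every real vector field $u\in H^s(\mathbb R^3)^3$ with $\operatorname{div}u=0$ and $\nabla_hu\in H^s(\mathbb R^3)$ (without the last condition the right-hand side below is infinite), the pairing $\langle u\cdot\nabla u,u\rangle_{H^s}$ exists and $$\big|\langle u\cdot\nabla u,u\rangle_{H^s}\big|\le C\Big[\|u\|_{L^\infty_vL^2_h}^{1/2}\,\|\nabla_hu\|_{L^\infty_vL^2_h}^{1/2}\,\|u\|_{H^s}^{1/2}\,\|\nabla_hu\|_{H^s}^{3/2}+\|\nabla_hu\|_{L^\infty_vL^2_h}\,\|u\|_{H^s}\,\|\nabla_hu\|_{H^s}\Big].$$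 Here $u\cdot\nabla u$ is the tempered distribution with components $\sum_{j=1}^3\partial_j(u_ju_i)$, whose Fourier transform is a locally integrable function, and $$\langle f,g\rangle_{H^s}=\lim_{R\to\infty}\int_{\mathbb R^3}\chi(|\xi|/R)\,(1+|\xi|^2)^s\,\hat f(\xi)\cdot\overline{\hat g(\xi)}\,d\xi ,$$ where the limit has to exist and be the same for all $\chi\in C_c^\infty(\mathbb R)$ that equal $1$ near $0$; it is the ordinary $H^s$ inner product if the integrand without $\chi$ is integrable. -/

import Mathlib

open MeasureTheory Filter Topology
open scoped FourierTransform SchwartzMap LineDeriv ENNReal ContDiff ComplexConjugate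

noncomputable section

namespace AnisotropicFluid

/-- Physical (and frequency) space `ℝ³`; the coordinates `0, 1` are horizontal, `2` is vertical. -/
abbrev R3 : Type := EuclideanSpace ℝ (Fin 3)

/-- Real-valued square-integrable functions on `ℝ³`. -/
abbrev L2 : Type := Lp ℝ 2 (volume : Measure R3)

/-- A real `L²` function seen as a complex one. -/
def complexify (f : L2) : Lp ℂ 2 (volume : Measure R3) :=
  Complex.ofRealCLM.compLp f

/-- The tempered distribution defined by a real `L²` function. -/
def toDistribution (f : L2) : 𝓢'(R3, ℂ) :=
  (complexify f : 𝓢'(R3, ℂ))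

/-- The partial derivative `∂_j` of a tempered distribution. -/
def partialDeriv (j : Fin 3) (T : 𝓢'(R3, ℂ)) : 𝓢'(R3, ℂ) :=
  ∂_{(EuclideanSpace.single j (1 : ℝ) : R3)} T

/-- `div u = 0` in the sense of distributions. -/
def IsDivFree (u : Fin 3 → L2) : Prop :=
  ∑ j, partialDeriv j (toDistribution (u j)) = 0

/-- `g = ∇_h u`, that is `g (j, i) = ∂_j u_i` for the two horizontal directions `j`,
in the sense of distributions. -/
def IsHorizontalGradient (u : Fin 3 → L2) (g : Fin 2 × Fin 3 → L2) : Prop :=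
  ∀ (j : Fin 2) (i : Fin 3),
    partialDeriv j.castSucc (toDistribution (u i)) = toDistribution (g (j, i))

/-- The advection term `u · ∇ u` of a divergence-free field, whose `i`-th component is the
distribution `∑ⱼ ∂ⱼ (uⱼ uᵢ)`. The products `uⱼ uᵢ` are integrable, as `u` is in `L²`. -/
def advection (u : Fin 3 → L2) (i : Fin 3) : 𝓢'(R3, ℂ) :=
  ∑ j, partialDeriv j
    (((complexify (u j) • complexify (u i) : Lp ℂ 1 (volume : Measure R3))) : 𝓢'(R3, ℂ))

/-- The weight of `H^s` at the point `ξ`. Mathlib's Fourier transform has the kernel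
`exp (-2 π i x · ξ)`, so that `ξ` is the angular frequency divided by `2 π`. -/
def sobolevWeight (s : ℝ) (ξ : R3) : ℝ :=
  (1 + (2 * Real.pi * ‖ξ‖) ^ 2) ^ s

/-- The `H^s` norm of a family of `L²` functions, with value `∞` outside `H^s`. -/
def sobolevNorm {ι : Type} [Fintype ι] (s : ℝ) (f : ι → L2) : ℝ≥0∞ :=
  (∑ i, ∫⁻ ξ : R3, ENNReal.ofReal (sobolevWeight s ξ) *
    ‖(𝓕 (complexify (f i)) : Lp ℂ 2 (volume : Measure R3)) ξ‖ₑ ^ 2) ^ (1 / 2 : ℝ)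

/-- The point `(x_h, x_3)`. -/
def joinPoint (y : EuclideanSpace ℝ (Fin 2)) (z : ℝ) : R3 :=
  !₂[y 0, y 1, z]

/-- The norm of `L^r_v (L^p_h)`: the `L^r` norm in `x_3` of the `L^p` norm in `x_h`, of a family
of functions, whose size at a point is its Euclidean length. -/
def mixedNorm {ι : Type} [Fintype ι] (r p : ℝ≥0∞) (f : ι → L2) : ℝ≥0∞ :=
  eLpNorm (fun z : ℝ =>
    eLpNorm (fun y : EuclideanSpace ℝ (Fin 2) =>
      (WithLp.toLp 2 (fun i => f i (joinPoint y z)) : EuclideanSpace ℝ ι)) p volume) r volume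

/-- The Fourier transform of the tempered distribution `T` is the locally integrable
function `F`. -/
def HasFourierTransform (T : 𝓢'(R3, ℂ)) (F : R3 → ℂ) : Prop :=
  LocallyIntegrable F ∧
    ∀ φ : 𝓢(R3, ℂ), Integrable (fun ξ => φ ξ * F ξ) ∧ (𝓕 T) φ = ∫ ξ, φ ξ * F ξ

/-- A smooth compactly supported function of one variable that equals `1` near the origin. -/
def IsCutoff (χ : ℝ → ℝ) : Prop :=
  ContDiff ℝ ∞ χ ∧ HasCompactSupport χ ∧ ∀ᶠ t in 𝓝 (0 : ℝ), χ t = 1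

/-- `⟨f, g⟩_{H^s} = L`, that is `∫ (1 + |2πξ|²)^s f̂ · conj ĝ dξ = L`, where the integral is the
limit as `R → ∞` of its smooth radial truncations to the frequencies of size at most `R`, and
the limit has to be the same for all truncations. If the integrand is absolutely integrable,
then `L` is the ordinary integral. -/
def HasSobolevInner {ι : Type} [Fintype ι] (s : ℝ) (f g : ι → 𝓢'(R3, ℂ)) (L : ℂ) : Prop :=
  ∃ F G : ι → R3 → ℂ,
    (∀ i, HasFourierTransform (f i) (F i)) ∧
    (∀ i, HasFourierTransform (g i) (G i)) ∧
    (∀ i, LocallyIntegrable (fun ξ => F i ξ * conj (G i ξ))) ∧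
    ∀ χ : ℝ → ℝ, IsCutoff χ →
      Tendsto (fun R : ℝ => ∫ ξ : R3,
          ((χ (‖ξ‖ / R) * sobolevWeight s ξ : ℝ) : ℂ) * ∑ i, F i ξ * conj (G i ξ))
        atTop (𝓝 L)

end AnisotropicFluid

end

open AnisotropicFluid

namespace AnisotropicFluid

/-! ### Fourier transforms and trilinear forms -/

/-! Write V for the Fourier transform of u and ω for the Sobolev weight. The pairing truncated by a
radial even multiplier m is 2πi times the double integral of m(η+ζ) against `advectionDensity`, a
cubic expression in V(η), V(ζ), V(η+ζ). Since u is real and divergence free, the reflection ζ ↦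
-(η+ζ) changes the sign of this density, so m(η+ζ) may be replaced by half of m(η+ζ) - m(ζ). This
commutator form has an integrable majorant independent of the truncation, hence the limit exists,
does not depend on the cutoff, and equals πi times `commutator`.

The majorant (`IsRadialMultiplier.norm_sub_mul_advectionDensity_le`) uses the mean value theorem for
m and the divergence condition, which replaces every vertical frequency by horizontal ones. What is
left is a product of two L² factors and one L¹ factor. The L¹ bound on V comes from Cauchy–Schwarz,
because ω(ξ)(1+|ξ_h|²) has an integrable inverse exactly when s > 1/2
(`integrable_inv_anisotropic_weight`). The estimate itself needs only s > 0.

For the bound, the field is made band-limited and the pair (ξ, ζ), with ξ = η+ζ, is cut into dyadic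
shells. Every piece becomes an integral of three functions in physical space. On each horizontal
plane Hölder with exponents 2, 4, 4 and Ladyzhenskaya's inequality apply; in height one function is
taken in L^∞ and the other two in L².

If ξ and ζ lie in distant shells, then |η| is at least comparable to 2^q, and the weight and any
vertical derivative can be moved to U(η) (`sum_farTerm_le`, `sum_farTerm_vertical_le`). If the
shells are adjacent and the derivative is horizontal, no cancellation is needed (`sum_nearTerm_le`).
If it is vertical, the difference ω(ξ) - ω(ζ) is expanded in a binomial series, which moves one
derivative to u_3 and gains 2^(-q) (`sum_nearTerm_vertical_le`); this case alone gives the second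
term of the bound. Low-pass kernels have an L¹ norm independent of the frequency, so the anisotropic
suprema survive the truncation and dominated convergence removes it. -/

lemma ae_eq_of_forall_schwartz {F G : R3 → ℂ} (hF : LocallyIntegrable F)
    (hG : LocallyIntegrable G) (h : ∀ φ : 𝓢(R3, ℂ), ∫ x, φ x * F x = ∫ x, φ x * G x) :
    F =ᵐ[volume] G := by
  refine ae_eq_of_integral_contDiff_smul_eq hF hG fun g hg hgc => ?_
  have hc : HasCompactSupport (fun x => (g x : ℂ)) := hgc.comp_left (g := fun t : ℝ => (t : ℂ)) (by simp)
  have hs : ContDiff ℝ ∞ (fun x => (g x : ℂ)) := Complex.ofRealCLM.contDiff.comp hg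
  have := h (hc.toSchwartzMap hs)
  simpa using this

lemma integral_fourier_mul {f g : R3 → ℂ} (hf : Integrable f) (hg : Integrable g) :
    ∫ x, 𝓕 f x * g x = ∫ x, f x * 𝓕 g x := by
  have := VectorFourier.integral_fourierIntegral_smul_eq_flip (μ := volume) (ν := volume)
    (L := innerₗ R3) Real.continuous_fourierChar continuous_inner hf hg
  rw [flip_innerₗ] at this
  exact this

lemma integral_fourierInv_mul {f g : R3 → ℂ} (hf : Integrable f) (hg : Integrable g) :
    ∫ x, 𝓕⁻ f x * g x = ∫ x, f x * 𝓕⁻ g x := by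
  have h1 : ∫ x, 𝓕⁻ f x * g x = ∫ x, 𝓕 f x * g (-x) := by
    rw [← integral_neg_eq_self]
    simp [Real.fourierInv_eq_fourier_neg]
  have h2 : 𝓕 (fun x => g (-x)) = 𝓕⁻ g := by
    rw [Real.fourierInv_eq_fourier_comp_neg]
  rw [h1, integral_fourier_mul hf hg.comp_neg, h2]

lemma continuous_fourierInv {f : R3 → ℂ} (hf : Integrable f) : Continuous (𝓕⁻ f) := by
  have : 𝓕⁻ f = fun x => 𝓕 f (-x) := by
    ext x; exact Real.fourierInv_eq_fourier_neg _ _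
  rw [this]
  exact (VectorFourier.fourierIntegral_continuous Real.continuous_fourierChar
    continuous_inner hf).comp continuous_neg

/-- Testing against Schwartz functions identifies the inverse transform obtained by extension to L²
with the one given by the integral. -/
lemma fourierInv_toLp_ae {f : R3 → ℂ} (hf : Integrable f) (hf2 : MemLp f 2) :
    ((𝓕⁻ (hf2.toLp f) : Lp ℂ 2 (volume : Measure R3)) : R3 → ℂ) =ᵐ[volume] 𝓕⁻ f := by
  refine ae_eq_of_forall_schwartz ?_ (continuous_fourierInv hf).locallyIntegrable fun φ => ?_
  · exact (Lp.memLp _).locallyIntegrable (by norm_num)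
  · have h1 := congrArg (fun T : 𝓢'(R3, ℂ) => T φ)
      (Lp.fourierInv_toTemperedDistribution_eq (hf2.toLp f))
    simp only [TemperedDistribution.fourierInv_apply, Lp.toTemperedDistribution_apply,
      smul_eq_mul] at h1
    rw [← h1, ← integral_fourierInv_mul φ.integrable hf, SchwartzMap.fourierInv_coe]
    refine integral_congr_ae ?_
    filter_upwards [hf2.coeFn_toLp] with x hx
    rw [hx]

lemma eLpNorm_fourierInv {f : R3 → ℂ} (hf : Integrable f) (hf2 : MemLp f 2) :
    eLpNorm (𝓕⁻ f) 2 = eLpNorm f 2 := by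
  rw [← eLpNorm_congr_ae (fourierInv_toLp_ae hf hf2), ← eLpNorm_congr_ae hf2.coeFn_toLp,
    ← Lp.enorm_def, ← Lp.enorm_def, ← ofReal_norm, ← ofReal_norm]
  congr 1
  exact (Lp.fourierTransformₗᵢ R3 ℂ).symm.norm_map _

lemma integral_fourierInv_mul_conj {f g : R3 → ℂ} (hf : Integrable f) (hf2 : MemLp f 2)
    (hg : Integrable g) (hg2 : MemLp g 2) :
    ∫ x, 𝓕⁻ f x * conj (𝓕⁻ g x) = ∫ ξ, f ξ * conj (g ξ) := by
  have h := (Lp.fourierTransformₗᵢ R3 ℂ).symm.inner_map_map (hg2.toLp g) (hf2.toLp f)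
  rw [L2.inner_def, L2.inner_def] at h
  simp only [RCLike.inner_apply] at h
  calc _ = _ := ?_
    _ = _ := h
    _ = _ := ?_
  · refine integral_congr_ae ?_
    filter_upwards [fourierInv_toLp_ae hf hf2, fourierInv_toLp_ae hg hg2] with x h1 h2
    rw [← h1, ← h2]; rfl
  · refine integral_congr_ae ?_
    filter_upwards [hf2.coeFn_toLp, hg2.coeFn_toLp] with x h1 h2
    rw [h1, h2]

/-! ### Trilinear forms with one L¹ and two L² factors. -/

/-- Cauchy–Schwarz for lower integrals. -/
lemma lintegral_mul_le_sqrt {α : Type*} [MeasurableSpace α] {μ : Measure α} {F G : α → ℝ≥0∞}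
    (hF : AEMeasurable F μ) (hG : AEMeasurable G μ) :
    ∫⁻ x, F x * G x ∂μ ≤ (∫⁻ x, F x ^ 2 ∂μ) ^ (1 / 2 : ℝ) * (∫⁻ x, G x ^ 2 ∂μ) ^ (1 / 2 : ℝ) := by
  have := ENNReal.lintegral_mul_le_Lp_mul_Lq μ Real.HolderConjugate.two_two hF hG
  simpa using this

/-- For fixed x, Cauchy–Schwarz in y and translation invariance remove the dependence on x from all
but F. -/
lemma lintegral_trilinear_le_left {F G H : R3 → ℝ≥0∞} (hF : Measurable F) (hG : Measurable G)
    (hH : Measurable H) :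
    ∫⁻ p : R3 × R3, F p.1 * G p.2 * H (p.1 + p.2) ≤
      (∫⁻ x, F x) * (∫⁻ x, G x ^ 2) ^ (1 / 2 : ℝ) * (∫⁻ x, H x ^ 2) ^ (1 / 2 : ℝ) := by
  rw [Measure.volume_eq_prod, lintegral_prod _ (by fun_prop)]
  have key : ∀ x : R3, ∫⁻ y, F x * G y * H (x + y) ≤
      F x * ((∫⁻ x, G x ^ 2) ^ (1 / 2 : ℝ) * (∫⁻ x, H x ^ 2) ^ (1 / 2 : ℝ)) := by
    intro x
    simp_rw [mul_assoc]
    rw [lintegral_const_mul _ (by fun_prop)]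
    gcongr
    refine (lintegral_mul_le_sqrt hG.aemeasurable (by fun_prop)).trans_eq ?_
    rw [lintegral_add_left_eq_self (fun y => H y ^ 2) x]
  refine (lintegral_mono key).trans_eq ?_
  rw [lintegral_mul_const _ hF, mul_assoc]

lemma lintegral_trilinear_le_right {F G H : R3 → ℝ≥0∞} (hF : Measurable F) (hG : Measurable G)
    (hH : Measurable H) :
    ∫⁻ p : R3 × R3, F p.1 * G p.2 * H (p.1 + p.2) ≤
      (∫⁻ x, F x ^ 2) ^ (1 / 2 : ℝ) * (∫⁻ x, G x) * (∫⁻ x, H x ^ 2) ^ (1 / 2 : ℝ) := by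
  have h := lintegral_trilinear_le_left hG hF hH
  rw [mul_comm (∫⁻ x, G x)] at h
  refine le_trans (le_of_eq ?_) h
  rw [Measure.volume_eq_prod, ← lintegral_prod_swap]
  simp only [Prod.fst_swap, Prod.snd_swap]
  refine lintegral_congr fun p => ?_
  rw [add_comm p.2, mul_comm (F p.2)]

lemma lintegral_trilinear_le_sum {F G H : R3 → ℝ≥0∞} (hF : Measurable F) (hG : Measurable G)
    (hH : Measurable H) :
    ∫⁻ p : R3 × R3, F p.1 * G p.2 * H (p.1 + p.2) ≤
      (∫⁻ x, F x ^ 2) ^ (1 / 2 : ℝ) * (∫⁻ x, G x ^ 2) ^ (1 / 2 : ℝ) * (∫⁻ x, H x) := by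
  -- Reflecting the first variable and then shifting the second by it moves H to the second slot and
  -- G to the slot of the sum.
  have h := lintegral_trilinear_le_right (F := fun x => F (-x)) (hF.comp measurable_neg) hH hG
  have e : ∫⁻ x, F (-x) ^ 2 = ∫⁻ x, F x ^ 2 :=
    lintegral_neg_eq_self (fun x => F x ^ 2)
  rw [e] at h
  refine le_trans (le_of_eq ?_) (h.trans_eq (by ring))
  rw [Measure.volume_eq_prod, lintegral_prod _ (by fun_prop), lintegral_prod _ (by fun_prop)]
  rw [← lintegral_neg_eq_self]
  refine lintegral_congr fun x => ?_
  rw [← lintegral_add_left_eq_self _ x]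
  refine lintegral_congr fun y => ?_
  rw [neg_add_cancel_left]
  ring


/-- The trilinear form `∫∫ f(η) g(ζ) conj h(η + ζ)`. -/
noncomputable def trilinear (f g h : R3 → ℂ) : ℂ :=
  ∫ p : R3 × R3, f p.1 * g p.2 * conj (h (p.1 + p.2))

lemma lintegral_enorm_sq_ne_top {f : R3 → ℂ} (hf : MemLp f 2) : ∫⁻ x, ‖f x‖ₑ ^ 2 ≠ ⊤ := by
  have := hf.2
  rw [eLpNorm_lt_top_iff_lintegral_rpow_enorm_lt_top (by norm_num) (by norm_num)] at this
  simpa using this.ne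

lemma integrable_trilinear_left {f g h : R3 → ℂ} (hfm : Measurable f) (hgm : Measurable g)
    (hhm : Measurable h) (hf : Integrable f) (hg : MemLp g 2) (hh : MemLp h 2) :
    Integrable (fun p : R3 × R3 => f p.1 * g p.2 * conj (h (p.1 + p.2))) := by
  have hc : Measurable fun p : R3 × R3 => conj (h (p.1 + p.2)) :=
    Complex.continuous_conj.measurable.comp (hhm.comp measurable_add)
  refine ⟨(((hfm.comp measurable_fst).mul (hgm.comp measurable_snd)).mul hc).aestronglyMeasurable, ?_⟩
  rw [HasFiniteIntegral]
  simp only [enorm_mul, RCLike.enorm_conj]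
  refine (lintegral_trilinear_le_left hfm.enorm hgm.enorm hhm.enorm).trans_lt ?_
  have h1 : ∫⁻ x, ‖f x‖ₑ < ⊤ := hf.2
  have h2 := (lintegral_enorm_sq_ne_top hg).lt_top
  have h3 := (lintegral_enorm_sq_ne_top hh).lt_top
  exact ENNReal.mul_lt_top (ENNReal.mul_lt_top h1 (ENNReal.rpow_lt_top_of_nonneg (by norm_num) h2.ne))
    (ENNReal.rpow_lt_top_of_nonneg (by norm_num) h3.ne)

/-! ### Convolution of profiles and passage to physical space. -/

/-- The convolution of two functions on frequency space. -/
noncomputable def freqConv (f g : R3 → ℂ) (ξ : R3) : ℂ := ∫ η, f η * g (ξ - η)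

lemma freqConv_eq (f g : R3 → ℂ) :
    freqConv f g = convolution f g (ContinuousLinearMap.mul ℂ ℂ) volume := by
  ext ξ; rfl

lemma integrable_freqConv {f g : R3 → ℂ} (hf : Integrable f) (hg : Integrable g) :
    Integrable (freqConv f g) := by
  rw [freqConv_eq]
  exact hf.integrable_convolution _ hg

lemma fourierInv_freqConv {f g : R3 → ℂ} (hf : Integrable f) (hg : Integrable g) (x : R3) :
    𝓕⁻ (freqConv f g) x = 𝓕⁻ f x * 𝓕⁻ g x := by
  simp only [Real.fourierInv_eq_fourier_neg]
  rw [freqConv_eq]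
  exact Real.fourier_mul_convolution_eq hf hg _

lemma enorm_freqConv_le {f g : R3 → ℂ} (hf : Measurable f) (hg : Measurable g) (ξ : R3) :
    ‖freqConv f g ξ‖ₑ ≤
      (∫⁻ x, ‖f x‖ₑ ^ 2) ^ (1 / 2 : ℝ) * (∫⁻ x, ‖g x‖ₑ ^ 2) ^ (1 / 2 : ℝ) := by
  refine (enorm_integral_le_lintegral_enorm _).trans ?_
  simp only [enorm_mul]
  refine (lintegral_mul_le_sqrt hf.enorm.aemeasurable (by fun_prop)).trans_eq ?_
  rw [lintegral_sub_left_eq_self (fun y => ‖g y‖ₑ ^ 2) ξ]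

lemma exists_norm_freqConv_le {f g : R3 → ℂ} (hf : Measurable f) (hg : Measurable g)
    (hf2 : MemLp f 2) (hg2 : MemLp g 2) : ∃ C, ∀ ξ, ‖freqConv f g ξ‖ ≤ C := by
  refine ⟨((∫⁻ x, ‖f x‖ₑ ^ 2) ^ (1 / 2 : ℝ) * (∫⁻ x, ‖g x‖ₑ ^ 2) ^ (1 / 2 : ℝ)).toReal,
    fun ξ => ?_⟩
  rw [← toReal_enorm]
  refine ENNReal.toReal_mono ?_ (enorm_freqConv_le hf hg ξ)
  exact ENNReal.mul_ne_top
    (ENNReal.rpow_ne_top_of_nonneg (by norm_num) (lintegral_enorm_sq_ne_top hf2))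
    (ENNReal.rpow_ne_top_of_nonneg (by norm_num) (lintegral_enorm_sq_ne_top hg2))

/-- Integrability comes from the L¹ bounds and boundedness from the L² bounds; together they give
square integrability. -/
lemma memLp_freqConv {f g : R3 → ℂ} (hf : Measurable f) (hg : Measurable g)
    (hf1 : Integrable f) (hg1 : Integrable g) (hf2 : MemLp f 2) (hg2 : MemLp g 2) :
    MemLp (freqConv f g) 2 := by
  obtain ⟨C, hC⟩ := exists_norm_freqConv_le hf hg hf2 hg2
  have hi := integrable_freqConv hf1 hg1
  refine (memLp_two_iff_integrable_sq_norm hi.1).2 ?_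
  simp_rw [pow_two]
  exact hi.norm.bdd_mul hi.1.norm (c := C) (Eventually.of_forall fun ξ => by simpa using hC ξ)

/-- Change of variables `ξ = η + ζ`. -/
lemma integral_trilinear_eq (k : R3 → R3 → R3 → ℂ) :
    ∫ p : R3 × R3, k p.1 p.2 (p.1 + p.2) = ∫ p : R3 × R3, k p.1 (p.2 - p.1) p.2 := by
  have h := measurePreserving_prod_add (volume : Measure R3) (volume : Measure R3)
  have he : MeasurableEmbedding fun z : R3 × R3 => (z.1, z.1 + z.2) :=
    (MeasurableEquiv.shearAddRight R3).measurableEmbedding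
  have := h.integral_comp he (fun p : R3 × R3 => k p.1 (p.2 - p.1) p.2)
  simpa [Measure.volume_eq_prod] using this

lemma integrable_shear_iff (k : R3 → R3 → R3 → ℂ) :
    Integrable (fun p : R3 × R3 => k p.1 p.2 (p.1 + p.2)) ↔
      Integrable (fun p : R3 × R3 => k p.1 (p.2 - p.1) p.2) := by
  have h := measurePreserving_prod_add (volume : Measure R3) (volume : Measure R3)
  have he : MeasurableEmbedding fun z : R3 × R3 => (z.1, z.1 + z.2) :=
    (MeasurableEquiv.shearAddRight R3).measurableEmbedding
  have := h.integrable_comp_emb he (g := fun p : R3 × R3 => k p.1 (p.2 - p.1) p.2)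
  rw [← Measure.volume_eq_prod] at this
  simpa [Function.comp_def] using this

lemma trilinear_eq_integral_freqConv {f g h : R3 → ℂ} (hfm : Measurable f) (hgm : Measurable g)
    (hhm : Measurable h) (hf : Integrable f) (hg : MemLp g 2) (hh : MemLp h 2) :
    trilinear f g h = ∫ ξ, freqConv f g ξ * conj (h ξ) := by
  have hi := (integrable_shear_iff fun a b c => f a * g b * conj (h c)).1
    (integrable_trilinear_left hfm hgm hhm hf hg hh)
  rw [trilinear, integral_trilinear_eq fun a b c => f a * g b * conj (h c)]
  rw [Measure.volume_eq_prod] at hi ⊢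
  rw [integral_prod_symm _ hi]
  refine integral_congr_ae (Eventually.of_forall fun ξ => ?_)
  simp only [freqConv]
  rw [integral_mul_const]

/-- Parseval and the convolution theorem. This is the passage to physical space, where Hölder's
inequality on horizontal slices is available. -/
lemma trilinear_eq_integral_fourierInv {f g h : R3 → ℂ} (hfm : Measurable f) (hgm : Measurable g)
    (hhm : Measurable h) (hf : Integrable f) (hg : Integrable g) (hh : Integrable h)
    (hf2 : MemLp f 2) (hg2 : MemLp g 2) (hh2 : MemLp h 2) :
    trilinear f g h = ∫ x, 𝓕⁻ f x * 𝓕⁻ g x * conj (𝓕⁻ h x) := by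
  rw [trilinear_eq_integral_freqConv hfm hgm hhm hf hg2 hh2,
    ← integral_fourierInv_mul_conj (integrable_freqConv hf hg)
      (memLp_freqConv hfm hgm hf hg hf2 hg2) hh hh2]
  simp only [fourierInv_freqConv hf hg]

lemma enorm_trilinear_le {f g h : R3 → ℂ} (hfm : Measurable f) (hgm : Measurable g)
    (hhm : Measurable h) (hf : Integrable f) (hg : Integrable g) (hh : Integrable h)
    (hf2 : MemLp f 2) (hg2 : MemLp g 2) (hh2 : MemLp h 2) :
    ‖trilinear f g h‖ₑ ≤ ∫⁻ x, ‖𝓕⁻ f x‖ₑ * ‖𝓕⁻ g x‖ₑ * ‖𝓕⁻ h x‖ₑ := by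
  rw [trilinear_eq_integral_fourierInv hfm hgm hhm hf hg hh hf2 hg2 hh2]
  refine (enorm_integral_le_lintegral_enorm _).trans_eq ?_
  simp only [enorm_mul, RCLike.enorm_conj]

/-! ### Coordinates -/

/-- The horizontal plane. -/
abbrev R2 : Type := EuclideanSpace ℝ (Fin 2)

lemma continuous_joinPoint : Continuous fun p : R2 × ℝ => joinPoint p.1 p.2 := by
  unfold joinPoint
  refine (PiLp.continuous_toLp 2 _).comp (continuous_pi fun i => ?_)
  fin_cases i <;> simp <;> fun_prop

@[fun_prop]
lemma measurable_joinPoint : Measurable fun p : R2 × ℝ => joinPoint p.1 p.2 :=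
  continuous_joinPoint.measurable

lemma measurePreserving_joinPoint :
    MeasurePreserving (fun p : ℝ × R2 => joinPoint p.2 p.1) volume volume := by
  have h1 := (EuclideanSpace.volume_preserving_symm_measurableEquiv_toLp (Fin 3)).symm
  -- Splitting off the last coordinate puts the height first, so that it is the outer variable in
  -- Fubini's theorem.
  have h2 := (volume_preserving_piFinSuccAbove (fun _ : Fin 3 => ℝ) (Fin.last 2)).symm
  have h3 : MeasurePreserving (Prod.map id (MeasurableEquiv.toLp 2 (Fin 2 → ℝ)).symm :
      ℝ × R2 → ℝ × (Fin 2 → ℝ)) volume volume :=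
    (MeasurePreserving.id volume).prod
      (EuclideanSpace.volume_preserving_symm_measurableEquiv_toLp (Fin 2))
  have h := h1.comp (h2.comp h3)
  have e : (fun p : ℝ × R2 => joinPoint p.2 p.1) =
      (MeasurableEquiv.toLp 2 (Fin 3 → ℝ)).symm.symm ∘
        (MeasurableEquiv.piFinSuccAbove (fun _ : Fin 3 => ℝ) (Fin.last 2)).symm ∘
          Prod.map id (MeasurableEquiv.toLp 2 (Fin 2 → ℝ)).symm := by
    funext p
    refine PiLp.ext fun i => ?_
    fin_cases i <;> rfl
  rw [e]
  exact h

lemma lintegral_joinPoint {F : R3 → ℝ≥0∞} (hF : Measurable F) :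
    ∫⁻ x, F x = ∫⁻ z, ∫⁻ y, F (joinPoint y z) := by
  rw [← measurePreserving_joinPoint.lintegral_comp hF, Measure.volume_eq_prod,
    lintegral_prod _ (by fun_prop)]

lemma lintegral_plane {G : R2 → ℝ≥0∞} (hG : Measurable G) :
    ∫⁻ y, G y = ∫⁻ s, ∫⁻ t, G !₂[s, t] := by
  have h := (EuclideanSpace.volume_preserving_symm_measurableEquiv_toLp (Fin 2)).symm.comp
    (volume_preserving_finTwoArrow ℝ).symm
  have e : ∀ p : ℝ × ℝ, ((MeasurableEquiv.toLp 2 (Fin 2 → ℝ)).symm.symm ∘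
      (MeasurableEquiv.finTwoArrow (α := ℝ)).symm) p = !₂[p.1, p.2] := by
    intro p
    ext i
    fin_cases i <;> rfl
  rw [← h.lintegral_comp hG, Measure.volume_eq_prod, lintegral_prod]
  · simp only [e]
  · exact (hG.comp h.measurable).aemeasurable

/-! ### Ladyzhenskaya's inequality -/

/-- The function |g|² and its derivative are integrable, so |g|² vanishes at -∞ and is the integral
of 2 Re(g' conj g) from there. If the right side is infinite there is nothing to prove. -/
lemma enorm_sq_le_lintegral {g g' : ℝ → ℂ} (hg : ∀ t, HasDerivAt g (g' t) t)
    (hg' : Continuous g') (hint : ∫⁻ t, ‖g t‖ₑ ^ 2 ≠ ⊤) (t : ℝ) :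
    ‖g t‖ₑ ^ 2 ≤ 2 * ∫⁻ t, ‖g t‖ₑ * ‖g' t‖ₑ := by
  by_cases hfin : ∫⁻ t, ‖g t‖ₑ * ‖g' t‖ₑ = ⊤
  · simp [hfin]
  have hgc : Continuous g := continuous_iff_continuousAt.2 fun t => (hg t).continuousAt
  have hd : ∀ t, HasDerivAt (fun t => ‖g t‖ ^ 2) (2 * inner ℝ (g t) (g' t)) t :=
    fun t => (hg t).norm_sq
  have hbound : ∀ t, ‖2 * inner ℝ (g t) (g' t)‖ₑ ≤ 2 * (‖g t‖ₑ * ‖g' t‖ₑ) := by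
    intro t
    rw [enorm_mul]
    have : ‖(2 : ℝ)‖ₑ = 2 := by
      rw [Real.enorm_eq_ofReal (by norm_num)]; simp
    rw [this]
    gcongr
    rw [← enorm_mul, enorm_le_iff_norm_le, norm_mul]
    exact norm_inner_le_norm _ _
  have hdint : Integrable fun t => 2 * inner ℝ (g t) (g' t) := by
    refine ⟨(by fun_prop : Continuous _).aestronglyMeasurable, ?_⟩
    refine (lintegral_mono hbound).trans_lt ?_
    rw [lintegral_const_mul _ (by fun_prop)]
    exact ENNReal.mul_lt_top (by norm_num) (Ne.lt_top hfin)
  have hsint : Integrable fun t => ‖g t‖ ^ 2 := by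
    refine ⟨(by fun_prop : Continuous _).aestronglyMeasurable, ?_⟩
    rw [HasFiniteIntegral]
    simpa using hint.lt_top
  have hlim := tendsto_zero_of_hasDerivAt_of_integrableOn_Iic (a := t) (fun x _ => hd x)
    hdint.integrableOn hsint.integrableOn
  have hI := integral_Iic_of_hasDerivAt_of_tendsto (a := t)
    (hd t).continuousAt.continuousWithinAt (fun x _ => hd x) hdint.integrableOn hlim
  have : ‖g t‖ₑ ^ 2 = ‖‖g t‖ ^ 2‖ₑ := by simp
  rw [this, ← sub_zero (‖g t‖ ^ 2), ← hI]
  refine (enorm_integral_le_lintegral_enorm _).trans ((setLIntegral_le_lintegral _ _).trans ?_)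
  refine (lintegral_mono hbound).trans_eq ?_
  rw [lintegral_const_mul _ (by fun_prop)]

lemma sqrt_mul_sqrt_le (a b : ℝ≥0∞) :
    a ^ (1 / 2 : ℝ) * b ^ (1 / 2 : ℝ) * (a ^ (1 / 2 : ℝ) * b ^ (1 / 2 : ℝ)) = a * b := by
  rw [← ENNReal.mul_rpow_of_nonneg _ _ (by norm_num), ← ENNReal.rpow_add_of_nonneg _ _
    (by norm_num) (by norm_num)]
  norm_num

/-- One copy of |f|² is bounded by its supremum A(y) along a horizontal line and the other by its
supremum B(x) along a vertical line. The product B(x) A(y) integrates to a product of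
one-dimensional integrals, each controlled by Cauchy–Schwarz. -/
lemma ladyzhenskaya {f fx fy : ℝ → ℝ → ℂ} (hf : Continuous (Function.uncurry f))
    (hfx : Continuous (Function.uncurry fx)) (hfy : Continuous (Function.uncurry fy))
    (hdx : ∀ x y, HasDerivAt (fun x => f x y) (fx x y) x)
    (hdy : ∀ x y, HasDerivAt (fun y => f x y) (fy x y) y)
    (hint : ∫⁻ x, ∫⁻ y, ‖f x y‖ₑ ^ 2 ≠ ⊤) :
    ∫⁻ x, ∫⁻ y, ‖f x y‖ₑ ^ 4 ≤ 4 * ((∫⁻ x, ∫⁻ y, ‖f x y‖ₑ ^ 2) *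
      ((∫⁻ x, ∫⁻ y, ‖fx x y‖ₑ ^ 2) + ∫⁻ x, ∫⁻ y, ‖fy x y‖ₑ ^ 2)) := by
  have hfm : Measurable fun p : ℝ × ℝ => ‖f p.1 p.2‖ₑ := hf.measurable.enorm
  have hfxm : Measurable fun p : ℝ × ℝ => ‖fx p.1 p.2‖ₑ := hfx.measurable.enorm
  have hfym : Measurable fun p : ℝ × ℝ => ‖fy p.1 p.2‖ₑ := hfy.measurable.enorm
  have hf2 : Measurable fun p : ℝ × ℝ => ‖f p.1 p.2‖ₑ ^ 2 := hfm.pow_const 2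
  set I := ∫⁻ x, ∫⁻ y, ‖f x y‖ₑ ^ 2 with hI
  set D1 := ∫⁻ x, ∫⁻ y, ‖fx x y‖ₑ ^ 2 with hD1
  set D2 := ∫⁻ x, ∫⁻ y, ‖fy x y‖ₑ ^ 2 with hD2
  have hI' : ∫⁻ y, ∫⁻ x, ‖f x y‖ₑ ^ 2 = I := by
    rw [hI, lintegral_lintegral_swap (f := fun y x => ‖f x y‖ₑ ^ 2)
      (hf2.comp measurable_swap).aemeasurable]
  let A : ℝ → ℝ≥0∞ := fun y => 2 * ∫⁻ x, ‖f x y‖ₑ * ‖fx x y‖ₑ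
  let B : ℝ → ℝ≥0∞ := fun x => 2 * ∫⁻ y, ‖f x y‖ₑ * ‖fy x y‖ₑ
  have hfxc : ∀ y, Continuous fun x => fx x y := fun y => hfx.comp (by fun_prop : Continuous fun x => (x, y))
  have hfyc : ∀ x, Continuous fun y => fy x y := fun x => hfy.comp (by fun_prop : Continuous fun y => (x, y))
  have hA : ∀ᵐ y, ∀ x, ‖f x y‖ₑ ^ 2 ≤ A y := by
    have : ∀ᵐ y, ∫⁻ x, ‖f x y‖ₑ ^ 2 < ⊤ := by
      refine ae_lt_top ?_ (by rw [hI']; exact hint)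
      exact Measurable.lintegral_prod_left' hf2
    filter_upwards [this] with y hy x
    exact enorm_sq_le_lintegral (fun t => hdx t y) (hfxc y) hy.ne x
  have hB : ∀ᵐ x, ∀ y, ‖f x y‖ₑ ^ 2 ≤ B x := by
    have : ∀ᵐ x, ∫⁻ y, ‖f x y‖ₑ ^ 2 < ⊤ := by
      refine ae_lt_top ?_ hint
      exact Measurable.lintegral_prod_right' hf2
    filter_upwards [this] with x hx y
    exact enorm_sq_le_lintegral (fun t => hdy x t) (hfyc x) hx.ne y
  -- Both factors are given the same bound with D1 + D2, so that their product contains no square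
  -- root.
  have hAint : ∫⁻ y, A y ≤ 2 * (I ^ (1 / 2 : ℝ) * (D1 + D2) ^ (1 / 2 : ℝ)) := by
    have hm : Measurable fun p : ℝ × ℝ => ‖f p.1 p.2‖ₑ * ‖fx p.1 p.2‖ₑ := hfm.mul hfxm
    rw [lintegral_const_mul _ (Measurable.lintegral_prod_left' hm)]
    gcongr
    rw [lintegral_lintegral_swap (f := fun y x => ‖f x y‖ₑ * ‖fx x y‖ₑ)
      (hm.comp measurable_swap).aemeasurable,
      lintegral_lintegral (f := fun x y => ‖f x y‖ₑ * ‖fx x y‖ₑ) hm.aemeasurable]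
    refine (lintegral_mul_le_sqrt hfm.aemeasurable hfxm.aemeasurable).trans ?_
    rw [lintegral_prod _ hf2.aemeasurable, lintegral_prod _ (hfxm.pow_const 2).aemeasurable]
    gcongr
    exact le_self_add
  have hBint : ∫⁻ x, B x ≤ 2 * (I ^ (1 / 2 : ℝ) * (D1 + D2) ^ (1 / 2 : ℝ)) := by
    have hm : Measurable fun p : ℝ × ℝ => ‖f p.1 p.2‖ₑ * ‖fy p.1 p.2‖ₑ := hfm.mul hfym
    rw [lintegral_const_mul _ (Measurable.lintegral_prod_right' hm)]
    gcongr
    rw [lintegral_lintegral (f := fun x y => ‖f x y‖ₑ * ‖fy x y‖ₑ) hm.aemeasurable]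
    refine (lintegral_mul_le_sqrt hfm.aemeasurable hfym.aemeasurable).trans ?_
    rw [lintegral_prod _ hf2.aemeasurable, lintegral_prod _ (hfym.pow_const 2).aemeasurable]
    gcongr
    exact le_add_self
  calc ∫⁻ x, ∫⁻ y, ‖f x y‖ₑ ^ 4 ≤ ∫⁻ x, ∫⁻ y, B x * A y := by
        refine lintegral_mono_ae ?_
        filter_upwards [hB] with x hx
        refine lintegral_mono_ae ?_
        filter_upwards [hA] with y hy
        calc ‖f x y‖ₑ ^ 4 = ‖f x y‖ₑ ^ 2 * ‖f x y‖ₑ ^ 2 := by ring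
          _ ≤ _ := mul_le_mul' (hx y) (hy x)
    _ = (∫⁻ x, B x) * ∫⁻ y, A y := by
        have hAm : Measurable A := (Measurable.lintegral_prod_left' (hfm.mul hfxm)).const_mul 2
        have hBm : Measurable B := (Measurable.lintegral_prod_right' (hfm.mul hfym)).const_mul 2
        simp_rw [lintegral_const_mul _ hAm]
        rw [lintegral_mul_const _ hBm]
    _ ≤ _ := mul_le_mul' hBint hAint
    _ = _ := by
        rw [← sqrt_mul_sqrt_le I (D1 + D2)]; ring

/-! ### Band-limited functions -/

/-- Frequency profiles of band-limited `L²` functions. -/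
structure IsBandLimited (f : R3 → ℂ) : Prop where
  measurable : Measurable f
  memLp : MemLp f 2
  bounded_support : ∃ R : ℝ, ∀ ξ, R < ‖ξ‖ → f ξ = 0

lemma IsBandLimited.mul {f m : R3 → ℂ} (hf : IsBandLimited f) (hm : Measurable m)
    (hb : ∀ R : ℝ, ∃ C : ℝ, ∀ ξ, ‖ξ‖ ≤ R → ‖m ξ‖ ≤ C) : IsBandLimited fun ξ => m ξ * f ξ := by
  obtain ⟨R, hR⟩ := hf.bounded_support
  obtain ⟨C, hC⟩ := hb R
  refine ⟨hm.mul hf.measurable, ?_, R, fun ξ h => by simp [hR ξ h]⟩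
  refine hf.memLp.of_le_mul (c := C) (hm.mul hf.measurable).aestronglyMeasurable
    (Eventually.of_forall fun ξ => ?_)
  by_cases h : ‖ξ‖ ≤ R
  · rw [norm_mul]
    gcongr
    exact hC ξ h
  · simp [hR ξ (not_le.1 h)]

lemma IsBandLimited.mul_continuous {f m : R3 → ℂ} (hf : IsBandLimited f) (hm : Continuous m) :
    IsBandLimited fun ξ => m ξ * f ξ := by
  refine hf.mul hm.measurable fun R => ?_
  obtain ⟨C, hC⟩ := (isCompact_closedBall (0 : R3) R).exists_bound_of_continuousOn hm.continuousOn
  exact ⟨C, fun ξ h => hC ξ (by simpa using h)⟩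

lemma IsBandLimited.integrable {f : R3 → ℂ} (hf : IsBandLimited f) : Integrable f := by
  obtain ⟨R, hR⟩ := hf.bounded_support
  have h1 : IntegrableOn f (Metric.closedBall 0 R) :=
    (hf.memLp.locallyIntegrable (by norm_num)).integrableOn_isCompact (isCompact_closedBall _ _)
  refine (integrableOn_iff_integrable_of_support_subset fun ξ h => ?_).1 h1
  by_contra h'
  exact h (hR ξ (by simpa using h'))

lemma IsBandLimited.add {f g : R3 → ℂ} (hf : IsBandLimited f) (hg : IsBandLimited g) :
    IsBandLimited fun ξ => f ξ + g ξ := by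
  obtain ⟨R, hR⟩ := hf.bounded_support
  obtain ⟨R', hR'⟩ := hg.bounded_support
  refine ⟨hf.measurable.add hg.measurable, hf.memLp.add hg.memLp, max R R', fun ξ h => ?_⟩
  rw [hR ξ (lt_of_le_of_lt (le_max_left _ _) h), hR' ξ (lt_of_le_of_lt (le_max_right _ _) h),
    add_zero]

/-- Multiplication by the `j`-th frequency coordinate. -/
def mulCoord (j : Fin 3) (f : R3 → ℂ) (ξ : R3) : ℂ := (ξ j : ℂ) * f ξ

lemma IsBandLimited.mulCoord {f : R3 → ℂ} (hf : IsBandLimited f) (j : Fin 3) :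
    IsBandLimited (mulCoord j f) := hf.mul_continuous (by fun_prop)

lemma IsBandLimited.integrable_norm_mul {f : R3 → ℂ} (hf : IsBandLimited f) :
    Integrable fun ξ => ‖ξ‖ * ‖f ξ‖ := by
  have := (hf.mul_continuous (m := fun ξ => (‖ξ‖ : ℂ)) (by fun_prop)).integrable.norm
  simpa using this

/-- Bounded support gives a finite first moment, which permits differentiation under the integral.
The derivative formula for the forward transform is applied to f(-v). -/
lemma IsBandLimited.hasDerivAt_fourierInv {f : R3 → ℂ} (hf : IsBandLimited f) (j : Fin 3) (x : R3)
    (t : ℝ) : HasDerivAt (fun t : ℝ => 𝓕⁻ f (x + t • EuclideanSpace.single j (1 : ℝ)))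
      (2 * Real.pi * Complex.I *
        𝓕⁻ (AnisotropicFluid.mulCoord j f) (x + t • EuclideanSpace.single j (1 : ℝ))) t := by
  set e : R3 := EuclideanSpace.single j (1 : ℝ) with he
  have h1 : Integrable fun v => f (-v) := hf.integrable.comp_neg
  have h2 : Integrable fun v => ‖v‖ * ‖f (-v)‖ := by
    simpa using hf.integrable_norm_mul.comp_neg
  have hd := Real.hasFDerivAt_fourier h1 h2 (x + t • e)
  have hl : HasDerivAt (fun t : ℝ => x + t • e) e t := by
    simpa using ((hasDerivAt_id t).smul_const e).const_add x
  have := hd.comp_hasDerivAt t hl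
  rw [Real.fourierInv_eq_fourier_comp_neg, Real.fourierInv_eq_fourier_comp_neg]
  refine this.congr_deriv ?_
  have hint : Integrable (VectorFourier.fourierSMulRight (innerSL ℝ) fun v => f (-v)) := by
    refine (h2.const_mul (2 * Real.pi * ‖innerSL ℝ (E := R3)‖)).mono'
      h1.aestronglyMeasurable.fourierSMulRight (Eventually.of_forall fun v => ?_)
    refine (VectorFourier.norm_fourierSMulRight_le _ _ _).trans_eq (by ring)
  rw [Real.fourier_continuousLinearMap_apply hint]
  rw [Real.fourier_eq, Real.fourier_eq, ← integral_const_mul]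
  refine integral_congr_ae (Eventually.of_forall fun v => ?_)
  have hin : innerSL ℝ v e = v j := by
    change inner ℝ v e = _
    simp [he, EuclideanSpace.inner_single_right]
  simp [VectorFourier.fourierSMulRight_apply, AnisotropicFluid.mulCoord, Circle.smul_def, hin]
  ring


/-! ### Slices at constant height -/

/-- The squared `L²` norm of the slice of `a` at height `z`. -/
noncomputable def sliceEnergy (a : R3 → ℂ) (z : ℝ) : ℝ≥0∞ :=
  ∫⁻ y : R2, ‖a (joinPoint y z)‖ₑ ^ 2

/-- The supremum over all heights of the `L²` norms of the slices. -/
noncomputable def verticalSup (a : R3 → ℂ) : ℝ≥0∞ :=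
  eLpNorm (fun z : ℝ => eLpNorm (fun y : R2 => a (joinPoint y z)) 2 volume) ⊤ volume

lemma eLpNorm_slice (a : R3 → ℂ) (z : ℝ) :
    eLpNorm (fun y : R2 => a (joinPoint y z)) 2 volume = sliceEnergy a z ^ (1 / 2 : ℝ) := by
  rw [eLpNorm_eq_lintegral_rpow_enorm_toReal (by norm_num) (by norm_num)]
  simp [sliceEnergy]

lemma ae_sliceEnergy_le (a : R3 → ℂ) : ∀ᵐ z, sliceEnergy a z ≤ verticalSup a ^ 2 := by
  have h := ae_le_eLpNormEssSup (f := fun z : ℝ =>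
    eLpNorm (fun y : R2 => a (joinPoint y z)) 2 volume) (μ := volume)
  filter_upwards [h] with z hz
  rw [enorm_eq_self, eLpNorm_slice] at hz
  have h2 : sliceEnergy a z = (sliceEnergy a z ^ (1 / 2 : ℝ)) ^ 2 := by
    rw [← ENNReal.rpow_natCast, ← ENNReal.rpow_mul]; norm_num
  rw [h2, verticalSup, eLpNorm_exponent_top]
  gcongr

lemma verticalSup_le_of_forall {a : R3 → ℂ} {C : ℝ≥0∞} (h : ∀ z, sliceEnergy a z ≤ C ^ 2) :
    verticalSup a ≤ C := by
  rw [verticalSup, eLpNorm_exponent_top]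
  refine eLpNormEssSup_le_of_ae_enorm_bound (Eventually.of_forall fun z => ?_)
  rw [enorm_eq_self, eLpNorm_slice]
  calc sliceEnergy a z ^ (1 / 2 : ℝ) ≤ (C ^ 2) ^ (1 / 2 : ℝ) := by gcongr; exact h z
    _ = C := by rw [← ENNReal.rpow_natCast, ← ENNReal.rpow_mul]; norm_num

lemma measurable_slices {a : R3 → ℂ} (ha : Measurable a) (n : ℕ) :
    Measurable fun z => ∫⁻ y : R2, ‖a (joinPoint y z)‖ₑ ^ n :=
  Measurable.lintegral_prod_left' (f := fun p : R2 × ℝ => ‖a (joinPoint p.1 p.2)‖ₑ ^ n)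
    (by fun_prop)

lemma lintegral_sliceEnergy {a : R3 → ℂ} (ha : Measurable a) :
    ∫⁻ z, sliceEnergy a z = ∫⁻ x, ‖a x‖ₑ ^ 2 :=
  (lintegral_joinPoint (ha.enorm.pow_const 2)).symm

/-- The squared `L²` norm. -/
noncomputable def energy (f : R3 → ℂ) : ℝ≥0∞ := ∫⁻ ξ, ‖f ξ‖ₑ ^ 2

/-- The squared `L²` norm of the horizontal gradient. -/
noncomputable def horizontalEnergy (f : R3 → ℂ) : ℝ≥0∞ :=
  energy (mulCoord 0 f) + energy (mulCoord 1 f)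

lemma IsBandLimited.measurable_fourierInv {f : R3 → ℂ} (hf : IsBandLimited f) :
    Measurable (𝓕⁻ f) := (continuous_fourierInv hf.integrable).measurable

lemma IsBandLimited.energy_fourierInv {f : R3 → ℂ} (hf : IsBandLimited f) :
    energy (𝓕⁻ f) = energy f := by
  have h := eLpNorm_fourierInv hf.integrable hf.memLp
  rw [eLpNorm_eq_lintegral_rpow_enorm_toReal (by norm_num) (by norm_num),
    eLpNorm_eq_lintegral_rpow_enorm_toReal (by norm_num) (by norm_num)] at h
  have := ENNReal.rpow_left_injective (by norm_num) h
  simpa [energy] using this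

lemma IsBandLimited.lintegral_sliceEnergy {f : R3 → ℂ} (hf : IsBandLimited f) :
    ∫⁻ z, sliceEnergy (𝓕⁻ f) z = energy f := by
  rw [AnisotropicFluid.lintegral_sliceEnergy hf.measurable_fourierInv]
  exact hf.energy_fourierInv

/-- The squared `L²` norm of the slice of the horizontal gradient, up to a factor `2π`. -/
noncomputable def sliceGradient (f : R3 → ℂ) (z : ℝ) : ℝ≥0∞ :=
  sliceEnergy (𝓕⁻ (mulCoord 0 f)) z + sliceEnergy (𝓕⁻ (mulCoord 1 f)) z

lemma IsBandLimited.lintegral_sliceGradient {f : R3 → ℂ} (hf : IsBandLimited f) :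
    ∫⁻ z, sliceGradient f z = horizontalEnergy f := by
  unfold sliceGradient horizontalEnergy
  have hm : Measurable (sliceEnergy (𝓕⁻ (AnisotropicFluid.mulCoord 0 f))) :=
    measurable_slices (hf.mulCoord 0).measurable_fourierInv 2
  rw [lintegral_add_left hm, (hf.mulCoord 0).lintegral_sliceEnergy, (hf.mulCoord 1).lintegral_sliceEnergy]

lemma enorm_two_pi_I : ‖(2 * Real.pi * Complex.I : ℂ)‖ₑ = ENNReal.ofReal (2 * Real.pi) := by
  rw [← ofReal_norm]
  simp [abs_of_pos Real.pi_pos]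

/-- Ladyzhenskaya's inequality on one horizontal plane. The constant is 4 from that inequality times
(2π)² from the derivatives. -/
lemma IsBandLimited.lintegral_slice_four_le {f : R3 → ℂ} (hf : IsBandLimited f) {z : ℝ}
    (hz : sliceEnergy (𝓕⁻ f) z ≠ ⊤) :
    ∫⁻ y : R2, ‖𝓕⁻ f (joinPoint y z)‖ₑ ^ 4 ≤
      ENNReal.ofReal (16 * Real.pi ^ 2) * (sliceEnergy (𝓕⁻ f) z * sliceGradient f z) := by
  have hc : ∀ {g : R3 → ℂ}, IsBandLimited g → ∀ n : ℕ,
      Measurable fun y : R2 => ‖𝓕⁻ g (joinPoint y z)‖ₑ ^ n := fun hg n =>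
    (hg.measurable_fourierInv.comp (measurable_joinPoint.comp measurable_prodMk_right)).enorm.pow_const n
  have hcont : ∀ {g : R3 → ℂ}, IsBandLimited g →
      Continuous (Function.uncurry fun s t : ℝ => 𝓕⁻ g (joinPoint !₂[s, t] z)) := fun hg => by
    refine (continuous_fourierInv hg.integrable).comp ?_
    unfold joinPoint
    refine (PiLp.continuous_toLp 2 _).comp (continuous_pi fun i => ?_)
    fin_cases i <;> simp <;> fun_prop
  have hcont' : ∀ {g : R3 → ℂ}, IsBandLimited g → Continuous (Function.uncurry fun s t : ℝ =>
      2 * Real.pi * Complex.I * 𝓕⁻ g (joinPoint !₂[s, t] z)) := fun hg =>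
    (continuous_const (y := (2 * Real.pi * Complex.I : ℂ))).mul (hcont hg)
  have h0 := hf.mulCoord 0
  have h1 := hf.mulCoord 1
  have hL := ladyzhenskaya (f := fun s t => 𝓕⁻ f (joinPoint !₂[s, t] z))
    (fx := fun s t => 2 * Real.pi * Complex.I * 𝓕⁻ (AnisotropicFluid.mulCoord 0 f) (joinPoint !₂[s, t] z))
    (fy := fun s t => 2 * Real.pi * Complex.I * 𝓕⁻ (AnisotropicFluid.mulCoord 1 f) (joinPoint !₂[s, t] z))
    (hcont hf) (hcont' h0) (hcont' h1)
    (fun s t => by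
      have := hf.hasDerivAt_fourierInv 0 (joinPoint !₂[0, t] z) s
      have e : ∀ s : ℝ, joinPoint !₂[0, t] z + s • EuclideanSpace.single (0 : Fin 3) (1 : ℝ) =
          joinPoint !₂[s, t] z := fun s => by
        refine PiLp.ext fun i => ?_
        fin_cases i <;> simp [joinPoint]
      simpa only [e] using this)
    (fun s t => by
      have := hf.hasDerivAt_fourierInv 1 (joinPoint !₂[s, 0] z) t
      have e : ∀ t : ℝ, joinPoint !₂[s, 0] z + t • EuclideanSpace.single (1 : Fin 3) (1 : ℝ) =
          joinPoint !₂[s, t] z := fun t => by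
        refine PiLp.ext fun i => ?_
        fin_cases i <;> simp [joinPoint]
      simpa only [e] using this)
    (by rw [sliceEnergy, lintegral_plane (hc hf 2)] at hz; exact hz)
  rw [sliceGradient, sliceEnergy, sliceEnergy, sliceEnergy, lintegral_plane (hc hf 4),
    lintegral_plane (hc hf 2), lintegral_plane (hc h0 2), lintegral_plane (hc h1 2)]
  refine hL.trans_eq ?_
  have hm : ∀ {g : R3 → ℂ}, IsBandLimited g →
      ∫⁻ s, ∫⁻ t, ‖2 * Real.pi * Complex.I * 𝓕⁻ g (joinPoint !₂[s, t] z)‖ₑ ^ 2 =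
      ENNReal.ofReal (4 * Real.pi ^ 2) * ∫⁻ s, ∫⁻ t, ‖𝓕⁻ g (joinPoint !₂[s, t] z)‖ₑ ^ 2 := by
    intro g hg
    have hk : ENNReal.ofReal (4 * Real.pi ^ 2) = ENNReal.ofReal (2 * Real.pi) ^ 2 := by
      rw [← ENNReal.ofReal_pow (by positivity)]; congr 1; ring
    rw [hk, ← lintegral_const_mul' _ _ (ENNReal.pow_ne_top ENNReal.ofReal_ne_top)]
    refine lintegral_congr fun s => ?_
    rw [← lintegral_const_mul' _ _ (ENNReal.pow_ne_top ENNReal.ofReal_ne_top)]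
    refine lintegral_congr fun t => ?_
    rw [enorm_mul, enorm_two_pi_I, mul_pow]
  rw [hm h0, hm h1, ← mul_add]
  have h4 : ENNReal.ofReal (16 * Real.pi ^ 2) = 4 * ENNReal.ofReal (4 * Real.pi ^ 2) := by
    rw [show (4 : ℝ≥0∞) = ENNReal.ofReal 4 by simp, ← ENNReal.ofReal_mul (by norm_num)]
    congr 1; ring
  rw [h4]
  ring

/-! ### Trilinear estimates -/

/-- Hölder's inequality with exponents 2, 4, 4, from two applications of Cauchy–Schwarz. -/
lemma lintegral_mul_mul_le {α : Type*} [MeasurableSpace α] {μ : Measure α} {A B C : α → ℝ≥0∞}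
    (hA : Measurable A) (hB : Measurable B) (hC : Measurable C) :
    ∫⁻ x, A x * B x * C x ∂μ ≤ (∫⁻ x, A x ^ 2 ∂μ) ^ (1 / 2 : ℝ) *
      (∫⁻ x, B x ^ 4 ∂μ) ^ (1 / 4 : ℝ) * (∫⁻ x, C x ^ 4 ∂μ) ^ (1 / 4 : ℝ) := by
  simp_rw [mul_assoc]
  refine (lintegral_mul_le_sqrt hA.aemeasurable (hB.mul hC).aemeasurable).trans ?_
  gcongr
  simp only [Pi.mul_apply, mul_pow]
  calc (∫⁻ x, B x ^ 2 * C x ^ 2 ∂μ) ^ (1 / 2 : ℝ)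
      ≤ ((∫⁻ x, (B x ^ 2) ^ 2 ∂μ) ^ (1 / 2 : ℝ) * (∫⁻ x, (C x ^ 2) ^ 2 ∂μ) ^ (1 / 2 : ℝ)) ^
        (1 / 2 : ℝ) := by
        gcongr
        exact lintegral_mul_le_sqrt (hB.pow_const 2).aemeasurable (hC.pow_const 2).aemeasurable
    _ = _ := by
        rw [ENNReal.mul_rpow_of_nonneg _ _ (by norm_num), ← ENNReal.rpow_mul, ← ENNReal.rpow_mul]
        simp only [← pow_mul]
        norm_num

/-- A bound for the `L²` norm in height of the horizontal `L⁴` norm. -/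
noncomputable def quarticNorm (f : R3 → ℂ) : ℝ≥0∞ :=
  (energy f * horizontalEnergy f) ^ (1 / 4 : ℝ)

/-- The largest size over all heights of the horizontal gradient of a profile. -/
noncomputable def verticalSupGradient (f : R3 → ℂ) : ℝ≥0∞ :=
  verticalSup (𝓕⁻ (mulCoord 0 f)) + verticalSup (𝓕⁻ (mulCoord 1 f))

/-- The integral of the absolute value of the product of three band-limited functions. -/
noncomputable def absTriple (f g h : R3 → ℂ) : ℝ≥0∞ :=
  ∫⁻ x, ‖𝓕⁻ f x‖ₑ * ‖𝓕⁻ g x‖ₑ * ‖𝓕⁻ h x‖ₑ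

lemma absTriple_comm (f g h : R3 → ℂ) : absTriple f g h = absTriple g f h := by
  simp only [absTriple, mul_comm ‖𝓕⁻ f _‖ₑ]

lemma absTriple_rotate (f g h : R3 → ℂ) : absTriple f g h = absTriple h f g := by
  refine lintegral_congr fun x => by ring

section

variable {f g h : R3 → ℂ}

lemma IsBandLimited.measurable_sliceEnergy (hf : IsBandLimited f) :
    Measurable (sliceEnergy (𝓕⁻ f)) := measurable_slices hf.measurable_fourierInv 2

lemma IsBandLimited.measurable_sliceGradient (hf : IsBandLimited f) :
    Measurable (sliceGradient f) :=
  (hf.mulCoord 0).measurable_sliceEnergy.add (hf.mulCoord 1).measurable_sliceEnergy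

lemma IsBandLimited.energy_ne_top (hf : IsBandLimited f) : energy f ≠ ⊤ :=
  lintegral_enorm_sq_ne_top hf.memLp

lemma IsBandLimited.ae_sliceEnergy_ne_top (hf : IsBandLimited f) :
    ∀ᵐ z, sliceEnergy (𝓕⁻ f) z ≠ ⊤ := by
  have := ae_lt_top hf.measurable_sliceEnergy (by
    rw [hf.lintegral_sliceEnergy]; exact hf.energy_ne_top)
  filter_upwards [this] with z hz using hz.ne

/-- Cauchy–Schwarz in the height: the slice energies and slice gradients integrate to the full ones.
-/
lemma IsBandLimited.lintegral_slice_product (hf : IsBandLimited f) :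
    (∫⁻ z, ((sliceEnergy (𝓕⁻ f) z * sliceGradient f z) ^ (1 / 4 : ℝ)) ^ 2) ^ (1 / 2 : ℝ) ≤
      quarticNorm f := by
  have h1 : ∀ z, ((sliceEnergy (𝓕⁻ f) z * sliceGradient f z) ^ (1 / 4 : ℝ)) ^ 2 =
      sliceEnergy (𝓕⁻ f) z ^ (1 / 2 : ℝ) * sliceGradient f z ^ (1 / 2 : ℝ) := by
    intro z
    rw [← ENNReal.rpow_natCast, ← ENNReal.rpow_mul, ← ENNReal.mul_rpow_of_nonneg _ _ (by norm_num)]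
    norm_num
  have h2 : ∀ t : ℝ≥0∞, (t ^ (1 / 2 : ℝ)) ^ 2 = t := by
    intro t
    rw [← ENNReal.rpow_natCast, ← ENNReal.rpow_mul]; norm_num
  simp only [h1]
  calc _ ≤ ((∫⁻ z, (sliceEnergy (𝓕⁻ f) z ^ (1 / 2 : ℝ)) ^ 2) ^ (1 / 2 : ℝ) *
        (∫⁻ z, (sliceGradient f z ^ (1 / 2 : ℝ)) ^ 2) ^ (1 / 2 : ℝ)) ^ (1 / 2 : ℝ) := by
        gcongr
        exact lintegral_mul_le_sqrt (hf.measurable_sliceEnergy.pow_const _).aemeasurable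
          (hf.measurable_sliceGradient.pow_const _).aemeasurable
    _ = quarticNorm f := by
        simp only [h2]
        rw [hf.lintegral_sliceEnergy, hf.lintegral_sliceGradient, quarticNorm,
          ← ENNReal.mul_rpow_of_nonneg _ _ (by norm_num), ← ENNReal.rpow_mul]
        norm_num

lemma absTriple_eq (hf : IsBandLimited f) (hg : IsBandLimited g) (hh : IsBandLimited h) :
    absTriple f g h = ∫⁻ z, ∫⁻ y : R2, ‖𝓕⁻ f (joinPoint y z)‖ₑ * ‖𝓕⁻ g (joinPoint y z)‖ₑ *
      ‖𝓕⁻ h (joinPoint y z)‖ₑ := by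
  have h1 := hf.measurable_fourierInv
  have h2 := hg.measurable_fourierInv
  have h3 := hh.measurable_fourierInv
  exact lintegral_joinPoint (by fun_prop)

/-- Hölder with exponents 2, 4, 4 on a plane; each of the two L⁴ norms contributes (16π²)^(1/4). -/
lemma absTriple_slice_le (hf : IsBandLimited f) (hg : IsBandLimited g) (hh : IsBandLimited h) :
    ∀ᵐ z, ∫⁻ y : R2, ‖𝓕⁻ f (joinPoint y z)‖ₑ * ‖𝓕⁻ g (joinPoint y z)‖ₑ *
      ‖𝓕⁻ h (joinPoint y z)‖ₑ ≤ ENNReal.ofReal (4 * Real.pi) * (sliceEnergy (𝓕⁻ f) z ^ (1 / 2 : ℝ) *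
        (sliceEnergy (𝓕⁻ g) z * sliceGradient g z) ^ (1 / 4 : ℝ) *
        (sliceEnergy (𝓕⁻ h) z * sliceGradient h z) ^ (1 / 4 : ℝ)) := by
  have hK : ENNReal.ofReal (16 * Real.pi ^ 2) ^ (1 / 4 : ℝ) * ENNReal.ofReal (16 * Real.pi ^ 2) ^ (1 / 4 : ℝ) =
      ENNReal.ofReal (4 * Real.pi) := by
    rw [← ENNReal.rpow_add_of_nonneg _ _ (by norm_num) (by norm_num),
      ENNReal.ofReal_rpow_of_nonneg (by positivity) (by norm_num)]
    congr 1
    rw [show (16 * Real.pi ^ 2) = (4 * Real.pi) ^ (2 : ℝ) by norm_num; ring, ← Real.rpow_mul (by positivity)]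
    norm_num
  filter_upwards [hg.ae_sliceEnergy_ne_top, hh.ae_sliceEnergy_ne_top] with z hz1 hz2
  have hm : ∀ {g : R3 → ℂ}, IsBandLimited g → Measurable fun y : R2 => ‖𝓕⁻ g (joinPoint y z)‖ₑ :=
    fun hg =>
    (hg.measurable_fourierInv.comp (measurable_joinPoint.comp measurable_prodMk_right)).enorm
  refine (lintegral_mul_mul_le (hm hf) (hm hg) (hm hh)).trans ?_
  calc _ ≤ sliceEnergy (𝓕⁻ f) z ^ (1 / 2 : ℝ) *
        (ENNReal.ofReal (16 * Real.pi ^ 2) * (sliceEnergy (𝓕⁻ g) z * sliceGradient g z)) ^ (1 / 4 : ℝ) *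
        (ENNReal.ofReal (16 * Real.pi ^ 2) * (sliceEnergy (𝓕⁻ h) z * sliceGradient h z)) ^ (1 / 4 : ℝ) := by
        gcongr
        · exact le_rfl
        · exact hg.lintegral_slice_four_le hz1
        · exact hh.lintegral_slice_four_le hz2
    _ = _ := by
        rw [ENNReal.mul_rpow_of_nonneg _ (_ * _) (by norm_num), ENNReal.mul_rpow_of_nonneg _ (_ * _) (by norm_num), ← hK]
        ring

/-- Here f is in L² on slices and bounded in height, while g and h are in L⁴ on slices and share the
integration in height. -/
lemma absTriple_le_verticalSup (hf : IsBandLimited f) (hg : IsBandLimited g)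
    (hh : IsBandLimited h) :
    absTriple f g h ≤ ENNReal.ofReal (4 * Real.pi) *
      (verticalSup (𝓕⁻ f) * quarticNorm g * quarticNorm h) := by
  have mg := (hg.measurable_sliceEnergy.mul hg.measurable_sliceGradient).pow_const (1 / 4 : ℝ)
  have mh := (hh.measurable_sliceEnergy.mul hh.measurable_sliceGradient).pow_const (1 / 4 : ℝ)
  rw [absTriple_eq hf hg hh]
  calc _ ≤ ∫⁻ z, ENNReal.ofReal (4 * Real.pi) * verticalSup (𝓕⁻ f) *
        ((sliceEnergy (𝓕⁻ g) z * sliceGradient g z) ^ (1 / 4 : ℝ) *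
        (sliceEnergy (𝓕⁻ h) z * sliceGradient h z) ^ (1 / 4 : ℝ)) := by
        refine lintegral_mono_ae ?_
        filter_upwards [absTriple_slice_le hf hg hh, ae_sliceEnergy_le (𝓕⁻ f)] with z h1 h2
        refine h1.trans ?_
        rw [mul_assoc, mul_assoc]
        gcongr
        calc sliceEnergy (𝓕⁻ f) z ^ (1 / 2 : ℝ) ≤ (verticalSup (𝓕⁻ f) ^ 2) ^ (1 / 2 : ℝ) := by
              gcongr
          _ = _ := by rw [← ENNReal.rpow_natCast, ← ENNReal.rpow_mul]; norm_num
    _ = ENNReal.ofReal (4 * Real.pi) * verticalSup (𝓕⁻ f) * ∫⁻ z,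
        ((sliceEnergy (𝓕⁻ g) z * sliceGradient g z) ^ (1 / 4 : ℝ) *
        (sliceEnergy (𝓕⁻ h) z * sliceGradient h z) ^ (1 / 4 : ℝ)) :=
        lintegral_const_mul _ (mg.mul mh)
    _ ≤ ENNReal.ofReal (4 * Real.pi) * verticalSup (𝓕⁻ f) * (quarticNorm g * quarticNorm h) := by
        gcongr
        refine (lintegral_mul_le_sqrt mg.aemeasurable mh.aemeasurable).trans ?_
        exact mul_le_mul' hg.lintegral_slice_product hh.lintegral_slice_product
    _ = _ := by ring

/-- Here f and g are in L⁴ on slices and h in L². For f both Ladyzhenskaya factors are bounded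
uniformly in height, which produces the geometric mean of the two suprema. -/
lemma absTriple_le_interpolation (hf : IsBandLimited f) (hg : IsBandLimited g)
    (hh : IsBandLimited h) :
    absTriple f g h ≤ ENNReal.ofReal (4 * Real.pi) *
      ((verticalSup (𝓕⁻ f) * verticalSupGradient f) ^ (1 / 2 : ℝ) * quarticNorm g *
        energy h ^ (1 / 2 : ℝ)) := by
  have mg := (hg.measurable_sliceEnergy.mul hg.measurable_sliceGradient).pow_const (1 / 4 : ℝ)
  have mh := hh.measurable_sliceEnergy.pow_const (1 / 2 : ℝ)
  rw [absTriple_rotate, absTriple_eq hh hf hg]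
  calc _ ≤ ∫⁻ z, ENNReal.ofReal (4 * Real.pi) *
        (verticalSup (𝓕⁻ f) * verticalSupGradient f) ^ (1 / 2 : ℝ) *
        ((sliceEnergy (𝓕⁻ g) z * sliceGradient g z) ^ (1 / 4 : ℝ) *
        sliceEnergy (𝓕⁻ h) z ^ (1 / 2 : ℝ)) := by
        refine lintegral_mono_ae ?_
        filter_upwards [absTriple_slice_le hh hf hg, ae_sliceEnergy_le (𝓕⁻ f),
          ae_sliceEnergy_le (𝓕⁻ (mulCoord 0 f)), ae_sliceEnergy_le (𝓕⁻ (mulCoord 1 f))]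
          with z h1 h2 h3 h4
        refine h1.trans ?_
        have key : (sliceEnergy (𝓕⁻ f) z * sliceGradient f z) ^ (1 / 4 : ℝ) ≤
            (verticalSup (𝓕⁻ f) * verticalSupGradient f) ^ (1 / 2 : ℝ) := by
          calc _ ≤ ((verticalSup (𝓕⁻ f) * verticalSupGradient f) ^ 2) ^ (1 / 4 : ℝ) := by
                rw [mul_pow]
                gcongr
                unfold sliceGradient verticalSupGradient
                refine (add_le_add h3 h4).trans ?_
                -- A sum of squares is at most the square of the sum; the cross term is dropped.
                rw [add_sq]
                rw [add_right_comm]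
                exact le_self_add
            _ = _ := by rw [← ENNReal.rpow_natCast, ← ENNReal.rpow_mul]; norm_num
        calc _ ≤ ENNReal.ofReal (4 * Real.pi) * (sliceEnergy (𝓕⁻ h) z ^ (1 / 2 : ℝ) *
              (verticalSup (𝓕⁻ f) * verticalSupGradient f) ^ (1 / 2 : ℝ) *
              (sliceEnergy (𝓕⁻ g) z * sliceGradient g z) ^ (1 / 4 : ℝ)) := by gcongr
          _ = _ := by ring
    _ = ENNReal.ofReal (4 * Real.pi) * (verticalSup (𝓕⁻ f) * verticalSupGradient f) ^ (1 / 2 : ℝ) *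
        ∫⁻ z, ((sliceEnergy (𝓕⁻ g) z * sliceGradient g z) ^ (1 / 4 : ℝ) *
        sliceEnergy (𝓕⁻ h) z ^ (1 / 2 : ℝ)) := lintegral_const_mul _ (mg.mul mh)
    _ ≤ ENNReal.ofReal (4 * Real.pi) * (verticalSup (𝓕⁻ f) * verticalSupGradient f) ^ (1 / 2 : ℝ) *
        (quarticNorm g * energy h ^ (1 / 2 : ℝ)) := by
        gcongr
        refine (lintegral_mul_le_sqrt mg.aemeasurable mh.aemeasurable).trans ?_
        refine mul_le_mul' hg.lintegral_slice_product (le_of_eq ?_)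
        congr 1
        rw [← hh.lintegral_sliceEnergy]
        refine lintegral_congr fun z => ?_
        rw [← ENNReal.rpow_natCast, ← ENNReal.rpow_mul]; norm_num
    _ = _ := by ring

lemma IsBandLimited.enorm_trilinear_le (hf : IsBandLimited f) (hg : IsBandLimited g)
    (hh : IsBandLimited h) : ‖trilinear f g h‖ₑ ≤ absTriple f g h :=
  AnisotropicFluid.enorm_trilinear_le hf.measurable hg.measurable hh.measurable hf.integrable
    hg.integrable hh.integrable hf.memLp hg.memLp hh.memLp

end

/-! ### Smooth low-pass filters -/

/-- A smooth bump function equal to `1` on the unit ball. -/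
noncomputable def bump : ContDiffBump (0 : R3) := ⟨1, 2, one_pos, one_lt_two⟩

/-- The smooth low-pass filter at frequency `2 ^ n`. -/
noncomputable def lowPass (n : ℕ) (ξ : R3) : ℝ := bump (((2 : ℝ) ^ n)⁻¹ • ξ)

lemma lowPass_nonneg (n : ℕ) (ξ : R3) : 0 ≤ lowPass n ξ := bump.nonneg

lemma lowPass_le_one (n : ℕ) (ξ : R3) : lowPass n ξ ≤ 1 := bump.le_one

lemma lowPass_neg (n : ℕ) (ξ : R3) : lowPass n (-ξ) = lowPass n ξ := by
  rw [lowPass, lowPass, smul_neg, bump.neg]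

lemma norm_inv_smul_pow (n : ℕ) (ξ : R3) : ‖((2 : ℝ) ^ n)⁻¹ • ξ‖ = ‖ξ‖ / 2 ^ n := by
  rw [norm_smul, norm_inv, norm_pow, Real.norm_two]; ring

lemma lowPass_eq_one {n : ℕ} {ξ : R3} (h : ‖ξ‖ ≤ 2 ^ n) : lowPass n ξ = 1 := by
  refine bump.one_of_mem_closedBall ?_
  rw [mem_closedBall_zero_iff, norm_inv_smul_pow]
  exact (div_le_one (by positivity)).2 h

lemma lowPass_eq_zero {n : ℕ} {ξ : R3} (h : 2 ^ (n + 1) ≤ ‖ξ‖) : lowPass n ξ = 0 := by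
  refine bump.zero_of_le_dist ?_
  rw [dist_zero_right, norm_inv_smul_pow]
  change (2 : ℝ) ≤ _
  rw [le_div_iff₀ (by positivity)]
  rw [pow_succ] at h; linarith

lemma contDiff_lowPass (n : ℕ) : ContDiff ℝ ∞ (lowPass n) :=
  bump.contDiff.comp (contDiff_const_smul _)

@[fun_prop]
lemma continuous_lowPass (n : ℕ) : Continuous (lowPass n) := (contDiff_lowPass n).continuous

lemma hasCompactSupport_lowPass (n : ℕ) : HasCompactSupport (lowPass n) := by
  refine HasCompactSupport.intro (isCompact_closedBall (0 : R3) (2 ^ (n + 1))) fun ξ h => ?_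
  refine lowPass_eq_zero ?_
  rw [mem_closedBall_zero_iff, not_le] at h
  exact h.le

/-- The low-pass filter as a complex Schwartz function. -/
noncomputable def lowPassSchwartz (n : ℕ) : 𝓢(R3, ℂ) :=
  HasCompactSupport.toSchwartzMap (f := fun ξ => (lowPass n ξ : ℂ))
    ((hasCompactSupport_lowPass n).comp_left (g := fun t : ℝ => (t : ℂ)) (by simp))
    (Complex.ofRealCLM.contDiff.comp (contDiff_lowPass n))

lemma lowPassSchwartz_apply (n : ℕ) (ξ : R3) : lowPassSchwartz n ξ = (lowPass n ξ : ℂ) := rfl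

/-! ### Low-pass kernels and bounds uniform in the frequency. -/

/-- The convolution kernel of the low-pass filter. -/
noncomputable def lowPassKernel (n : ℕ) : 𝓢(R3, ℂ) := 𝓕⁻ (lowPassSchwartz n)

/-- All kernels are L¹-normalised dilates of the first one; hence `kernelMass` serves every n. -/
lemma lowPassKernel_apply (n : ℕ) (x : R3) :
    lowPassKernel n x = (2 : ℝ) ^ (3 * n) • lowPassKernel 0 ((2 : ℝ) ^ n • x) := by
  simp only [lowPassKernel, SchwartzMap.fourierInv_coe, Real.fourierInv_eq]
  have h := Measure.integral_comp_inv_smul (volume : Measure R3)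
    (fun v => 𝐞 (inner ℝ v ((2 : ℝ) ^ n • x)) • lowPassSchwartz 0 v) ((2 : ℝ) ^ n)
  have e : |((2 : ℝ) ^ n) ^ Module.finrank ℝ R3| = 2 ^ (3 * n) := by
    rw [finrank_euclideanSpace_fin, abs_of_pos (by positivity), ← pow_mul, mul_comm]
  rw [e] at h
  rw [← h]
  refine integral_congr_ae (Eventually.of_forall fun v => ?_)
  have h2 : ((2 : ℝ) ^ n) ≠ 0 := by positivity
  simp only [lowPassSchwartz_apply, lowPass, inner_smul_left, inner_smul_right]
  simp [h2]

/-- The `L¹` norm of the kernels of all low-pass filters. -/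
noncomputable def kernelMass : ℝ≥0∞ := ∫⁻ x, ‖lowPassKernel 0 x‖ₑ

lemma kernelMass_ne_top : kernelMass ≠ ⊤ := (lowPassKernel 0).integrable.2.ne

lemma lintegral_lowPassKernel (n : ℕ) : ∫⁻ x, ‖lowPassKernel n x‖ₑ = kernelMass := by
  rw [kernelMass, ← ofReal_integral_norm_eq_lintegral_enorm (lowPassKernel n).integrable,
    ← ofReal_integral_norm_eq_lintegral_enorm (lowPassKernel 0).integrable]
  congr 1
  simp_rw [lowPassKernel_apply n, norm_smul]
  rw [integral_const_mul, Measure.integral_comp_smul (volume : Measure R3)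
    (fun x => ‖lowPassKernel 0 x‖)]
  rw [finrank_euclideanSpace_fin, abs_of_pos (by positivity), ← pow_mul, mul_comm n 3, norm_pow,
    Real.norm_two, smul_eq_mul, ← mul_assoc, mul_inv_cancel₀ (by positivity), one_mul]

/-- For fixed x the filter times the character at x is a Schwartz function. Testing the transform of
v against it gives the convolution at every point, not only almost everywhere. -/
lemma fourierInv_lowPass_mul (n : ℕ) (v : Lp ℂ 2 (volume : Measure R3)) (x : R3) :
    𝓕⁻ (fun ξ => (lowPass n ξ : ℂ) * (𝓕 v : Lp ℂ 2 (volume : Measure R3)) ξ) x =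
      ∫ y, lowPassKernel n y * v (x - y) := by
  have hc : HasCompactSupport fun ξ : R3 => (𝐞 (inner ℝ ξ x) : ℂ) * (lowPass n ξ : ℂ) :=
    ((hasCompactSupport_lowPass n).comp_left (g := fun t : ℝ => (t : ℂ)) (by simp)).mul_left
  have hs : ContDiff ℝ ∞ fun ξ : R3 => (𝐞 (inner ℝ ξ x) : ℂ) * (lowPass n ξ : ℂ) := by
    refine ContDiff.mul ?_ (Complex.ofRealCLM.contDiff.comp (contDiff_lowPass n))
    simp only [Real.fourierChar_apply]
    refine ContDiff.cexp (ContDiff.mul (Complex.ofRealCLM.contDiff.comp ?_) contDiff_const)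
    exact contDiff_const.mul (contDiff_id.inner ℝ contDiff_const)
  let φ : 𝓢(R3, ℂ) := hc.toSchwartzMap hs
  have h1 := congrArg (fun T : 𝓢'(R3, ℂ) => T φ) (Lp.fourier_toTemperedDistribution_eq v)
  simp only [TemperedDistribution.fourier_apply, Lp.toTemperedDistribution_apply,
    smul_eq_mul] at h1
  calc _ = ∫ ξ, φ ξ * (𝓕 v : Lp ℂ 2 (volume : Measure R3)) ξ := by
        rw [Real.fourierInv_eq]
        refine integral_congr_ae (Eventually.of_forall fun ξ => ?_)
        change _ = ((𝐞 (inner ℝ ξ x) : ℂ) * (lowPass n ξ : ℂ)) * _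
        simp only [Circle.smul_def, smul_eq_mul]
        ring
    _ = ∫ y, (𝓕 φ) y * v y := h1.symm
    _ = ∫ y, lowPassKernel n (x - y) * v y := by
        refine integral_congr_ae (Eventually.of_forall fun y => ?_)
        simp only [lowPassKernel, SchwartzMap.fourierInv_coe, SchwartzMap.fourier_coe]
        congr 1
        rw [Real.fourier_eq, Real.fourierInv_eq]
        refine integral_congr_ae (Eventually.of_forall fun ξ => ?_)
        change 𝐞 (-inner ℝ ξ y) • ((𝐞 (inner ℝ ξ x) : ℂ) * (lowPass n ξ : ℂ)) =
          𝐞 (inner ℝ ξ (x - y)) • (lowPass n ξ : ℂ)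
        rw [inner_sub_right, sub_eq_neg_add, AddChar.map_add_eq_mul]
        simp only [Circle.smul_def, smul_eq_mul, Circle.coe_mul]
        ring
    _ = _ := by
        rw [← integral_sub_left_eq_self _ volume x]
        simp

lemma sliceEnergy_comp_sub (v : R3 → ℂ) (y : R2) (z z' : ℝ) :
    ∫⁻ w : R2, ‖v (joinPoint w z - joinPoint y z')‖ₑ ^ 2 = sliceEnergy v (z - z') := by
  have e : ∀ w : R2, joinPoint w z - joinPoint y z' = joinPoint (w - y) (z - z') := by
    intro w
    refine PiLp.ext fun i => ?_
    fin_cases i <;> simp [joinPoint]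
  simp only [e]
  exact lintegral_sub_right_eq_self (fun w : R2 => ‖v (joinPoint w (z - z'))‖ₑ ^ 2) y

/-- Cauchy–Schwarz after writing k as the square of its root. -/
lemma sq_lintegral_mul_le {k b : R3 → ℝ≥0∞} (hk : Measurable k) (hb : Measurable b) :
    (∫⁻ y, k y * b y) ^ 2 ≤ (∫⁻ y, k y) * ∫⁻ y, k y * b y ^ 2 := by
  have h2 : ∀ t : ℝ≥0∞, (t ^ (1 / 2 : ℝ)) ^ 2 = t := by
    intro t
    rw [← ENNReal.rpow_natCast, ← ENNReal.rpow_mul]; norm_num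
  have h := lintegral_mul_le_sqrt (μ := (volume : Measure R3)) (hk.pow_const (1 / 2 : ℝ)).aemeasurable
    ((hk.pow_const (1 / 2 : ℝ)).mul hb).aemeasurable
  have e : ∀ y, k y ^ (1 / 2 : ℝ) * ((fun y => k y ^ (1 / 2 : ℝ)) * b) y = k y * b y := by
    intro y
    rw [Pi.mul_apply, ← mul_assoc, ← pow_two, h2]
  have e2 : ∀ y, (((fun y => k y ^ (1 / 2 : ℝ)) * b) y) ^ 2 = k y * b y ^ 2 := by
    intro y
    rw [Pi.mul_apply, mul_pow, h2]
  simp only [e, e2, h2] at h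
  calc _ ≤ ((∫⁻ y, k y) ^ (1 / 2 : ℝ) * (∫⁻ y, k y * b y ^ 2) ^ (1 / 2 : ℝ)) ^ 2 := by gcongr
    _ = _ := by rw [mul_pow, h2, h2]

/-- A Young inequality for the norm of L^∞ in height and L² in the plane: Cauchy–Schwarz against
|k|, Fubini, and horizontal translation invariance. The slices of v are controlled only at almost
every height, but the height z' is integrated, so the bound holds at every z. -/
lemma sliceEnergy_convolution_le {k v : R3 → ℂ} (hk : Measurable k) (hv : Measurable v) (z : ℝ) :
    sliceEnergy (fun x => ∫ y, k y * v (x - y)) z ≤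
      ((∫⁻ y, ‖k y‖ₑ) * verticalSup v) ^ 2 := by
  set A := ∫⁻ y, ‖k y‖ₑ with hA
  have h1 : ∀ x, ‖∫ y, k y * v (x - y)‖ₑ ^ 2 ≤ A * ∫⁻ y, ‖k y‖ₑ * ‖v (x - y)‖ₑ ^ 2 := by
    intro x
    calc _ ≤ (∫⁻ y, ‖k y‖ₑ * ‖v (x - y)‖ₑ) ^ 2 := by
          gcongr
          refine (enorm_integral_le_lintegral_enorm _).trans_eq ?_
          simp only [enorm_mul]
      _ ≤ _ := sq_lintegral_mul_le hk.enorm (by fun_prop)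
  have hm : Measurable fun p : R2 × R3 => ‖k p.2‖ₑ * ‖v (joinPoint p.1 z - p.2)‖ₑ ^ 2 := by
    have : Measurable fun p : R2 × R3 => joinPoint p.1 z - p.2 :=
      ((measurable_joinPoint.comp measurable_prodMk_right).comp measurable_fst).sub measurable_snd
    exact (hk.enorm.comp measurable_snd).mul ((hv.enorm.comp this).pow_const 2)
  calc _ ≤ ∫⁻ w : R2, A * ∫⁻ y, ‖k y‖ₑ * ‖v (joinPoint w z - y)‖ₑ ^ 2 :=
        lintegral_mono fun w => h1 _
    _ = A * ∫⁻ y, ∫⁻ w : R2, ‖k y‖ₑ * ‖v (joinPoint w z - y)‖ₑ ^ 2 := by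
        rw [lintegral_const_mul _ (Measurable.lintegral_prod_right' hm),
          lintegral_lintegral_swap hm.aemeasurable]
    _ = A * ∫⁻ y, ‖k y‖ₑ * ∫⁻ w : R2, ‖v (joinPoint w z - y)‖ₑ ^ 2 := by
        congr 1
        refine lintegral_congr fun y => ?_
        rw [lintegral_const_mul' _ _ enorm_ne_top]
    _ = A * ∫⁻ z', ∫⁻ y : R2, ‖k (joinPoint y z')‖ₑ * sliceEnergy v (z - z') := by
        rw [lintegral_joinPoint]
        · simp only [sliceEnergy_comp_sub]
        · refine hk.enorm.mul ?_
          have : Measurable fun p : R2 × R3 => ‖v (joinPoint p.1 z - p.2)‖ₑ ^ 2 := by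
            have : Measurable fun p : R2 × R3 => joinPoint p.1 z - p.2 :=
              ((measurable_joinPoint.comp measurable_prodMk_right).comp measurable_fst).sub
                measurable_snd
            exact (hv.enorm.comp this).pow_const 2
          exact Measurable.lintegral_prod_left' this
    _ ≤ A * ∫⁻ z', ∫⁻ y : R2, ‖k (joinPoint y z')‖ₑ * verticalSup v ^ 2 := by
        gcongr A * ?_
        refine lintegral_mono_ae ?_
        have := (Measure.measurePreserving_sub_left volume z).quasiMeasurePreserving.ae
          (ae_sliceEnergy_le v)
        filter_upwards [this] with z' hz'
        gcongr
    _ = A * (A * verticalSup v ^ 2) := by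
        congr 1
        rw [hA, lintegral_joinPoint hk.enorm, ← lintegral_mul_const]
        · refine lintegral_congr fun z' => ?_
          rw [← lintegral_mul_const]
          exact (hk.comp (measurable_joinPoint.comp measurable_prodMk_right)).enorm
        · simpa using measurable_slices hk 1
    _ = _ := by ring

lemma verticalSup_congr_ae {a b : R3 → ℂ} (h : a =ᵐ[volume] b) :
    verticalSup a = verticalSup b := by
  have h1 := measurePreserving_joinPoint.quasiMeasurePreserving.ae h
  rw [Measure.volume_eq_prod] at h1
  have h2 := Measure.ae_ae_of_ae_prod h1
  refine eLpNorm_congr_ae ?_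
  filter_upwards [h2] with z hz
  exact eLpNorm_congr_ae hz

lemma verticalSup_lowPass_le (n : ℕ) (v : Lp ℂ 2 (volume : Measure R3)) :
    verticalSup (𝓕⁻ (fun ξ => (lowPass n ξ : ℂ) * (𝓕 v : Lp ℂ 2 (volume : Measure R3)) ξ)) ≤
      kernelMass * verticalSup v := by
  refine verticalSup_le_of_forall fun z => ?_
  have e : 𝓕⁻ (fun ξ => (lowPass n ξ : ℂ) * (𝓕 v : Lp ℂ 2 (volume : Measure R3)) ξ) =
      fun x => ∫ y, lowPassKernel n y * v (x - y) := funext fun x => fourierInv_lowPass_mul n v x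
  rw [e, ← lintegral_lowPassKernel n]
  exact sliceEnergy_convolution_le (lowPassKernel n).continuous.measurable
    (Lp.stronglyMeasurable v).measurable z

lemma fourierInv_congr_ae {f g : R3 → ℂ} (h : f =ᵐ[volume] g) : 𝓕⁻ f = 𝓕⁻ g := by
  ext x
  rw [Real.fourierInv_eq, Real.fourierInv_eq]
  refine integral_congr_ae ?_
  filter_upwards [h] with y hy
  rw [hy]

lemma IsBandLimited.verticalSup_lowPass_le {f : R3 → ℂ} (hf : IsBandLimited f) (n : ℕ) :
    verticalSup (𝓕⁻ fun ξ => (lowPass n ξ : ℂ) * f ξ) ≤ kernelMass * verticalSup (𝓕⁻ f) := by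
  have h := AnisotropicFluid.verticalSup_lowPass_le n (𝓕⁻ (hf.memLp.toLp f))
  rw [FourierTransform.fourier_fourierInv_eq,
    verticalSup_congr_ae (fourierInv_toLp_ae hf.integrable hf.memLp)] at h
  refine le_trans (le_of_eq ?_) h
  congr 1
  refine fourierInv_congr_ae ?_
  filter_upwards [hf.memLp.coeFn_toLp] with ξ hξ
  rw [hξ]

lemma IsBandLimited.lowPass {f : R3 → ℂ} (hf : IsBandLimited f) (n : ℕ) :
    IsBandLimited fun ξ => (lowPass n ξ : ℂ) * f ξ :=
  hf.mul_continuous (by fun_prop)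

lemma isBandLimited_lowPass_mul {f : R3 → ℂ} (hf : Measurable f) (hf2 : MemLp f 2) (n : ℕ) :
    IsBandLimited fun ξ => (AnisotropicFluid.lowPass n ξ : ℂ) * f ξ := by
  have hm : Measurable fun ξ => (AnisotropicFluid.lowPass n ξ : ℂ) * f ξ :=
    (by fun_prop : Measurable fun ξ => (AnisotropicFluid.lowPass n ξ : ℂ)).mul hf
  refine ⟨hm, ?_, 2 ^ (n + 1), fun ξ h => ?_⟩
  · refine hf2.mono hm.aestronglyMeasurable (Eventually.of_forall fun ξ => ?_)
    rw [norm_mul, Complex.norm_real, Real.norm_of_nonneg (lowPass_nonneg n ξ)]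
    exact mul_le_of_le_one_left (norm_nonneg _) (lowPass_le_one n ξ)
  · rw [lowPass_eq_zero h.le]; simp

lemma verticalSup_add_le {f g : R3 → ℂ} (hf : IsBandLimited f) (hg : IsBandLimited g) :
    verticalSup (𝓕⁻ fun ξ => f ξ + g ξ) ≤ verticalSup (𝓕⁻ f) + verticalSup (𝓕⁻ g) := by
  have e : 𝓕⁻ (fun ξ => f ξ + g ξ) = fun x => 𝓕⁻ f x + 𝓕⁻ g x := by
    ext x
    simp only [Real.fourierInv_eq]
    rw [← integral_add]
    · simp only [smul_add]
    · simpa using (Real.fourierIntegral_convergent_iff (-x)).2 hf.integrable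
    · simpa using (Real.fourierIntegral_convergent_iff (-x)).2 hg.integrable
  have hs : ∀ {f : R3 → ℂ}, IsBandLimited f → ∀ z : ℝ,
      Measurable fun y : R2 => 𝓕⁻ f (joinPoint y z) := fun hf z =>
    hf.measurable_fourierInv.comp (measurable_joinPoint.comp measurable_prodMk_right)
  have hm : ∀ {f : R3 → ℂ}, IsBandLimited f →
      Measurable fun z : ℝ => eLpNorm (fun y : R2 => 𝓕⁻ f (joinPoint y z)) 2 volume := fun hf => by
    simp only [eLpNorm_slice]
    exact hf.measurable_sliceEnergy.pow_const _
  rw [e]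
  unfold verticalSup
  refine le_trans ?_ (eLpNorm_add_le (hm hf).aestronglyMeasurable
    (hm hg).aestronglyMeasurable le_top)
  refine eLpNorm_mono_enorm fun z => ?_
  simp only [enorm_eq_self, Pi.add_apply]
  exact eLpNorm_add_le (hs hf z).aestronglyMeasurable (hs hg z).aestronglyMeasurable (by norm_num)

lemma verticalSup_const_mul {f : R3 → ℂ} (c : ℂ) :
    verticalSup (𝓕⁻ fun ξ => c * f ξ) = ‖c‖ₑ * verticalSup (𝓕⁻ f) := by
  have e : 𝓕⁻ (fun ξ => c * f ξ) = fun x => c * 𝓕⁻ f x := by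
    ext x
    simp only [Real.fourierInv_eq, Circle.smul_def, smul_eq_mul]
    rw [← integral_const_mul]
    refine integral_congr_ae (Eventually.of_forall fun y => ?_)
    ring
  rw [e]
  unfold verticalSup
  have h1 : ∀ z : ℝ, eLpNorm (fun y : R2 => c * 𝓕⁻ f (joinPoint y z)) 2 volume =
      ‖c‖ₑ * eLpNorm (fun y : R2 => 𝓕⁻ f (joinPoint y z)) 2 volume := fun z =>
    eLpNorm_const_smul c _ _ _
  simp only [h1, eLpNorm_exponent_top, eLpNormEssSup, enorm_eq_self]
  exact ENNReal.essSup_const_mul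

/-! ### Dyadic blocks -/

/-- The symbol of `1 - Δ`. -/
noncomputable def symbol (ξ : R3) : ℝ := 1 + (2 * Real.pi * ‖ξ‖) ^ 2

lemma one_le_symbol (ξ : R3) : 1 ≤ symbol ξ := by
  unfold symbol; nlinarith [sq_nonneg (2 * Real.pi * ‖ξ‖)]

lemma symbol_pos (ξ : R3) : 0 < symbol ξ := one_pos.trans_le (one_le_symbol ξ)

lemma symbol_neg (ξ : R3) : symbol (-ξ) = symbol ξ := by simp [symbol]

lemma continuous_symbol : Continuous symbol := by unfold symbol; fun_prop

lemma sobolevWeight_eq (s : ℝ) (ξ : R3) : sobolevWeight s ξ = symbol ξ ^ s := rfl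

lemma sobolevWeight_pos (s : ℝ) (ξ : R3) : 0 < sobolevWeight s ξ :=
  Real.rpow_pos_of_pos (symbol_pos ξ) s

lemma sobolevWeight_neg (s : ℝ) (ξ : R3) : sobolevWeight s (-ξ) = sobolevWeight s ξ := by
  rw [sobolevWeight_eq, sobolevWeight_eq, symbol_neg]

@[fun_prop]
lemma continuous_sobolevWeight (s : ℝ) : Continuous (sobolevWeight s) :=
  continuous_symbol.rpow_const fun ξ => Or.inl (symbol_pos ξ).ne'

lemma sq_norm_le_symbol (ξ : R3) : ‖ξ‖ ^ 2 ≤ symbol ξ := by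
  unfold symbol
  nlinarith [Real.pi_gt_three, sq_nonneg ‖ξ‖, mul_pos Real.pi_pos Real.pi_pos, norm_nonneg ξ,
    mul_nonneg (sq_nonneg ‖ξ‖) (sub_nonneg.2 (by nlinarith [Real.pi_gt_three] :
      (1 : ℝ) ≤ 4 * Real.pi ^ 2))]

/-- The filter of a dyadic shell. -/
noncomputable def shell : ℕ → R3 → ℝ
  | 0 => lowPass 0
  | q + 1 => fun ξ => lowPass (q + 1) ξ - lowPass q ξ

@[fun_prop]
lemma continuous_shell (q : ℕ) : Continuous (shell q) := by
  cases q with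
  | zero => exact continuous_lowPass 0
  | succ q => exact (continuous_lowPass _).sub (continuous_lowPass _)

lemma shell_neg (q : ℕ) (ξ : R3) : shell q (-ξ) = shell q ξ := by
  cases q <;> simp [shell, lowPass_neg]

lemma sum_shell (n : ℕ) (ξ : R3) : ∑ q ∈ Finset.range (n + 1), shell q ξ = lowPass n ξ := by
  induction n with
  | zero => simp [shell]
  | succ n ih => rw [Finset.sum_range_succ, ih]; simp [shell]

lemma abs_shell_le_one (q : ℕ) (ξ : R3) : |shell q ξ| ≤ 1 := by
  cases q with
  | zero => exact abs_le.2 ⟨by linarith [lowPass_nonneg 0 ξ, show shell 0 ξ = lowPass 0 ξ from rfl],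
      lowPass_le_one 0 ξ⟩
  | succ q =>
    have h : shell (q + 1) ξ = lowPass (q + 1) ξ - lowPass q ξ := rfl
    rw [h, abs_le]
    constructor <;> linarith [lowPass_nonneg (q + 1) ξ, lowPass_nonneg q ξ,
      lowPass_le_one (q + 1) ξ, lowPass_le_one q ξ]

lemma norm_lt_of_shell_ne_zero {q : ℕ} {ξ : R3} (h : shell q ξ ≠ 0) : ‖ξ‖ < 2 ^ (q + 1) := by
  by_contra hc
  rw [not_lt] at hc
  refine h ?_
  cases q with
  | zero => exact lowPass_eq_zero hc
  | succ q =>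
    have h' : shell (q + 1) ξ = lowPass (q + 1) ξ - lowPass q ξ := rfl
    rw [h', lowPass_eq_zero hc, lowPass_eq_zero
      (le_trans (pow_le_pow_right₀ one_le_two (by omega)) hc), sub_zero]

lemma lt_norm_of_shell_ne_zero {q : ℕ} {ξ : R3} (h : shell q ξ ≠ 0) (hq : q ≠ 0) :
    2 ^ q < 2 * ‖ξ‖ := by
  obtain ⟨q, rfl⟩ := Nat.exists_eq_succ_of_ne_zero hq
  by_contra hc
  rw [not_lt, Nat.succ_eq_add_one, pow_succ] at hc
  refine h ?_
  have h' : shell (q + 1) ξ = lowPass (q + 1) ξ - lowPass q ξ := rfl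
  have h1 : ‖ξ‖ ≤ 2 ^ q := by linarith
  rw [Nat.succ_eq_add_one, h', lowPass_eq_one h1, lowPass_eq_one
    (h1.trans (pow_le_pow_right₀ one_le_two (by omega))), sub_self]

lemma four_pow_eq (q : ℕ) : (4 : ℝ) ^ q = (2 ^ q) ^ 2 := by
  rw [← pow_mul, mul_comm, pow_mul]; norm_num

/-- The block q = 0 contains the origin, so there the bound rests on the 1 in the symbol. -/
lemma four_pow_le_of_shell_ne_zero {q : ℕ} {ξ : R3} (h : shell q ξ ≠ 0) :
    (4 : ℝ) ^ q ≤ 4 * symbol ξ := by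
  rcases eq_or_ne q 0 with rfl | hq
  · have := one_le_symbol ξ
    norm_num; linarith
  · have h1 := lt_norm_of_shell_ne_zero h hq
    rw [four_pow_eq]
    have h2 := sq_norm_le_symbol ξ
    nlinarith [pow_pos (two_pos : (0 : ℝ) < 2) q]

/-- With π² ≤ 10 the symbol is at most 1 + 160 · 4^q; the constant is rounded up to a power of 4. -/
lemma symbol_le_of_shell_ne_zero {q : ℕ} {ξ : R3} (h : shell q ξ ≠ 0) :
    symbol ξ ≤ 256 * 4 ^ q := by
  have h1 := norm_lt_of_shell_ne_zero h
  have h2 : ‖ξ‖ ^ 2 ≤ 4 * 4 ^ q := by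
    rw [four_pow_eq]
    rw [pow_succ] at h1
    nlinarith [norm_nonneg ξ]
  have h3 : (1 : ℝ) ≤ 4 ^ q := one_le_pow₀ (by norm_num)
  have h4 : Real.pi ^ 2 ≤ 10 := by nlinarith [Real.pi_lt_d2, Real.pi_pos]
  unfold symbol
  have h5 : (2 * Real.pi * ‖ξ‖) ^ 2 = 4 * (Real.pi ^ 2 * ‖ξ‖ ^ 2) := by ring
  have h6 : Real.pi ^ 2 * ‖ξ‖ ^ 2 ≤ 10 * (4 * 4 ^ q) :=
    mul_le_mul h4 h2 (sq_nonneg _) (by norm_num)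
  rw [h5]
  linarith

/-- Two dyadic indices are adjacent if they differ by at most `2`. -/
def Adjacent (q r : ℕ) : Prop := q ≤ r + 2 ∧ r ≤ q + 2

instance (q : ℕ) : DecidablePred (Adjacent q) := fun _ => inferInstanceAs (Decidable (_ ∧ _))

lemma adjacent_comm {q r : ℕ} : Adjacent q r ↔ Adjacent r q := and_comm

/-- The filter of the shells adjacent to the shell `q`. -/
noncomputable def nearFilter (n q : ℕ) (ξ : R3) : ℝ :=
  ∑ r ∈ (Finset.range (n + 1)).filter (Adjacent q), shell r ξ

/-- The filter of the shells not adjacent to the shell `q`. -/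
noncomputable def farFilter (n q : ℕ) (ξ : R3) : ℝ :=
  ∑ r ∈ (Finset.range (n + 1)).filter (fun r => ¬ Adjacent q r), shell r ξ

@[fun_prop]
lemma continuous_nearFilter (n q : ℕ) : Continuous (nearFilter n q) :=
  continuous_finsetSum _ fun r _ => continuous_shell r

@[fun_prop]
lemma continuous_farFilter (n q : ℕ) : Continuous (farFilter n q) :=
  continuous_finsetSum _ fun r _ => continuous_shell r

lemma nearFilter_add_farFilter (n q : ℕ) (ξ : R3) :
    nearFilter n q ξ + farFilter n q ξ = lowPass n ξ := by
  rw [nearFilter, farFilter, Finset.sum_filter_add_sum_filter_not, sum_shell]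

lemma card_adjacent_le (n q : ℕ) : ((Finset.range (n + 1)).filter (Adjacent q)).card ≤ 5 := by
  -- Truncated subtraction at q < 2 only shortens the interval, which never has more than five
  -- elements.
  have : (Finset.range (n + 1)).filter (Adjacent q) ⊆ Finset.Icc (q - 2) (q + 2) := by
    intro r hr
    rw [Finset.mem_filter] at hr
    have := hr.2
    unfold Adjacent at this
    rw [Finset.mem_Icc]; omega
  refine (Finset.card_le_card this).trans ?_
  rw [Nat.card_Icc]; omega

lemma abs_nearFilter_le (n q : ℕ) (ξ : R3) : |nearFilter n q ξ| ≤ 5 := by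
  refine (Finset.abs_sum_le_sum_abs _ _).trans ?_
  refine (Finset.sum_le_card_nsmul _ _ 1 fun r _ => abs_shell_le_one r ξ).trans ?_
  have := card_adjacent_le n q
  simp only [nsmul_eq_mul, mul_one]
  exact_mod_cast this

lemma exists_shell_of_nearFilter_ne_zero {n q : ℕ} {ξ : R3} (h : nearFilter n q ξ ≠ 0) :
    ∃ r, Adjacent q r ∧ shell r ξ ≠ 0 := by
  obtain ⟨r, hr, h⟩ := Finset.exists_ne_zero_of_sum_ne_zero h
  exact ⟨r, (Finset.mem_filter.1 hr).2, h⟩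

lemma four_pow_le_of_nearFilter_ne_zero {n q : ℕ} {ξ : R3} (h : nearFilter n q ξ ≠ 0) :
    (4 : ℝ) ^ q ≤ 64 * symbol ξ := by
  obtain ⟨r, hr, h⟩ := exists_shell_of_nearFilter_ne_zero h
  have h1 := four_pow_le_of_shell_ne_zero h
  have h2 : (4 : ℝ) ^ q ≤ 4 ^ (r + 2) := pow_le_pow_right₀ (by norm_num) hr.1
  rw [pow_add] at h2
  linarith

lemma symbol_le_of_nearFilter_ne_zero {n q : ℕ} {ξ : R3} (h : nearFilter n q ξ ≠ 0) :
    symbol ξ ≤ 4096 * 4 ^ q := by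
  obtain ⟨r, hr, h⟩ := exists_shell_of_nearFilter_ne_zero h
  have h1 := symbol_le_of_shell_ne_zero h
  have h2 : (4 : ℝ) ^ r ≤ 4 ^ (q + 2) := pow_le_pow_right₀ (by norm_num) hr.2
  rw [pow_add] at h2
  linarith

/-- Frequencies in non-adjacent shells are far apart. -/
lemma two_pow_le_norm_of_far {n q : ℕ} {ξ η ζ : R3} (hξ : shell q ξ ≠ 0)
    (hζ : farFilter n q ζ ≠ 0) (h : ξ = η + ζ) : (2 : ℝ) ^ q ≤ 4 * ‖η‖ := by
  obtain ⟨r, hr, hrζ⟩ := Finset.exists_ne_zero_of_sum_ne_zero hζ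
  have hr := (Finset.mem_filter.1 hr).2
  have h1 := norm_lt_of_shell_ne_zero hξ
  have h2 := norm_lt_of_shell_ne_zero hrζ
  unfold Adjacent at hr
  -- Non-adjacent indices differ by at least 3. The larger of |ξ|, |ζ| then exceeds twice the
  -- smaller, and their difference η keeps at least a quarter of 2^q.
  rcases lt_or_ge (r + 2) q with hlt | hge
  · have h3 := lt_norm_of_shell_ne_zero hξ (by omega)
    have h4 : (2 : ℝ) ^ (r + 3) ≤ 2 ^ q := pow_le_pow_right₀ one_le_two (by omega)
    have h5 : ‖ξ‖ ≤ ‖η‖ + ‖ζ‖ := h ▸ norm_add_le _ _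
    rw [pow_add] at h4 h2
    linarith
  · have hq : q + 3 ≤ r := by omega
    have h3 := lt_norm_of_shell_ne_zero hrζ (by omega)
    have h4 : (2 : ℝ) ^ (q + 3) ≤ 2 ^ r := pow_le_pow_right₀ one_le_two hq
    have h5 : ‖ζ‖ ≤ ‖ξ‖ + ‖η‖ := by
      have : ζ = ξ - η := by rw [h]; abel
      rw [this]; exact norm_sub_le _ _
    rw [pow_add] at h4 h1
    have h6 : (0 : ℝ) < 2 ^ q := by positivity
    linarith

/-! ### Summation over blocks -/

/-- A geometric sum with ratio above 1 is comparable to its largest term. -/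
lemma sum_geometric_le {r Y : ℝ} (hr : 1 < r) (hY : 0 ≤ Y) (S : Finset ℕ)
    (hS : ∀ q ∈ S, r ^ q ≤ Y) : ∑ q ∈ S, r ^ q ≤ r / (r - 1) * Y := by
  have hr1 : 0 < r - 1 := by linarith
  rcases S.eq_empty_or_nonempty with rfl | hne
  · simp; positivity
  · set Q := S.max' hne with hQ
    have h1 : S ⊆ Finset.range (Q + 1) := fun q hq =>
      Finset.mem_range.2 (Nat.lt_succ_of_le (S.le_max' q hq))
    have h2 := hS Q (S.max'_mem hne)
    calc ∑ q ∈ S, r ^ q ≤ ∑ q ∈ Finset.range (Q + 1), r ^ q :=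
          Finset.sum_le_sum_of_subset_of_nonneg h1 fun _ _ _ => by positivity
      _ = (r ^ (Q + 1) - 1) / (r - 1) := geom_sum_eq hr.ne' _
      _ ≤ r / (r - 1) * Y := by
          rw [div_mul_eq_mul_div]
          gcongr
          rw [pow_succ]
          nlinarith

/-- The square of the `H^s` norm on the frequency side. -/
noncomputable def sobolevEnergy (s : ℝ) (f : R3 → ℂ) : ℝ≥0∞ :=
  ∫⁻ ξ, ENNReal.ofReal (sobolevWeight s ξ) * ‖f ξ‖ₑ ^ 2

/-- The square of the `H^s` norm of the horizontal gradient, up to a factor `2π`. -/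
noncomputable def sobolevHorizontalEnergy (s : ℝ) (f : R3 → ℂ) : ℝ≥0∞ :=
  sobolevEnergy s (mulCoord 0 f) + sobolevEnergy s (mulCoord 1 f)

/-- The weight `4 ^ (s q)` of the block `q`. -/
noncomputable def blockWeight (s : ℝ) (q : ℕ) : ℝ := ((4 : ℝ) ^ s) ^ q

lemma blockWeight_pos (s : ℝ) (q : ℕ) : 0 < blockWeight s q := by unfold blockWeight; positivity

lemma blockWeight_eq (s : ℝ) (q : ℕ) : blockWeight s q = ((4 : ℝ) ^ q) ^ s := by
  unfold blockWeight
  rw [← Real.rpow_natCast, ← Real.rpow_natCast, ← Real.rpow_mul (by norm_num),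
    ← Real.rpow_mul (by norm_num), mul_comm]

/-- A family of multipliers is subordinate to the blocks if it is bounded by `M`
and the `q`-th one lives at frequencies at least comparable to `2 ^ q`. -/
structure IsSubordinate (ρ : ℕ → R3 → ℂ) (M : ℝ) : Prop where
  measurable : ∀ q, Measurable (ρ q)
  bound : ∀ q ξ, ‖ρ q ξ‖ ≤ M
  support : ∀ q ξ, ρ q ξ ≠ 0 → (4 : ℝ) ^ q ≤ 64 * symbol ξ

/-- The constant in the summation of blocks. -/
noncomputable def blockConst (s M : ℝ) : ℝ := (4 : ℝ) ^ s / ((4 : ℝ) ^ s - 1) * (64 : ℝ) ^ s * M ^ 2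

/-- At a fixed frequency only the q with 4^q ≤ 64 · `symbol ξ` contribute, and for s > 0 their
weights form a geometric sum bounded by the Sobolev weight. The supports of the multipliers may
overlap without limit, so high-pass cutoffs are allowed. -/
lemma sum_block_energy_le {s : ℝ} (hs : 0 < s) {ρ : ℕ → R3 → ℂ} {M : ℝ}
    (hρ : IsSubordinate ρ M) {f : R3 → ℂ} (hf : Measurable f) (S : Finset ℕ) :
    ∑ q ∈ S, ENNReal.ofReal (blockWeight s q) * energy (fun ξ => ρ q ξ * f ξ) ≤
      ENNReal.ofReal (blockConst s M) * sobolevEnergy s f := by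
  have hr : 1 < (4 : ℝ) ^ s := Real.one_lt_rpow (by norm_num) hs
  have hm : ∀ q, Measurable fun ξ => ‖ρ q ξ * f ξ‖ₑ ^ 2 := fun q =>
    (((hρ.measurable q).mul hf).enorm).pow_const 2
  unfold energy sobolevEnergy
  simp_rw [← lintegral_const_mul' (ENNReal.ofReal _) _ ENNReal.ofReal_ne_top]
  rw [← lintegral_finsetSum _ fun q _ => (hm q).const_mul _]
  refine lintegral_mono fun ξ => ?_
  have h1 : ∀ q ∈ S, ENNReal.ofReal (blockWeight s q) * ‖ρ q ξ * f ξ‖ₑ ^ 2 ≤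
      (if ρ q ξ ≠ 0 then ENNReal.ofReal (blockWeight s q) else 0) * (ENNReal.ofReal (M ^ 2) * ‖f ξ‖ₑ ^ 2) := by
    intro q _
    split_ifs with h
    · gcongr
      rw [enorm_mul, mul_pow]
      gcongr
      rw [ENNReal.ofReal_pow ((norm_nonneg _).trans (hρ.bound q ξ))]
      gcongr
      rw [← ofReal_norm]
      exact ENNReal.ofReal_le_ofReal (hρ.bound q ξ)
    · rw [not_not] at h
      simp [h]
  refine (Finset.sum_le_sum h1).trans ?_
  rw [← Finset.sum_mul, ← Finset.sum_filter, ← ENNReal.ofReal_sum_of_nonneg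
    fun q _ => (blockWeight_pos s q).le]
  have h2 : ∑ q ∈ S.filter fun q => ρ q ξ ≠ 0, blockWeight s q ≤
      (4 : ℝ) ^ s / ((4 : ℝ) ^ s - 1) * ((64 : ℝ) ^ s * sobolevWeight s ξ) := by
    refine sum_geometric_le hr (by have := sobolevWeight_pos s ξ; positivity) _ fun q hq => ?_
    have h := hρ.support q ξ (Finset.mem_filter.1 hq).2
    rw [sobolevWeight_eq, ← Real.mul_rpow (by norm_num) (symbol_pos ξ).le]
    rw [show ((4 : ℝ) ^ s) ^ q = blockWeight s q from rfl, blockWeight_eq]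
    exact Real.rpow_le_rpow (by positivity) h hs.le
  have hc : 0 ≤ (4 : ℝ) ^ s / ((4 : ℝ) ^ s - 1) := div_nonneg (by positivity) (by linarith)
  calc _ ≤ ENNReal.ofReal ((4 : ℝ) ^ s / ((4 : ℝ) ^ s - 1) * ((64 : ℝ) ^ s * sobolevWeight s ξ)) *
        (ENNReal.ofReal (M ^ 2) * ‖f ξ‖ₑ ^ 2) := by
        gcongr
    _ = _ := by
        have := (sobolevWeight_pos s ξ).le
        rw [← mul_assoc, ← mul_assoc (ENNReal.ofReal (blockConst s M)),
          ← ENNReal.ofReal_mul (by positivity),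
          ← ENNReal.ofReal_mul (by unfold blockConst; positivity)]
        congr 2
        unfold blockConst
        ring

lemma energy_mulCoord_mul (j : Fin 3) (m f : R3 → ℂ) :
    energy (mulCoord j fun ξ => m ξ * f ξ) = energy fun ξ => m ξ * mulCoord j f ξ := by
  unfold energy mulCoord
  refine lintegral_congr fun ξ => ?_
  rw [mul_left_comm]

lemma sum_block_horizontalEnergy_le {s : ℝ} (hs : 0 < s) {ρ : ℕ → R3 → ℂ} {M : ℝ}
    (hρ : IsSubordinate ρ M) {f : R3 → ℂ} (hf : Measurable f) (S : Finset ℕ) :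
    ∑ q ∈ S, ENNReal.ofReal (blockWeight s q) * horizontalEnergy (fun ξ => ρ q ξ * f ξ) ≤
      ENNReal.ofReal (blockConst s M) * sobolevHorizontalEnergy s f := by
  have hm : ∀ j, Measurable (mulCoord j f) := fun j =>
    (by fun_prop : Measurable fun ξ : R3 => (ξ j : ℂ)).mul hf
  unfold horizontalEnergy sobolevHorizontalEnergy
  simp only [energy_mulCoord_mul, mul_add, Finset.sum_add_distrib]
  exact add_le_add (sum_block_energy_le hs hρ (hm 0) S) (sum_block_energy_le hs hρ (hm 1) S)

lemma sqrt_sq (t : ℝ≥0∞) : (t ^ (1 / 2 : ℝ)) ^ 2 = t := by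
  rw [← ENNReal.rpow_natCast, ← ENNReal.rpow_mul]; norm_num

lemma sq_sqrt (t : ℝ≥0∞) : (t ^ 2) ^ (1 / 2 : ℝ) = t := by
  rw [← ENNReal.rpow_natCast, ← ENNReal.rpow_mul]; norm_num

lemma sum_mul_le_sqrt {ι : Type*} (S : Finset ι) (a b : ι → ℝ≥0∞) :
    ∑ i ∈ S, a i ^ (1 / 2 : ℝ) * b i ^ (1 / 2 : ℝ) ≤
      (∑ i ∈ S, a i) ^ (1 / 2 : ℝ) * (∑ i ∈ S, b i) ^ (1 / 2 : ℝ) := by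
  have h := ENNReal.inner_le_Lp_mul_Lq S (fun i => a i ^ (1 / 2 : ℝ)) (fun i => b i ^ (1 / 2 : ℝ))
    Real.HolderConjugate.two_two
  simpa only [ENNReal.rpow_two, sqrt_sq] using h

/-- The interpolated `H^s` norm of the horizontal `L⁴` norm. -/
noncomputable def sobolevQuartic (s : ℝ) (f : R3 → ℂ) : ℝ≥0∞ :=
  (sobolevEnergy s f * sobolevHorizontalEnergy s f) ^ (1 / 4 : ℝ)

/-- The squared quartic norm is a geometric mean of two block energies, so Cauchy–Schwarz in q
reduces it to the two sums already bounded. -/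
lemma sum_block_quartic_sq_le {s : ℝ} (hs : 0 < s) {ρ : ℕ → R3 → ℂ} {M : ℝ}
    (hρ : IsSubordinate ρ M) {f : R3 → ℂ} (hf : Measurable f) (S : Finset ℕ) :
    ∑ q ∈ S, ENNReal.ofReal (blockWeight s q) * quarticNorm (fun ξ => ρ q ξ * f ξ) ^ 2 ≤
      ENNReal.ofReal (blockConst s M) * sobolevQuartic s f ^ 2 := by
  have e : ∀ a b c : ℝ≥0∞, a * ((b * c) ^ (1 / 4 : ℝ)) ^ 2 =
      (a * b) ^ (1 / 2 : ℝ) * (a * c) ^ (1 / 2 : ℝ) := by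
    intro a b c
    rw [← ENNReal.rpow_natCast, ← ENNReal.rpow_mul, ENNReal.mul_rpow_of_nonneg a b (by norm_num),
      ENNReal.mul_rpow_of_nonneg a c (by norm_num), mul_mul_mul_comm,
      ← ENNReal.rpow_add_of_nonneg _ _ (by norm_num) (by norm_num),
      ← ENNReal.mul_rpow_of_nonneg b c (by norm_num)]
    norm_num
  unfold quarticNorm sobolevQuartic
  simp only [e]
  refine (sum_mul_le_sqrt _ _ _).trans ?_
  gcongr
  · exact sum_block_energy_le hs hρ hf S
  · exact sum_block_horizontalEnergy_le hs hρ hf S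

lemma sum_weight_mul_le {ι : Type*} (S : Finset ι) (b x y : ι → ℝ≥0∞) :
    ∑ i ∈ S, b i * (x i * y i) ≤
      (∑ i ∈ S, b i * x i ^ 2) ^ (1 / 2 : ℝ) * (∑ i ∈ S, b i * y i ^ 2) ^ (1 / 2 : ℝ) := by
  refine le_trans (le_of_eq (Finset.sum_congr rfl fun i _ => ?_)) (sum_mul_le_sqrt S _ _)
  rw [← ENNReal.mul_rpow_of_nonneg _ _ (by norm_num),
    show b i * x i ^ 2 * (b i * y i ^ 2) = (b i * (x i * y i)) ^ 2 by ring,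
    ← ENNReal.rpow_natCast, ← ENNReal.rpow_mul]
  norm_num

lemma sum_block_quartic_energy_le {s : ℝ} (hs : 0 < s) {ρ ρ' : ℕ → R3 → ℂ} {M : ℝ}
    (hρ : IsSubordinate ρ M) (hρ' : IsSubordinate ρ' M) {f g : R3 → ℂ} (hf : Measurable f)
    (hg : Measurable g) (S : Finset ℕ) :
    ∑ q ∈ S, ENNReal.ofReal (blockWeight s q) * (quarticNorm (fun ξ => ρ q ξ * f ξ) *
        energy (fun ξ => ρ' q ξ * g ξ) ^ (1 / 2 : ℝ)) ≤
      ENNReal.ofReal (blockConst s M) *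
        (sobolevQuartic s f * sobolevEnergy s g ^ (1 / 2 : ℝ)) := by
  refine (sum_weight_mul_le _ _ _ _).trans ?_
  simp only [sqrt_sq]
  calc _ ≤ (ENNReal.ofReal (blockConst s M) * sobolevQuartic s f ^ 2) ^ (1 / 2 : ℝ) *
        (ENNReal.ofReal (blockConst s M) * sobolevEnergy s g) ^ (1 / 2 : ℝ) := by
        gcongr
        · exact sum_block_quartic_sq_le hs hρ hf S
        · exact sum_block_energy_le hs hρ' hg S
    _ = _ := by
        rw [ENNReal.mul_rpow_of_nonneg _ _ (by norm_num), ENNReal.mul_rpow_of_nonneg _ _ (by norm_num),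
          sq_sqrt, mul_mul_mul_comm, ← pow_two, sqrt_sq]

lemma sum_block_quartic_quartic_le {s : ℝ} (hs : 0 < s) {ρ ρ' : ℕ → R3 → ℂ} {M : ℝ}
    (hρ : IsSubordinate ρ M) (hρ' : IsSubordinate ρ' M) {f g : R3 → ℂ} (hf : Measurable f)
    (hg : Measurable g) (S : Finset ℕ) :
    ∑ q ∈ S, ENNReal.ofReal (blockWeight s q) * (quarticNorm (fun ξ => ρ q ξ * f ξ) *
        quarticNorm (fun ξ => ρ' q ξ * g ξ)) ≤
      ENNReal.ofReal (blockConst s M) * (sobolevQuartic s f * sobolevQuartic s g) := by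
  refine (sum_weight_mul_le _ _ _ _).trans ?_
  calc _ ≤ (ENNReal.ofReal (blockConst s M) * sobolevQuartic s f ^ 2) ^ (1 / 2 : ℝ) *
        (ENNReal.ofReal (blockConst s M) * sobolevQuartic s g ^ 2) ^ (1 / 2 : ℝ) := by
        gcongr
        · exact sum_block_quartic_sq_le hs hρ hf S
        · exact sum_block_quartic_sq_le hs hρ' hg S
    _ = _ := by
        rw [ENNReal.mul_rpow_of_nonneg _ _ (by norm_num), ENNReal.mul_rpow_of_nonneg _ _ (by norm_num),
          sq_sqrt, sq_sqrt, mul_mul_mul_comm, ← pow_two, sqrt_sq]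

/-! ### Divided differences of the Sobolev weight -/

lemma hasSum_binomial (s : ℝ) {x : ℝ} (hx : |x| < 1) :
    HasSum (fun n : ℕ => Ring.choose s n * x ^ n) ((1 + x) ^ s) := by
  have h := (Real.one_add_rpow_hasFPowerSeriesOnBall_zero (a := s)).hasSum
    (y := x) (by simpa [Metric.mem_eball, edist_dist, Real.dist_eq] using hx)
  simpa [binomialSeries, FormalMultilinearSeries.coeff_ofScalars, mul_comm] using h

/-- Convergence of the binomial series at some r' between r and 1 bounds the coefficients by B /
r'^n; the rest is n (r/r')^n. -/
lemma summable_binomial_deriv (s : ℝ) {r : ℝ} (hr0 : 0 < r) (hr1 : r < 1) :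
    Summable fun n : ℕ => n * |Ring.choose s n| * r ^ (n - 1) := by
  obtain ⟨r', hr', hr1'⟩ := exists_between hr1
  have hr'0 : 0 < r' := hr0.trans hr'
  have hsum := (hasSum_binomial s (x := r') (by rwa [abs_of_pos hr'0])).summable
  obtain ⟨B, hB⟩ := hsum.tendsto_atTop_zero.norm.bddAbove_range
  have hB' : ∀ n, |Ring.choose s n| * r' ^ n ≤ B := fun n => by
    have := hB ⟨n, rfl⟩
    simpa [abs_of_pos hr'0] using this
  have hg := (summable_pow_mul_geometric_of_norm_lt_one 1 (r := r / r') (by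
    rw [Real.norm_of_nonneg (by positivity)]; exact (div_lt_one hr'0).2 hr')).mul_left (B / r)
  refine Summable.of_nonneg_of_le (fun n => by positivity) (fun n => ?_) hg
  rcases n with _ | n
  · simp
  · rw [Nat.add_sub_cancel, pow_one]
    have e : B / r * (((n + 1 : ℕ) : ℝ) * (r / r') ^ (n + 1)) =
        ((n + 1 : ℕ) : ℝ) * r ^ n * (B / r' ^ (n + 1)) := by
      rw [div_pow, pow_succ r]; field_simp
    rw [e]
    have h2 : |Ring.choose s (n + 1)| ≤ B / r' ^ (n + 1) := (le_div_iff₀ (by positivity)).2 (hB' _)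
    calc _ = ((n + 1 : ℕ) : ℝ) * r ^ n * |Ring.choose s (n + 1)| := by ring
      _ ≤ _ := by gcongr

/-! ### Trilinear forms with separate multipliers and the commutator with the weight. -/

lemma IsBandLimited.mul_bounded {f m : R3 → ℂ} (hf : IsBandLimited f) (hm : Measurable m) {C : ℝ}
    (hb : ∀ ξ, ‖m ξ‖ ≤ C) : IsBandLimited fun ξ => m ξ * f ξ :=
  hf.mul hm fun _ => ⟨C, fun ξ _ => hb ξ⟩

lemma IsBandLimited.integrable_trilinear {f g h : R3 → ℂ} (hf : IsBandLimited f)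
    (hg : IsBandLimited g) (hh : IsBandLimited h) :
    Integrable (fun p : R3 × R3 => f p.1 * g p.2 * conj (h (p.1 + p.2))) :=
  integrable_trilinear_left hf.measurable hg.measurable hh.measurable hf.integrable hg.memLp hh.memLp

lemma trilinear_const_mul (f g h : R3 → ℂ) (a b : ℝ) :
    trilinear f (fun ξ => (a : ℂ) * g ξ) (fun ξ => (b : ℂ) * h ξ) =
      ((a * b : ℝ) : ℂ) * trilinear f g h := by
  unfold trilinear
  rw [← integral_const_mul]
  refine integral_congr_ae (Eventually.of_forall fun p => ?_)
  simp only [map_mul, Complex.conj_ofReal, Complex.ofReal_mul]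
  ring

/-- `B` bounds the trilinear form with `η_l f` and arbitrary multipliers of size one on `g`, `h`. -/
def IsMultiplierBound (f g h : R3 → ℂ) (B : ℝ≥0∞) : Prop :=
  ∀ (l : Fin 3) (μ ν : R3 → ℂ), Measurable μ → Measurable ν → (∀ ξ, ‖μ ξ‖ ≤ 1) →
    (∀ ξ, ‖ν ξ‖ ≤ 1) →
    ‖trilinear (mulCoord l f) (fun ξ => μ ξ * g ξ) (fun ξ => ν ξ * h ξ)‖ₑ ≤ B

/-- Where |μ| exceeds a, g vanishes, so μ may be set to zero there without changing the form;
dividing by a then gives a multiplier of size one. The same applies to ν. -/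
lemma IsMultiplierBound.le_of_support {f g h : R3 → ℂ} {B : ℝ≥0∞} (hB : IsMultiplierBound f g h B)
    (l : Fin 3) {μ ν : R3 → ℂ} (hμ : Measurable μ) (hν : Measurable ν) {a b : ℝ} (ha : 0 < a)
    (hb : 0 < b) (hμa : ∀ ξ, g ξ ≠ 0 → ‖μ ξ‖ ≤ a) (hνb : ∀ ξ, h ξ ≠ 0 → ‖ν ξ‖ ≤ b) :
    ‖trilinear (mulCoord l f) (fun ξ => μ ξ * g ξ) (fun ξ => ν ξ * h ξ)‖ₑ ≤
      ENNReal.ofReal (a * b) * B := by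
  classical
  have key : ∀ {g μ : R3 → ℂ} {a : ℝ}, Measurable μ → 0 < a → (∀ ξ, g ξ ≠ 0 → ‖μ ξ‖ ≤ a) →
      ∃ μ' : R3 → ℂ, Measurable μ' ∧ (∀ ξ, ‖μ' ξ‖ ≤ 1) ∧
        (fun ξ => μ ξ * g ξ) = fun ξ => (a : ℂ) * (μ' ξ * g ξ) := by
    intro g μ a hμ ha h
    refine ⟨fun ξ => if ‖μ ξ‖ ≤ a then (a : ℂ)⁻¹ * μ ξ else 0,
      Measurable.ite (measurableSet_le hμ.norm measurable_const) (hμ.const_mul _) measurable_const,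
      fun ξ => ?_, funext fun ξ => ?_⟩
    · dsimp only
      split_ifs with h1
      · rw [norm_mul, norm_inv, Complex.norm_real, Real.norm_of_nonneg ha.le, inv_mul_le_iff₀ ha]
        simpa using h1
      · simp
    · by_cases hg : g ξ = 0
      · simp [hg]
      · have : (a : ℂ) ≠ 0 := by exact_mod_cast ha.ne'
        simp only [if_pos (h ξ hg)]
        field_simp
  obtain ⟨μ', h1, h2, h3⟩ := key hμ ha hμa
  obtain ⟨ν', h4, h5, h6⟩ := key hν hb hνb
  rw [h3, h6, trilinear_const_mul, enorm_mul]
  gcongr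
  · rw [← ofReal_norm, Complex.norm_real, Real.norm_of_nonneg (by positivity)]
  · exact hB l μ' ν' h1 h4 h2 h5

/-- The identity |ξ|² - |ζ|² = (ξ-ζ)·(ξ+ζ) exhibits the factor η, that is, one derivative falling on
the first function. -/
lemma symbol_add_sub (η ζ : R3) :
    symbol (η + ζ) - symbol ζ = 4 * Real.pi ^ 2 * ∑ l, η l * ((η + ζ) l + ζ l) := by
  have h : ∀ x : R3, ‖x‖ ^ 2 = ∑ l, x l ^ 2 := fun x => by
    rw [EuclideanSpace.norm_sq_eq]; simp
  unfold symbol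
  simp only [mul_pow, h, Fin.sum_univ_three, PiLp.add_apply]
  ring

lemma abs_coord_le_sqrt_symbol (ξ : R3) (l : Fin 3) : |ξ l| ≤ √(symbol ξ) / (2 * Real.pi) := by
  have h1 : |ξ l| ≤ ‖ξ‖ := by
    simpa using PiLp.norm_apply_le ξ l
  rw [le_div_iff₀ (by positivity)]
  refine Real.le_sqrt_of_sq_le ?_
  unfold symbol
  have : (|ξ l| * (2 * Real.pi)) ^ 2 ≤ (2 * Real.pi * ‖ξ‖) ^ 2 := by
    rw [mul_comm (2 * Real.pi)]
    gcongr
  linarith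

/-- The constant in the bound for divided differences of the Sobolev weight. -/
noncomputable def schurConst (s r : ℝ) : ℝ :=
  12 * Real.pi * ∑' n : ℕ, n * |Ring.choose s n| * r ^ (n - 1)

/-- The symbol of `1 - Δ`, recentred at `c`. -/
noncomputable def centered (c : ℝ) (ξ : R3) : ℝ := symbol ξ / c - 1

lemma continuous_centered (c : ℝ) : Continuous (centered c) :=
  (continuous_symbol.div_const c).sub continuous_const

lemma abs_centered_le {c r : ℝ} (hc : 0 < c) {ξ : R3}
    (h : (1 - r) * c ≤ symbol ξ ∧ symbol ξ ≤ c) : |centered c ξ| ≤ r := by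
  have h3 : 1 - r ≤ symbol ξ / c := (le_div_iff₀ hc).2 h.1
  have h4 : symbol ξ / c ≤ 1 := (div_le_one hc).2 h.2
  unfold centered
  rw [abs_le]; constructor <;> linarith

/-- The integrand of the trilinear form with `η_l f` and multipliers on `g` and `h`. -/
noncomputable def splitIntegrand (f g h : R3 → ℂ) (l : Fin 3) (m₁ m₂ : R3 → ℝ) (p : R3 × R3) : ℂ :=
  mulCoord l f p.1 * ((m₁ p.2 : ℂ) * g p.2) * conj ((m₂ (p.1 + p.2) : ℂ) * h (p.1 + p.2))

lemma integrable_splitIntegrand {f g h : R3 → ℂ} (hf : IsBandLimited f) (hg : IsBandLimited g)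
    (hh : IsBandLimited h) (l : Fin 3) {m₁ m₂ : R3 → ℝ} (h₁ : Continuous m₁) (h₂ : Continuous m₂) :
    Integrable (splitIntegrand f g h l m₁ m₂) := by
  have e₁ : Continuous fun ξ => (m₁ ξ : ℂ) := Complex.continuous_ofReal.comp h₁
  have e₂ : Continuous fun ξ => (m₂ ξ : ℂ) := Complex.continuous_ofReal.comp h₂
  have hf' : IsBandLimited (mulCoord l f) := hf.mulCoord l
  have hg' : IsBandLimited fun ξ => (m₁ ξ : ℂ) * g ξ := hg.mul_continuous e₁
  have hh' : IsBandLimited fun ξ => (m₂ ξ : ℂ) * h ξ := hh.mul_continuous e₂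
  have := hf'.integrable_trilinear hg' hh'
  unfold splitIntegrand
  exact this

lemma IsMultiplierBound.enorm_integral_splitIntegrand_le {f g h : R3 → ℂ} {B : ℝ≥0∞}
    (hB : IsMultiplierBound f g h B) (l : Fin 3) {m₁ m₂ : R3 → ℝ} (h₁ : Continuous m₁)
    (h₂ : Continuous m₂) {a b : ℝ} (ha : 0 < a) (hb : 0 < b) (hga : ∀ ξ, g ξ ≠ 0 → |m₁ ξ| ≤ a)
    (hhb : ∀ ξ, h ξ ≠ 0 → |m₂ ξ| ≤ b) :
    ‖∫ p, splitIntegrand f g h l m₁ m₂ p‖ₑ ≤ ENNReal.ofReal (a * b) * B := by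
  refine hB.le_of_support l (μ := fun ξ => (m₁ ξ : ℂ)) (ν := fun ξ => (m₂ ξ : ℂ))
    (Complex.continuous_ofReal.comp h₁).measurable (Complex.continuous_ofReal.comp h₂).measurable
    ha hb (fun ξ h => ?_) (fun ξ h => ?_)
  · rw [Complex.norm_real]; exact hga ξ h
  · rw [Complex.norm_real]; exact hhb ξ h

/-- Factoring a^n - b^n separates the variables ξ and ζ: each summand carries one multiplier in ζ,
one in ξ, and a factor η_l on f. A multiplier depending jointly on ξ and ζ could not be passed to
physical space this way. -/
lemma centered_pow_sub_mul (f g h : R3 → ℂ) (c : ℝ) (n : ℕ) (p : R3 × R3) :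
    ((centered c (p.1 + p.2) ^ n - centered c p.2 ^ n : ℝ) : ℂ) *
      (f p.1 * g p.2 * conj (h (p.1 + p.2))) = ((4 * Real.pi ^ 2 / c : ℝ) : ℂ) *
        ∑ k ∈ Finset.range n, ∑ l,
          (splitIntegrand f g h l (fun ξ => centered c ξ ^ (n - 1 - k))
              (fun ξ => ξ l * centered c ξ ^ k) p +
            splitIntegrand f g h l (fun ξ => ξ l * centered c ξ ^ (n - 1 - k))
              (fun ξ => centered c ξ ^ k) p) := by
  have h1 : centered c (p.1 + p.2) ^ n - centered c p.2 ^ n = ((4 * Real.pi ^ 2 / c : ℝ)) *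
      ∑ k ∈ Finset.range n, ∑ l, p.1 l * ((p.1 + p.2) l + p.2 l) *
        (centered c (p.1 + p.2) ^ k * centered c p.2 ^ (n - 1 - k)) := by
    rw [← geom_sum₂_mul]
    have : centered c (p.1 + p.2) - centered c p.2 =
        4 * Real.pi ^ 2 / c * ∑ l, p.1 l * ((p.1 + p.2) l + p.2 l) := by
      unfold centered
      rw [sub_sub_sub_cancel_right, ← sub_div, symbol_add_sub]
      ring
    rw [this]
    simp only [← Finset.sum_mul, ← Finset.mul_sum]
    ring
  rw [h1, Complex.ofReal_mul, mul_assoc, Complex.ofReal_sum, Finset.sum_mul]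
  congr 1
  refine Finset.sum_congr rfl fun k _ => ?_
  rw [Complex.ofReal_sum, Finset.sum_mul]
  refine Finset.sum_congr rfl fun l _ => ?_
  simp only [splitIntegrand, mulCoord, map_mul, Complex.conj_ofReal, Complex.ofReal_mul,
    Complex.ofReal_add]
  ring

/-- There are n exponents, 3 directions and 2 terms, each of size r^(n-1) √c / (2π); with the
prefactor 4π²/c this makes 12π n r^(n-1) / √c. -/
lemma enorm_integral_pow_sub_le {f g h : R3 → ℂ} (hf : IsBandLimited f) (hg : IsBandLimited g)
    (hh : IsBandLimited h) {c r : ℝ} (hc : 0 < c) (hr0 : 0 < r)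
    (hgs : ∀ ξ, g ξ ≠ 0 → (1 - r) * c ≤ symbol ξ ∧ symbol ξ ≤ c)
    (hhs : ∀ ξ, h ξ ≠ 0 → (1 - r) * c ≤ symbol ξ ∧ symbol ξ ≤ c) {B : ℝ≥0∞}
    (hB : IsMultiplierBound f g h B) (n : ℕ) :
    ‖∫ p : R3 × R3, ((centered c (p.1 + p.2) ^ n - centered c p.2 ^ n : ℝ) : ℂ) *
        (f p.1 * g p.2 * conj (h (p.1 + p.2)))‖ₑ ≤
      ENNReal.ofReal (n * r ^ (n - 1) * (12 * Real.pi / √c)) * B := by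
  have hxc := continuous_centered c
  have hsc : 0 < √c := Real.sqrt_pos.2 hc
  have hcl : ∀ l : Fin 3, Continuous fun ξ : R3 => ξ l := fun l => by fun_prop
  have hxp : ∀ (k : ℕ) (ξ : R3), (1 - r) * c ≤ symbol ξ ∧ symbol ξ ≤ c →
      |centered c ξ ^ k| ≤ r ^ k := by
    intro k ξ h
    rw [abs_pow]
    exact pow_le_pow_left₀ (abs_nonneg _) (abs_centered_le hc h) k
  have hxq : ∀ (k : ℕ) (l : Fin 3) (ξ : R3), (1 - r) * c ≤ symbol ξ ∧ symbol ξ ≤ c →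
      |ξ l * centered c ξ ^ k| ≤ √c / (2 * Real.pi) * r ^ k := by
    intro k l ξ h
    rw [abs_mul]
    refine mul_le_mul ((abs_coord_le_sqrt_symbol ξ l).trans ?_) (hxp k ξ h) (abs_nonneg _)
      (by positivity)
    have := Real.sqrt_le_sqrt h.2
    gcongr
  have hi1 : ∀ k l, Integrable (splitIntegrand f g h l (fun ξ => centered c ξ ^ (n - 1 - k))
      (fun ξ => ξ l * centered c ξ ^ k)) := fun k l =>
    integrable_splitIntegrand hf hg hh l (hxc.pow _) ((hcl l).mul (hxc.pow _))
  have hi2 : ∀ k l, Integrable (splitIntegrand f g h l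
      (fun ξ => ξ l * centered c ξ ^ (n - 1 - k)) (fun ξ => centered c ξ ^ k)) := fun k l =>
    integrable_splitIntegrand hf hg hh l ((hcl l).mul (hxc.pow _)) (hxc.pow _)
  have hi12 : ∀ k l, Integrable fun p => splitIntegrand f g h l
      (fun ξ => centered c ξ ^ (n - 1 - k)) (fun ξ => ξ l * centered c ξ ^ k) p +
      splitIntegrand f g h l (fun ξ => ξ l * centered c ξ ^ (n - 1 - k))
        (fun ξ => centered c ξ ^ k) p := fun k l => (hi1 k l).add (hi2 k l)
  have hbd : ∀ k ∈ Finset.range n, ∀ l,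
      ‖∫ p, (splitIntegrand f g h l (fun ξ => centered c ξ ^ (n - 1 - k))
          (fun ξ => ξ l * centered c ξ ^ k) p + splitIntegrand f g h l
          (fun ξ => ξ l * centered c ξ ^ (n - 1 - k)) (fun ξ => centered c ξ ^ k) p)‖ₑ ≤
      ENNReal.ofReal (2 * (r ^ (n - 1) * (√c / (2 * Real.pi)))) * B := by
    intro k hk l
    have hk := Finset.mem_range.1 hk
    have hrr : r ^ (n - 1) = r ^ (n - 1 - k) * r ^ k := by
      rw [← pow_add]; congr 1; omega
    rw [integral_add (hi1 k l) (hi2 k l)]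
    refine (enorm_add_le _ _).trans ?_
    have e1 := hB.enorm_integral_splitIntegrand_le l (hxc.pow (n - 1 - k))
      ((hcl l).mul (hxc.pow k)) (a := r ^ (n - 1 - k)) (b := √c / (2 * Real.pi) * r ^ k)
      (by positivity) (by positivity)
      (fun ξ h => hxp _ ξ (hgs ξ h)) (fun ξ h => hxq _ l ξ (hhs ξ h))
    have e2 := hB.enorm_integral_splitIntegrand_le l ((hcl l).mul (hxc.pow (n - 1 - k)))
      (hxc.pow k) (a := √c / (2 * Real.pi) * r ^ (n - 1 - k)) (b := r ^ k)
      (by positivity) (by positivity)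
      (fun ξ h => hxq _ l ξ (hgs ξ h)) (fun ξ h => hxp _ ξ (hhs ξ h))
    refine (add_le_add e1 e2).trans_eq ?_
    rw [← add_mul, ← ENNReal.ofReal_add (by positivity) (by positivity), hrr]
    congr 2
    ring
  have hmain : ∫ p : R3 × R3, ((centered c (p.1 + p.2) ^ n - centered c p.2 ^ n : ℝ) : ℂ) *
        (f p.1 * g p.2 * conj (h (p.1 + p.2))) = ((4 * Real.pi ^ 2 / c : ℝ) : ℂ) *
      ∑ k ∈ Finset.range n, ∑ l, ∫ p, (splitIntegrand f g h l
          (fun ξ => centered c ξ ^ (n - 1 - k)) (fun ξ => ξ l * centered c ξ ^ k) p +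
          splitIntegrand f g h l (fun ξ => ξ l * centered c ξ ^ (n - 1 - k))
          (fun ξ => centered c ξ ^ k) p) := by
    rw [integral_congr_ae (Eventually.of_forall (centered_pow_sub_mul f g h c n)),
      integral_const_mul, integral_finsetSum _ fun k _ => integrable_finsetSum _ fun l _ =>
        hi12 k l]
    congr 1
    refine Finset.sum_congr rfl fun k _ => ?_
    rw [integral_finsetSum _ fun l _ => hi12 k l]
  rw [hmain, enorm_mul]
  calc _ ≤ ENNReal.ofReal (4 * Real.pi ^ 2 / c) * ∑ k ∈ Finset.range n, ∑ l : Fin 3,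
        ENNReal.ofReal (2 * (r ^ (n - 1) * (√c / (2 * Real.pi)))) * B := by
        refine mul_le_mul' (le_of_eq ?_) ?_
        · rw [← ofReal_norm, Complex.norm_real, Real.norm_of_nonneg (by positivity)]
        · refine (enorm_sum_le _ _).trans (Finset.sum_le_sum fun k hk => ?_)
          exact (enorm_sum_le _ _).trans (Finset.sum_le_sum fun l _ => hbd k hk l)
    _ = _ := by
        simp only [Finset.sum_const, Finset.card_range, Finset.card_univ, Fintype.card_fin,
          nsmul_eq_mul]
        rw [show ((n : ℕ) : ℝ≥0∞) = ENNReal.ofReal n by simp,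
          show (((3 : ℕ) : ℝ≥0∞)) = ENNReal.ofReal 3 by simp]
        rw [← mul_assoc (ENNReal.ofReal 3), ← mul_assoc (ENNReal.ofReal n), ← mul_assoc,
          ← ENNReal.ofReal_mul (by norm_num), ← ENNReal.ofReal_mul (by positivity),
          ← ENNReal.ofReal_mul (by positivity)]
        congr 2
        have hpi := Real.pi_pos
        have hcc : √c * √c = c := Real.mul_self_sqrt hc.le
        field_simp
        nlinarith [hcc]

/-- On the supports the symbol lies within relative distance r < 1 of c, so the weight is c^s times
a convergent binomial series in `centered c`. Each power is treated by `enorm_integral_pow_sub_le`,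
and the total gains a factor 1/√c over the weight. -/
lemma enorm_integral_weight_sub_le (s : ℝ) {f g h : R3 → ℂ} (hf : IsBandLimited f)
    (hg : IsBandLimited g) (hh : IsBandLimited h) {c r : ℝ} (hc : 0 < c) (hr0 : 0 < r)
    (hr1 : r < 1)
    (hgs : ∀ ξ, g ξ ≠ 0 → (1 - r) * c ≤ symbol ξ ∧ symbol ξ ≤ c)
    (hhs : ∀ ξ, h ξ ≠ 0 → (1 - r) * c ≤ symbol ξ ∧ symbol ξ ≤ c) {B : ℝ≥0∞}
    (hB : IsMultiplierBound f g h B) :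
    ‖∫ p : R3 × R3, ((sobolevWeight s (p.1 + p.2) - sobolevWeight s p.2 : ℝ) : ℂ) *
        (f p.1 * g p.2 * conj (h (p.1 + p.2)))‖ₑ ≤
      ENNReal.ofReal (c ^ s / √c * schurConst s r) * B := by
  have hxc := continuous_centered c
  have hxr : ∀ ξ, (1 - r) * c ≤ symbol ξ ∧ symbol ξ ≤ c → |centered c ξ| ≤ r := fun ξ =>
    abs_centered_le hc
  have hw : ∀ ξ, (1 - r) * c ≤ symbol ξ ∧ symbol ξ ≤ c →
      HasSum (fun n : ℕ => c ^ s * (Ring.choose s n * centered c ξ ^ n)) (sobolevWeight s ξ) := by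
    intro ξ h
    have h1 := (hasSum_binomial s ((hxr ξ h).trans_lt hr1)).mul_left (c ^ s)
    have e : c ^ s * (1 + centered c ξ) ^ s = sobolevWeight s ξ := by
      have : 1 + centered c ξ = symbol ξ / c := by simp [centered]
      rw [this, Real.div_rpow (symbol_pos ξ).le hc.le, sobolevWeight_eq]
      have : c ^ s ≠ 0 := (Real.rpow_pos_of_pos hc s).ne'
      field_simp
    rwa [e] at h1
  set k : R3 × R3 → ℂ := fun p => f p.1 * g p.2 * conj (h (p.1 + p.2)) with hk
  have hki : Integrable k := hf.integrable_trilinear hg hh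
  let T : ℕ → R3 × R3 → ℂ := fun n p => ((c ^ s * Ring.choose s n : ℝ) : ℂ) *
    (((centered c (p.1 + p.2) ^ n - centered c p.2 ^ n : ℝ) : ℂ) * k p)
  have hcs : 0 < c ^ s := Real.rpow_pos_of_pos hc s
  have hTb : ∀ n p, ‖T n p‖ ≤ (c ^ s * (2 * (|Ring.choose s n| * r ^ n))) * ‖k p‖ := by
    intro n p
    -- Off the supports of g and h the kernel vanishes, so the powers of `centered c` need no bound
    -- there.
    by_cases hkp : k p = 0
    · simp [T, hkp]
    · have h1 : g p.2 ≠ 0 := fun h0 => hkp (by simp [hk, h0])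
      have h2 : h (p.1 + p.2) ≠ 0 := fun h0 => hkp (by simp [hk, h0])
      have e1 : |centered c (p.1 + p.2) ^ n| ≤ r ^ n := by
        rw [abs_pow]; exact pow_le_pow_left₀ (abs_nonneg _) (hxr _ (hhs _ h2)) n
      have e2 : |centered c p.2 ^ n| ≤ r ^ n := by
        rw [abs_pow]; exact pow_le_pow_left₀ (abs_nonneg _) (hxr _ (hgs _ h1)) n
      simp only [T]
      rw [norm_mul, norm_mul, Complex.norm_real, Complex.norm_real, norm_mul,
        Real.norm_of_nonneg hcs.le, Real.norm_eq_abs, Real.norm_eq_abs, ← mul_assoc]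
      gcongr ?_ * _
      have e3 := (abs_sub (centered c (p.1 + p.2) ^ n) (centered c p.2 ^ n)).trans (add_le_add e1 e2)
      calc _ ≤ c ^ s * |Ring.choose s n| * (r ^ n + r ^ n) := by gcongr
        _ = _ := by ring
  have hTm : ∀ n, AEStronglyMeasurable (T n) := fun n => by
    have : Continuous fun p : R3 × R3 => ((centered c (p.1 + p.2) ^ n - centered c p.2 ^ n : ℝ) : ℂ) :=
      Complex.continuous_ofReal.comp (((hxc.comp continuous_add).pow n).sub
        ((hxc.comp continuous_snd).pow n))
    exact (this.aestronglyMeasurable.mul hki.1).const_mul _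
  have hTi : ∀ n, Integrable (T n) := fun n =>
    Integrable.mono' (hki.norm.const_mul _) (hTm n) (Eventually.of_forall (hTb n))
  have hTs : Summable fun n => ∫ p, ‖T n p‖ := by
    have hsum : Summable fun n : ℕ => |Ring.choose s n| * r ^ n := by
      have := (hasSum_binomial s (x := r) (by rwa [abs_of_pos hr0])).summable.abs
      simpa [abs_mul, abs_of_pos hr0] using this
    refine Summable.of_nonneg_of_le (fun n => integral_nonneg fun _ => norm_nonneg _) (fun n => ?_)
      (((hsum.mul_left 2).mul_left (c ^ s)).mul_right (∫ p, ‖k p‖))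
    rw [← integral_const_mul]
    exact integral_mono (hTi n).norm (hki.norm.const_mul _) (hTb n)
  have hS := hasSum_integral_of_summable_integral_norm hTi hTs
  have hpt : ∀ p, ∑' n, T n p = ((sobolevWeight s (p.1 + p.2) - sobolevWeight s p.2 : ℝ) : ℂ) * k p := by
    intro p
    by_cases hkp : k p = 0
    · simp [T, hkp]
    · have h1 : g p.2 ≠ 0 := fun h0 => hkp (by simp [hk, h0])
      have h2 : h (p.1 + p.2) ≠ 0 := fun h0 => hkp (by simp [hk, h0])
      have h3 := (hw _ (hhs _ h2)).sub (hw _ (hgs _ h1))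
      have h4 := (Complex.hasSum_ofReal.2 h3).mul_right (k p)
      rw [← h4.tsum_eq]
      refine tsum_congr fun n => ?_
      simp only [T]
      push_cast
      ring
  simp_rw [hpt] at hS
  rw [← hS.tsum_eq]
  refine (enorm_tsum_le_tsum_enorm).trans ?_
  have hn : ∀ n, ‖∫ p, T n p‖ₑ ≤ ENNReal.ofReal
      (c ^ s / √c * (12 * Real.pi) * (n * |Ring.choose s n| * r ^ (n - 1))) * B := by
    intro n
    simp only [T]
    rw [integral_const_mul, enorm_mul]
    refine (mul_le_mul' le_rfl (enorm_integral_pow_sub_le hf hg hh hc hr0 hgs hhs hB n)).trans_eq ?_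
    rw [← ofReal_norm, Complex.norm_real, norm_mul, Real.norm_of_nonneg hcs.le, Real.norm_eq_abs,
      ← mul_assoc, ← ENNReal.ofReal_mul (by positivity)]
    congr 2
    ring
  refine (ENNReal.tsum_le_tsum hn).trans_eq ?_
  rw [ENNReal.tsum_mul_right, ← ENNReal.ofReal_tsum_of_nonneg (fun n => by positivity)
    ((summable_binomial_deriv s hr0 hr1).mul_left _), tsum_mul_left, schurConst]
  congr 2
  ring

/-! ### The advection density and its antisymmetry -/

/-- The Fourier transform of a real divergence-free vector field. -/
structure IsSolenoidal (U : Fin 3 → R3 → ℂ) : Prop where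
  div_eq_zero : ∀ ξ : R3, ∑ j, (ξ j : ℂ) * U j ξ = 0
  map_neg : ∀ i ξ, U i (-ξ) = conj (U i ξ)

/-- The integrand of `⟨u · ∇ u, u⟩` on the frequency side, at `p = (η, ξ - η)`. -/
noncomputable def advectionDensity (U : Fin 3 → R3 → ℂ) (p : R3 × R3) : ℂ :=
  ∑ i, ∑ j, U j p.1 * U i p.2 * conj (mulCoord j (U i) (p.1 + p.2))

lemma advectionDensity_eq (U : Fin 3 → R3 → ℂ) (p : R3 × R3) :
    advectionDensity U p =
      (∑ j, ((p.1 + p.2) j : ℂ) * U j p.1) * ∑ i, U i p.2 * conj (U i (p.1 + p.2)) := by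
  unfold advectionDensity
  rw [Finset.sum_mul_sum, Finset.sum_comm]
  refine Finset.sum_congr rfl fun j _ => Finset.sum_congr rfl fun i _ => ?_
  simp only [mulCoord, map_mul, Complex.conj_ofReal]
  ring

lemma IsSolenoidal.sum_add_coord {U : Fin 3 → R3 → ℂ} (hU : IsSolenoidal U) (η ζ : R3) :
    ∑ j, ((η + ζ) j : ℂ) * U j η = ∑ j, (ζ j : ℂ) * U j η := by
  have h := hU.div_eq_zero η
  simp only [PiLp.add_apply, Complex.ofReal_add, add_mul, Finset.sum_add_distrib, h, zero_add]

/-- The reflection `(η, ζ) ↦ (η, -η - ζ)`. -/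
def reflect : R3 × R3 ≃ᵐ R3 × R3 where
  toFun p := (p.1, -(p.1 + p.2))
  invFun p := (p.1, -(p.1 + p.2))
  left_inv p := by simp
  right_inv p := by simp
  measurable_toFun := by
    change Measurable fun p : R3 × R3 => (p.1, -(p.1 + p.2))
    fun_prop
  measurable_invFun := by
    change Measurable fun p : R3 × R3 => (p.1, -(p.1 + p.2))
    fun_prop

lemma measurePreserving_reflect :
    MeasurePreserving reflect (volume : Measure (R3 × R3)) volume := by
  have h1 := measurePreserving_prod_add (volume : Measure R3) (volume : Measure R3)
  have h2 := (MeasurePreserving.id (volume : Measure R3)).prod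
    (Measure.measurePreserving_neg (volume : Measure R3))
  exact h2.comp h1

lemma reflect_apply (p : R3 × R3) : reflect p = (p.1, -(p.1 + p.2)) := rfl

lemma fst_add_snd_reflect (p : R3 × R3) : (reflect p).1 + (reflect p).2 = -p.2 := by
  rw [reflect_apply]
  exact add_neg_eq_of_eq_add (by abel)

/-- By the divergence condition the transport factor is ζ·U(η) as well as (η+ζ)·U(η). The reflection
sends η+ζ to -ζ and so flips its sign, while reality of u makes the remaining product invariant.
This is the frequency form of ∫ (u·∇u)·u = 0. -/
lemma IsSolenoidal.advectionDensity_reflect {U : Fin 3 → R3 → ℂ} (hU : IsSolenoidal U)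
    (p : R3 × R3) : advectionDensity U (reflect p) = -advectionDensity U p := by
  have h2 : p.1 + -(p.1 + p.2) = -p.2 := by abel
  simp only [reflect_apply, advectionDensity_eq, h2, hU.map_neg, hU.sum_add_coord]
  have h3 : ∑ j, (((-p.2 : R3) j : ℝ) : ℂ) * U j p.1 = -∑ j, (p.2 j : ℂ) * U j p.1 := by
    simp [Finset.sum_neg_distrib]
  rw [h3]
  have h4 : ∑ i, conj (U i (p.1 + p.2)) * conj (conj (U i p.2)) =
      ∑ i, U i p.2 * conj (U i (p.1 + p.2)) :=
    Finset.sum_congr rfl fun i _ => by rw [Complex.conj_conj, mul_comm]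
  rw [h4]
  ring

lemma IsSolenoidal.integral_swap {U : Fin 3 → R3 → ℂ} (hU : IsSolenoidal U) {k : R3 → R3 → ℂ}
    (hk : ∀ ξ ζ, k (-ξ) (-ζ) = k ξ ζ) :
    ∫ p : R3 × R3, k (p.1 + p.2) p.2 * advectionDensity U p =
      -∫ p : R3 × R3, k p.2 (p.1 + p.2) * advectionDensity U p := by
  rw [← measurePreserving_reflect.integral_comp', ← integral_neg]
  refine integral_congr_ae (Eventually.of_forall fun p => ?_)
  dsimp only
  rw [fst_add_snd_reflect, hU.advectionDensity_reflect, reflect_apply, hk, mul_neg]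

/-! ### Splitting into near and far frequency interactions -/

/-- The sum of the products of non-adjacent shells. -/
noncomputable def farPair (n : ℕ) (ξ ζ : R3) : ℝ :=
  ∑ q ∈ Finset.range (n + 1), shell q ξ * farFilter n q ζ

/-- Adjacency is symmetric. Thus the far cutoff survives the exchange of ξ and ζ and the
antisymmetry can be used on the far part alone. -/
lemma farPair_comm (n : ℕ) (ξ ζ : R3) : farPair n ξ ζ = farPair n ζ ξ := by
  unfold farPair farFilter
  simp only [Finset.mul_sum]
  rw [Finset.sum_comm' (t' := Finset.range (n + 1))
    (s' := fun r => (Finset.range (n + 1)).filter fun q => ¬ Adjacent r q)]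
  · exact Finset.sum_congr rfl fun q _ => Finset.sum_congr rfl fun r _ => mul_comm _ _
  · intro q r
    simp only [Finset.mem_filter, adjacent_comm (q := q)]
    tauto

lemma farFilter_neg (n q : ℕ) (ξ : R3) : farFilter n q (-ξ) = farFilter n q ξ := by
  simp [farFilter, shell_neg]

lemma farPair_neg (n : ℕ) (ξ ζ : R3) : farPair n (-ξ) (-ζ) = farPair n ξ ζ := by
  simp [farPair, shell_neg, farFilter_neg]

/-- The interaction of adjacent frequencies, with the difference of the weights. -/
noncomputable def nearTerm (s : ℝ) (n : ℕ) (f g h : R3 → ℂ) (q : ℕ) : ℂ :=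
  ∫ p : R3 × R3, ((sobolevWeight s (p.1 + p.2) - sobolevWeight s p.2 : ℝ) : ℂ) *
    (f p.1 * ((nearFilter n q p.2 : ℂ) * g p.2) *
      conj ((shell q (p.1 + p.2) : ℂ) * h (p.1 + p.2)))

/-- The interaction of distant frequencies. -/
noncomputable def farTerm (s : ℝ) (n : ℕ) (f g h : R3 → ℂ) (q : ℕ) : ℂ :=
  trilinear f (fun ξ => (farFilter n q ξ : ℂ) * g ξ)
    (fun ξ => (sobolevWeight s ξ : ℂ) * ((shell q ξ : ℂ) * h ξ))

lemma IsBandLimited.mul_real {f : R3 → ℂ} (hf : IsBandLimited f) {m : R3 → ℝ} (hm : Continuous m) :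
    IsBandLimited fun ξ => (m ξ : ℂ) * f ξ :=
  hf.mul_continuous (m := fun ξ => (m ξ : ℂ)) (Complex.continuous_ofReal.comp hm)

lemma integrable_mul_mul_trilinear {f g h : R3 → ℂ} (hf : IsBandLimited f) (hg : IsBandLimited g)
    (hh : IsBandLimited h) {a b : R3 → ℝ} (ha : Continuous a) (hb : Continuous b) :
    Integrable fun p : R3 × R3 => ((a (p.1 + p.2) * b p.2 : ℝ) : ℂ) *
      (f p.1 * g p.2 * conj (h (p.1 + p.2))) := by
  have h1 : IsBandLimited fun ξ => (b ξ : ℂ) * g ξ := hg.mul_real hb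
  have h2 : IsBandLimited fun ξ => (a ξ : ℂ) * h ξ := hh.mul_real ha
  refine (hf.integrable_trilinear h1 h2).congr (Eventually.of_forall fun p => ?_)
  simp only [map_mul, Complex.conj_ofReal, Complex.ofReal_mul]
  ring

lemma integrable_mul_advectionDensity {U : Fin 3 → R3 → ℂ}
    (hU : ∀ i, IsBandLimited (U i)) {a b : R3 → ℝ} (ha : Continuous a) (hb : Continuous b) :
    Integrable fun p : R3 × R3 => ((a (p.1 + p.2) * b p.2 : ℝ) : ℂ) * advectionDensity U p := by
  simp only [advectionDensity, Finset.mul_sum]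
  exact integrable_finsetSum _ fun i _ => integrable_finsetSum _ fun j _ =>
    integrable_mul_mul_trilinear (hU j) (hU i) ((hU i).mulCoord j) ha hb

lemma integral_mul_advectionDensity {U : Fin 3 → R3 → ℂ}
    (hU : ∀ i, IsBandLimited (U i)) {a b : R3 → ℝ} (ha : Continuous a) (hb : Continuous b) :
    ∫ p : R3 × R3, ((a (p.1 + p.2) * b p.2 : ℝ) : ℂ) * advectionDensity U p =
      ∑ i, ∑ j, ∫ p : R3 × R3, ((a (p.1 + p.2) * b p.2 : ℝ) : ℂ) *
        (U j p.1 * U i p.2 * conj (mulCoord j (U i) (p.1 + p.2))) := by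
  have hi : ∀ i j, Integrable fun p : R3 × R3 => ((a (p.1 + p.2) * b p.2 : ℝ) : ℂ) *
        (U j p.1 * U i p.2 * conj (mulCoord j (U i) (p.1 + p.2))) := fun i j =>
    integrable_mul_mul_trilinear (hU j) (hU i) ((hU i).mulCoord j) ha hb
  simp only [advectionDensity, Finset.mul_sum]
  rw [integral_finsetSum _ fun i _ => integrable_finsetSum _ fun j _ => hi i j]
  exact Finset.sum_congr rfl fun i _ => integral_finsetSum _ fun j _ => hi i j

/-- The near and far products add up to `lowPass n` at ξ times `lowPass n` at ζ, which is 1 wherever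
the density does not vanish. -/
lemma advectionDensity_split {U : Fin 3 → R3 → ℂ} {n : ℕ}
    (hn : ∀ i ξ, U i ξ ≠ 0 → lowPass n ξ = 1) (p : R3 × R3) :
    advectionDensity U p = ∑ q ∈ Finset.range (n + 1),
      ((shell q (p.1 + p.2) * nearFilter n q p.2 : ℝ) : ℂ) * advectionDensity U p +
      (farPair n (p.1 + p.2) p.2 : ℂ) * advectionDensity U p := by
  have h1 : ((∑ q ∈ Finset.range (n + 1), shell q (p.1 + p.2) * nearFilter n q p.2) +
      farPair n (p.1 + p.2) p.2) = lowPass n (p.1 + p.2) * lowPass n p.2 := by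
    rw [farPair, ← Finset.sum_add_distrib, ← sum_shell, Finset.sum_mul]
    refine Finset.sum_congr rfl fun q _ => ?_
    rw [← nearFilter_add_farFilter n q, mul_add]
  rw [← Finset.sum_mul, ← add_mul, ← Complex.ofReal_sum, ← Complex.ofReal_add, h1, advectionDensity,
    Finset.mul_sum]
  refine Finset.sum_congr rfl fun i _ => ?_
  rw [Finset.mul_sum]
  refine Finset.sum_congr rfl fun j _ => ?_
  by_cases h2 : U i p.2 = 0
  · simp [h2]
  by_cases h3 : U i (p.1 + p.2) = 0
  · simp [h3, mulCoord]
  rw [hn i _ h2, hn i _ h3]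
  simp

/-- The decomposition of the commutator into frequency interactions. -/
lemma integral_weight_sub_advectionDensity {U : Fin 3 → R3 → ℂ}
    (hU : ∀ i, IsBandLimited (U i)) (hS : IsSolenoidal U) (s : ℝ) {n : ℕ}
    (hn : ∀ i ξ, U i ξ ≠ 0 → lowPass n ξ = 1) :
    ∫ p : R3 × R3, ((sobolevWeight s (p.1 + p.2) - sobolevWeight s p.2 : ℝ) : ℂ) *
        advectionDensity U p =
      ∑ i, ∑ j, ∑ q ∈ Finset.range (n + 1), (nearTerm s n (U j) (U i) (mulCoord j (U i)) q +
        2 * farTerm s n (U j) (U i) (mulCoord j (U i)) q) := by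
  have hw := continuous_sobolevWeight s
  have hws : ∀ q, Continuous fun ξ => sobolevWeight s ξ * shell q ξ := fun q =>
    hw.mul (continuous_shell q)
  have hwn : ∀ q, Continuous fun ξ => sobolevWeight s ξ * nearFilter n q ξ := fun q =>
    hw.mul (continuous_nearFilter n q)
  let W : R3 × R3 → ℂ := fun p => ((sobolevWeight s (p.1 + p.2) - sobolevWeight s p.2 : ℝ) : ℂ)
  have hfar1 : Integrable fun p : R3 × R3 => ((sobolevWeight s (p.1 + p.2) *
      farPair n (p.1 + p.2) p.2 : ℝ) : ℂ) * advectionDensity U p := by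
    have : ∀ p : R3 × R3, ((sobolevWeight s (p.1 + p.2) * farPair n (p.1 + p.2) p.2 : ℝ) : ℂ) *
        advectionDensity U p = ∑ q ∈ Finset.range (n + 1), (((sobolevWeight s (p.1 + p.2) *
          shell q (p.1 + p.2)) * farFilter n q p.2 : ℝ) : ℂ) * advectionDensity U p := by
      intro p
      rw [← Finset.sum_mul, ← Complex.ofReal_sum, farPair, Finset.mul_sum]
      simp only [mul_assoc]
    simp_rw [this]
    exact integrable_finsetSum _ fun q _ => integrable_mul_advectionDensity hU
      (hws q) (continuous_farFilter n q)
  have hfar2 : Integrable fun p : R3 × R3 => ((sobolevWeight s p.2 *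
      farPair n (p.1 + p.2) p.2 : ℝ) : ℂ) * advectionDensity U p := by
    have : ∀ p : R3 × R3, ((sobolevWeight s p.2 * farPair n (p.1 + p.2) p.2 : ℝ) : ℂ) *
        advectionDensity U p = ∑ q ∈ Finset.range (n + 1), ((
          shell q (p.1 + p.2) * (sobolevWeight s p.2 * farFilter n q p.2) : ℝ) : ℂ) *
            advectionDensity U p := by
      intro p
      rw [← Finset.sum_mul, ← Complex.ofReal_sum, farPair, Finset.mul_sum]
      simp only [mul_left_comm]
    simp_rw [this]
    exact integrable_finsetSum _ fun q _ => integrable_mul_advectionDensity hU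
      (continuous_shell q) (hw.mul (continuous_farFilter n q))
  -- The far part with the weight at ζ is minus the far part with the weight at ξ; this is the
  -- origin of the factor 2 before `farTerm`.
  have hswap := hS.integral_swap
    (k := fun ξ ζ => ((sobolevWeight s ζ * farPair n ξ ζ : ℝ) : ℂ))
    (fun ξ ζ => by rw [farPair_neg, sobolevWeight_neg])
  simp only [farPair_comm n (_ : R3 × R3).2] at hswap
  have hfar : ∫ p : R3 × R3, ((sobolevWeight s (p.1 + p.2) * farPair n (p.1 + p.2) p.2 : ℝ) : ℂ) *
      advectionDensity U p = ∑ i, ∑ j, ∑ q ∈ Finset.range (n + 1),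
        farTerm s n (U j) (U i) (mulCoord j (U i)) q := by
    have : ∀ p : R3 × R3, ((sobolevWeight s (p.1 + p.2) * farPair n (p.1 + p.2) p.2 : ℝ) : ℂ) *
        advectionDensity U p = ∑ q ∈ Finset.range (n + 1), (((sobolevWeight s (p.1 + p.2) *
          shell q (p.1 + p.2)) * farFilter n q p.2 : ℝ) : ℂ) * advectionDensity U p := by
      intro p
      rw [← Finset.sum_mul, ← Complex.ofReal_sum, farPair, Finset.mul_sum]
      simp only [mul_assoc]
    simp_rw [this]
    rw [integral_finsetSum _ fun q _ => integrable_mul_advectionDensity hU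
      (hws q) (continuous_farFilter n q)]
    simp_rw [integral_mul_advectionDensity hU (hws _)
      (continuous_farFilter n _)]
    rw [Finset.sum_comm]
    refine Finset.sum_congr rfl fun i _ => ?_
    rw [Finset.sum_comm]
    refine Finset.sum_congr rfl fun j _ => Finset.sum_congr rfl fun q _ => ?_
    refine integral_congr_ae (Eventually.of_forall fun p => ?_)
    simp only [map_mul, Complex.conj_ofReal, Complex.ofReal_mul]
    ring
  have hni : ∀ q i j, Integrable fun p : R3 × R3 => W p *
      (((shell q (p.1 + p.2) * nearFilter n q p.2 : ℝ) : ℂ) *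
        (U j p.1 * U i p.2 * conj (mulCoord j (U i) (p.1 + p.2)))) := by
    intro q i j
    have h1 := integrable_mul_mul_trilinear (hU j) (hU i) ((hU i).mulCoord j)
      (hws q) (continuous_nearFilter n q)
    have h2 := integrable_mul_mul_trilinear (hU j) (hU i) ((hU i).mulCoord j)
      (continuous_shell q) (hwn q)
    refine (h1.sub h2).congr (Eventually.of_forall fun p => ?_)
    simp only [W, Pi.sub_apply]
    push_cast
    ring
  have hnear : ∀ q, ∫ p : R3 × R3, W p * (((shell q (p.1 + p.2) * nearFilter n q p.2 : ℝ) : ℂ) *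
      advectionDensity U p) = ∑ i, ∑ j, nearTerm s n (U j) (U i) (mulCoord j (U i)) q := by
    intro q
    simp only [advectionDensity, Finset.mul_sum]
    rw [integral_finsetSum _ fun i _ => integrable_finsetSum _ fun j _ => hni q i j]
    refine Finset.sum_congr rfl fun i _ => ?_
    rw [integral_finsetSum _ fun j _ => hni q i j]
    refine Finset.sum_congr rfl fun j _ => ?_
    refine integral_congr_ae (Eventually.of_forall fun p => ?_)
    simp only [W, map_mul, Complex.conj_ofReal, Complex.ofReal_mul]
    ring
  have hnearI : ∀ q, Integrable fun p : R3 × R3 => W p *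
      (((shell q (p.1 + p.2) * nearFilter n q p.2 : ℝ) : ℂ) * advectionDensity U p) := by
    intro q
    simp only [advectionDensity, Finset.mul_sum]
    exact integrable_finsetSum _ fun i _ => integrable_finsetSum _ fun j _ => hni q i j
  have hpt : ∀ p : R3 × R3, W p * advectionDensity U p =
      (∑ q ∈ Finset.range (n + 1), W p * (((shell q (p.1 + p.2) * nearFilter n q p.2 : ℝ) : ℂ) *
        advectionDensity U p)) +
      (((sobolevWeight s (p.1 + p.2) * farPair n (p.1 + p.2) p.2 : ℝ) : ℂ) * advectionDensity U p -
        ((sobolevWeight s p.2 * farPair n (p.1 + p.2) p.2 : ℝ) : ℂ) * advectionDensity U p) := by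
    intro p
    conv_lhs => rw [advectionDensity_split hn p]
    rw [mul_add, Finset.mul_sum]
    congr 1
    simp only [W]
    push_cast
    ring
  have hsub : Integrable fun p : R3 × R3 =>
      ((sobolevWeight s (p.1 + p.2) * farPair n (p.1 + p.2) p.2 : ℝ) : ℂ) * advectionDensity U p -
        ((sobolevWeight s p.2 * farPair n (p.1 + p.2) p.2 : ℝ) : ℂ) * advectionDensity U p :=
    hfar1.sub hfar2
  change ∫ p, W p * advectionDensity U p = _
  simp_rw [hpt]
  rw [integral_add (integrable_finsetSum _ fun q _ => hnearI q) hsub,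
    integral_finsetSum _ fun q _ => hnearI q, integral_sub hfar1 hfar2, hswap, sub_neg_eq_add,
    ← two_mul, hfar]
  simp_rw [hnear]
  rw [Finset.sum_comm]
  simp only [Finset.mul_sum, Finset.sum_add_distrib]
  congr 1
  refine Finset.sum_congr rfl fun i _ => ?_
  rw [Finset.sum_comm]

/-! ### Multipliers and norms -/

lemma energy_mul_le {m f : R3 → ℂ} {c : ℝ} (h : ∀ ξ, f ξ ≠ 0 → ‖m ξ‖ ≤ c) :
    energy (fun ξ => m ξ * f ξ) ≤ ENNReal.ofReal c ^ 2 * energy f := by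
  unfold energy
  rw [← lintegral_const_mul' _ _ (by finiteness)]
  refine lintegral_mono fun ξ => ?_
  rw [enorm_mul, mul_pow]
  by_cases hf : f ξ = 0
  · simp [hf]
  · gcongr
    rw [← ofReal_norm]
    exact ENNReal.ofReal_le_ofReal (h ξ hf)

lemma sqrt_energy_mul_le {m f : R3 → ℂ} {c : ℝ} (h : ∀ ξ, f ξ ≠ 0 → ‖m ξ‖ ≤ c) :
    energy (fun ξ => m ξ * f ξ) ^ (1 / 2 : ℝ) ≤ ENNReal.ofReal c * energy f ^ (1 / 2 : ℝ) := by
  refine (ENNReal.rpow_le_rpow (energy_mul_le h) (by norm_num)).trans_eq ?_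
  rw [ENNReal.mul_rpow_of_nonneg _ _ (by norm_num), sq_sqrt]

lemma quarticNorm_mul_le {m f : R3 → ℂ} {c : ℝ} (h : ∀ ξ, f ξ ≠ 0 → ‖m ξ‖ ≤ c) :
    quarticNorm (fun ξ => m ξ * f ξ) ≤ ENNReal.ofReal c * quarticNorm f := by
  have h1 : ∀ j, energy (mulCoord j fun ξ => m ξ * f ξ) ≤
      ENNReal.ofReal c ^ 2 * energy (mulCoord j f) := fun j => by
    rw [energy_mulCoord_mul]
    exact energy_mul_le fun ξ hξ => h ξ fun h0 => hξ (by simp [mulCoord, h0])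
  have h2 : horizontalEnergy (fun ξ => m ξ * f ξ) ≤ ENNReal.ofReal c ^ 2 * horizontalEnergy f := by
    unfold horizontalEnergy
    rw [mul_add]
    exact add_le_add (h1 0) (h1 1)
  unfold quarticNorm
  refine (ENNReal.rpow_le_rpow (mul_le_mul' (energy_mul_le h) h2) (by norm_num)).trans_eq ?_
  rw [show ENNReal.ofReal c ^ 2 * energy f * (ENNReal.ofReal c ^ 2 * horizontalEnergy f) =
    ENNReal.ofReal c ^ 4 * (energy f * horizontalEnergy f) by ring,
    ENNReal.mul_rpow_of_nonneg _ _ (by norm_num), ← ENNReal.rpow_natCast, ← ENNReal.rpow_mul]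
  norm_num

lemma sobolevWeight_le_of_symbol_le {s : ℝ} (hs : 0 ≤ s) {c : ℝ} (hc : 0 ≤ c) {q : ℕ} {ξ : R3}
    (h : symbol ξ ≤ c * 4 ^ q) : sobolevWeight s ξ ≤ c ^ s * blockWeight s q := by
  rw [sobolevWeight_eq, blockWeight_eq, ← Real.mul_rpow hc (by positivity)]
  exact Real.rpow_le_rpow (symbol_pos ξ).le h hs

/-! ### Families of multipliers adapted to the dyadic scale -/

/-- The bound 5 is the one natural for `nearFilter`; using it for every family lets a single
`blockConst` serve them all. -/
lemma isSubordinate_shell : IsSubordinate (fun q ξ => (shell q ξ : ℂ)) 5 where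
  measurable q := (Complex.continuous_ofReal.comp (continuous_shell q)).measurable
  bound q ξ := by
    rw [Complex.norm_real]
    exact (abs_shell_le_one q ξ).trans (by norm_num)
  support q ξ h := by
    have := four_pow_le_of_shell_ne_zero (q := q) (ξ := ξ) (by exact_mod_cast h)
    linarith [symbol_pos ξ]

lemma isSubordinate_nearFilter (n : ℕ) : IsSubordinate (fun q ξ => (nearFilter n q ξ : ℂ)) 5 where
  measurable q := (Complex.continuous_ofReal.comp (continuous_nearFilter n q)).measurable
  bound q ξ := by
    rw [Complex.norm_real]
    exact abs_nearFilter_le n q ξ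
  support q ξ h := four_pow_le_of_nearFilter_ne_zero (n := n) (by exact_mod_cast h)

open Classical in
/-- The sharp cutoff to the frequencies of size at least `2 ^ q / 4`. -/
noncomputable def highPass (q : ℕ) (ξ : R3) : ℂ := if (2 : ℝ) ^ q ≤ 4 * ‖ξ‖ then 1 else 0

lemma measurable_highPass (q : ℕ) : Measurable (highPass q) :=
  Measurable.ite (measurableSet_le measurable_const (by fun_prop)) measurable_const measurable_const

lemma highPass_eq_one {q : ℕ} {ξ : R3} (h : (2 : ℝ) ^ q ≤ 4 * ‖ξ‖) : highPass q ξ = 1 := if_pos h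

lemma le_of_highPass_ne_zero {q : ℕ} {ξ : R3} (h : highPass q ξ ≠ 0) : (2 : ℝ) ^ q ≤ 4 * ‖ξ‖ := by
  by_contra h'
  exact h (if_neg h')

lemma norm_highPass_le (q : ℕ) (ξ : R3) : ‖highPass q ξ‖ ≤ 1 := by
  unfold highPass
  split_ifs <;> simp

lemma four_pow_le_of_highPass_ne_zero {q : ℕ} {ξ : R3} (h : highPass q ξ ≠ 0) :
    (4 : ℝ) ^ q ≤ 64 * symbol ξ := by
  have h1 := le_of_highPass_ne_zero h
  have h2 := sq_norm_le_symbol ξ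
  rw [four_pow_eq]
  nlinarith [pow_pos (two_pos (α := ℝ)) q, symbol_pos ξ, norm_nonneg ξ]

lemma isSubordinate_highPass : IsSubordinate highPass 5 where
  measurable := measurable_highPass
  bound q ξ := (norm_highPass_le q ξ).trans (by norm_num)
  support _ _ := four_pow_le_of_highPass_ne_zero

/-- The sharp cutoff to the frequencies of size at least `2 ^ q / 4`, times `2 ^ q / |ξ|`. -/
noncomputable def scaledHighPass (q : ℕ) (ξ : R3) : ℂ :=
  ((2 ^ q / ‖ξ‖ : ℝ) : ℂ) * highPass q ξ

lemma isSubordinate_scaledHighPass : IsSubordinate scaledHighPass 5 where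
  measurable q := by
    have : Measurable fun ξ : R3 => ((2 ^ q / ‖ξ‖ : ℝ) : ℂ) :=
      Complex.measurable_ofReal.comp (measurable_const.div measurable_norm)
    exact this.mul (measurable_highPass q)
  bound q ξ := by
    by_cases h : highPass q ξ = 0
    · simp [scaledHighPass, h]
    · have h1 := le_of_highPass_ne_zero h
      have h2 : 0 < ‖ξ‖ := by
        have := pow_pos (two_pos (α := ℝ)) q
        linarith
      rw [scaledHighPass, highPass_eq_one h1, mul_one, Complex.norm_real,
        Real.norm_of_nonneg (by positivity), div_le_iff₀ h2]
      linarith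
  support q ξ h := four_pow_le_of_highPass_ne_zero fun h0 => h (by simp [scaledHighPass, h0])

/-- This trades a factor 2^q for |ξ|. The quotient is harmless at the origin because the high-pass
cutoff vanishes there. -/
lemma scaledHighPass_mul_norm (q : ℕ) (ξ : R3) (z : ℂ) :
    scaledHighPass q ξ * ((‖ξ‖ : ℂ) * z) = ((2 : ℂ) ^ q * highPass q ξ) * z := by
  by_cases h : highPass q ξ = 0
  · simp [scaledHighPass, h]
  · have h1 := le_of_highPass_ne_zero h
    have h2 : ‖ξ‖ ≠ 0 := by
      have := pow_pos (two_pos (α := ℝ)) q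
      intro h0
      rw [h0] at h1
      linarith
    have h3 : (‖ξ‖ : ℂ) ≠ 0 := by exact_mod_cast h2
    rw [scaledHighPass]
    push_cast
    field_simp

/-! ### Vertical suprema of filtered functions -/

lemma verticalSup_shell_le {f : R3 → ℂ} (hf : IsBandLimited f) (q : ℕ) :
    verticalSup (𝓕⁻ fun ξ => (shell q ξ : ℂ) * f ξ) ≤ 2 * kernelMass * verticalSup (𝓕⁻ f) := by
  rcases q with _ | q
  · refine (hf.verticalSup_lowPass_le 0).trans ?_
    gcongr
    exact le_mul_of_one_le_left' one_le_two
  · have h1 : (fun ξ => (shell (q + 1) ξ : ℂ) * f ξ) =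
        fun ξ => (lowPass (q + 1) ξ : ℂ) * f ξ + (-1) * ((lowPass q ξ : ℂ) * f ξ) := by
      funext ξ
      simp only [shell]
      push_cast
      ring
    have h2 : IsBandLimited fun ξ => (-1 : ℂ) * ((lowPass q ξ : ℂ) * f ξ) :=
      (hf.lowPass q).mul_continuous continuous_const
    rw [h1]
    refine (verticalSup_add_le (hf.lowPass (q + 1)) h2).trans ?_
    rw [verticalSup_const_mul, enorm_neg, enorm_one, one_mul, two_mul, add_mul]
    exact add_le_add (hf.verticalSup_lowPass_le _) (hf.verticalSup_lowPass_le _)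

lemma verticalSup_sum_le {ι : Type*} (S : Finset ι) {f : ι → R3 → ℂ}
    (hf : ∀ i, IsBandLimited (f i)) :
    IsBandLimited (fun ξ => ∑ i ∈ S, f i ξ) ∧
      verticalSup (𝓕⁻ fun ξ => ∑ i ∈ S, f i ξ) ≤ ∑ i ∈ S, verticalSup (𝓕⁻ (f i)) := by
  classical
  induction S using Finset.induction_on with
  | empty =>
    have h0 : IsBandLimited fun _ : R3 => (0 : ℂ) :=
      ⟨measurable_const, MemLp.zero, 0, fun _ _ => rfl⟩
    refine ⟨by simpa using h0, ?_⟩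
    have := verticalSup_const_mul (f := fun _ : R3 => (0 : ℂ)) 0
    simp only [zero_mul, enorm_zero] at this
    simp [this]
  | insert i S hi ih =>
    simp only [Finset.sum_insert hi]
    exact ⟨(hf i).add ih.1, (verticalSup_add_le (hf i) ih.1).trans (by gcongr; exact ih.2)⟩

lemma verticalSup_nearFilter_le {f : R3 → ℂ} (hf : IsBandLimited f) (n q : ℕ) :
    verticalSup (𝓕⁻ fun ξ => (nearFilter n q ξ : ℂ) * f ξ) ≤
      10 * kernelMass * verticalSup (𝓕⁻ f) := by
  have h1 : (fun ξ => (nearFilter n q ξ : ℂ) * f ξ) = fun ξ =>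
      ∑ r ∈ (Finset.range (n + 1)).filter (Adjacent q), (shell r ξ : ℂ) * f ξ := by
    funext ξ
    rw [nearFilter, Complex.ofReal_sum, Finset.sum_mul]
  rw [h1]
  refine ((verticalSup_sum_le _ fun r => hf.mul_real (continuous_shell r)).2.trans
    (Finset.sum_le_sum fun r _ => verticalSup_shell_le hf r)).trans ?_
  rw [Finset.sum_const, nsmul_eq_mul]
  calc _ ≤ (5 : ℝ≥0∞) * (2 * kernelMass * verticalSup (𝓕⁻ f)) := by
        gcongr
        exact_mod_cast card_adjacent_le n q
    _ = _ := by ring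

/-- The far filter has a number of shells growing with n, but it is a low-pass filter minus a near
filter; hence the uniform constant 1 + 10. -/
lemma verticalSup_farFilter_le {f : R3 → ℂ} (hf : IsBandLimited f) (n q : ℕ) :
    verticalSup (𝓕⁻ fun ξ => (farFilter n q ξ : ℂ) * f ξ) ≤
      11 * kernelMass * verticalSup (𝓕⁻ f) := by
  have h1 : (fun ξ => (farFilter n q ξ : ℂ) * f ξ) =
      fun ξ => (lowPass n ξ : ℂ) * f ξ + (-1) * ((nearFilter n q ξ : ℂ) * f ξ) := by
    funext ξ
    rw [← nearFilter_add_farFilter n q]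
    push_cast
    ring
  have h2 : IsBandLimited fun ξ => (-1 : ℂ) * ((nearFilter n q ξ : ℂ) * f ξ) :=
    (hf.mul_real (continuous_nearFilter n q)).mul_continuous continuous_const
  rw [h1]
  refine (verticalSup_add_le (hf.lowPass n) h2).trans ?_
  rw [verticalSup_const_mul, enorm_neg, enorm_one, one_mul]
  refine (add_le_add (hf.verticalSup_lowPass_le n) (verticalSup_nearFilter_le hf n q)).trans_eq ?_
  ring

lemma verticalSupGradient_farFilter_le {f : R3 → ℂ} (hf : IsBandLimited f) (n q : ℕ) :
    verticalSupGradient (fun ξ => (farFilter n q ξ : ℂ) * f ξ) ≤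
      11 * kernelMass * verticalSupGradient f := by
  have h1 : ∀ j, mulCoord j (fun ξ => (farFilter n q ξ : ℂ) * f ξ) =
      fun ξ => (farFilter n q ξ : ℂ) * mulCoord j f ξ := fun j => by
    funext ξ
    simp only [mulCoord]
    ring
  unfold verticalSupGradient
  rw [h1, h1, mul_add]
  exact add_le_add (verticalSup_farFilter_le (hf.mulCoord 0) n q)
    (verticalSup_farFilter_le (hf.mulCoord 1) n q)

/-- The interpolation quantity for the function at low frequency. -/
noncomputable def verticalInterp (f : R3 → ℂ) : ℝ≥0∞ :=
  (verticalSup (𝓕⁻ f) * verticalSupGradient f) ^ (1 / 2 : ℝ)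

lemma verticalInterp_farFilter_le {f : R3 → ℂ} (hf : IsBandLimited f) (n q : ℕ) :
    verticalInterp (fun ξ => (farFilter n q ξ : ℂ) * f ξ) ≤ 11 * kernelMass * verticalInterp f := by
  unfold verticalInterp
  refine (ENNReal.rpow_le_rpow (mul_le_mul' (verticalSup_farFilter_le hf n q)
    (verticalSupGradient_farFilter_le hf n q)) (by norm_num)).trans_eq ?_
  rw [show 11 * kernelMass * verticalSup (𝓕⁻ f) * (11 * kernelMass * verticalSupGradient f) =
    (11 * kernelMass) ^ 2 * (verticalSup (𝓕⁻ f) * verticalSupGradient f) by ring,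
    ENNReal.mul_rpow_of_nonneg _ _ (by norm_num), sq_sqrt]

/-! ### Sums over the dyadic blocks -/

/-- The scheme common to three of the four cases: a is bounded uniformly in q by its anisotropic
suprema, and the block weight is split between the other two functions. -/
lemma sum_absTriple_le {s : ℝ} (hs : 0 < s) {ρ ρ' : ℕ → R3 → ℂ} {M : ℝ}
    (hρ : IsSubordinate ρ M) (hρ' : IsSubordinate ρ' M) {F G : R3 → ℂ} (hF : Measurable F)
    (hG : Measurable G) (S : Finset ℕ) {a f h : ℕ → R3 → ℂ} (ha : ∀ q, IsBandLimited (a q))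
    (hf : ∀ q, IsBandLimited (f q)) (hh : ∀ q, IsBandLimited (h q)) {A K : ℝ≥0∞}
    (hA : ∀ q, verticalInterp (a q) ≤ A)
    (hK : ∀ q, quarticNorm (f q) * energy (h q) ^ (1 / 2 : ℝ) ≤ K * (ENNReal.ofReal (blockWeight s q) *
      (quarticNorm (fun ξ => ρ q ξ * F ξ) * energy (fun ξ => ρ' q ξ * G ξ) ^ (1 / 2 : ℝ)))) :
    ∑ q ∈ S, absTriple (a q) (f q) (h q) ≤ ENNReal.ofReal (4 * Real.pi) * A * K *
      ENNReal.ofReal (blockConst s M) * (sobolevQuartic s F * sobolevEnergy s G ^ (1 / 2 : ℝ)) := by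
  calc _ ≤ ∑ q ∈ S, ENNReal.ofReal (4 * Real.pi) * A * K * (ENNReal.ofReal (blockWeight s q) *
      (quarticNorm (fun ξ => ρ q ξ * F ξ) * energy (fun ξ => ρ' q ξ * G ξ) ^ (1 / 2 : ℝ))) := by
        refine Finset.sum_le_sum fun q _ => ?_
        refine (absTriple_le_interpolation (ha q) (hf q) (hh q)).trans ?_
        rw [mul_assoc (_ ^ (1 / 2 : ℝ)), mul_assoc _ K, mul_assoc _ A]
        exact mul_le_mul' le_rfl (mul_le_mul' (hA q) (hK q))
    _ ≤ _ := by
        rw [← Finset.mul_sum, mul_assoc _ (ENNReal.ofReal (blockConst s M))]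
        exact mul_le_mul' le_rfl (sum_block_quartic_energy_le hs hρ hρ' hF hG S)

lemma norm_weight_le_of_shell {s : ℝ} (hs : 0 ≤ s) {h : R3 → ℂ} {q : ℕ} {ξ : R3}
    (hξ : (shell q ξ : ℂ) * h ξ ≠ 0) :
    ‖(sobolevWeight s ξ : ℂ)‖ ≤ 256 ^ s * blockWeight s q := by
  rw [Complex.norm_real, Real.norm_of_nonneg (sobolevWeight_pos s ξ).le]
  refine sobolevWeight_le_of_symbol_le hs (by norm_num) (symbol_le_of_shell_ne_zero ?_)
  intro h0
  exact hξ (by simp [h0])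

/-- Distant shells force |η| ≥ 2^q / 4, so a high-pass cutoff on f costs nothing. The sum in q then
converges through f and h, although g is only low-frequency information. -/
lemma sum_farTerm_le {s : ℝ} (hs : 0 < s) (n : ℕ) {f g h : R3 → ℂ} (hf : IsBandLimited f)
    (hg : IsBandLimited g) (hh : IsBandLimited h) (S : Finset ℕ) :
    ∑ q ∈ S, ‖farTerm s n f g h q‖ₑ ≤ ENNReal.ofReal (4 * Real.pi) *
      (11 * kernelMass * verticalInterp g) * ENNReal.ofReal (256 ^ s) *
      ENNReal.ofReal (blockConst s 5) * (sobolevQuartic s f * sobolevEnergy s h ^ (1 / 2 : ℝ)) := by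
  have hG : ∀ q, IsBandLimited fun ξ => (farFilter n q ξ : ℂ) * g ξ := fun q =>
    hg.mul_real (continuous_farFilter n q)
  have hH : ∀ q, IsBandLimited fun ξ => (sobolevWeight s ξ : ℂ) * ((shell q ξ : ℂ) * h ξ) :=
    fun q => (hh.mul_real (continuous_shell q)).mul_real (continuous_sobolevWeight s)
  have hF : ∀ q, IsBandLimited fun ξ => highPass q ξ * f ξ := fun q =>
    hf.mul_bounded (measurable_highPass q) (norm_highPass_le q)
  refine (Finset.sum_le_sum fun q _ => ?_).trans (sum_absTriple_le hs isSubordinate_highPass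
    isSubordinate_shell hf.measurable hh.measurable S hG hF hH
    (fun q => verticalInterp_farFilter_le hg n q) fun q => ?_)
  · rw [absTriple_comm]
    refine le_trans (le_of_eq ?_) ((hF q).enorm_trilinear_le (hG q) (hH q))
    congr 1
    refine integral_congr_ae (Eventually.of_forall fun p => ?_)
    dsimp only
    by_cases h1 : farFilter n q p.2 = 0
    · simp [h1]
    by_cases h2 : shell q (p.1 + p.2) = 0
    · simp [h2]
    rw [highPass_eq_one (two_pow_le_norm_of_far h2 h1 rfl), one_mul]
  · refine (mul_le_mul' le_rfl (sqrt_energy_mul_le fun ξ hξ =>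
      norm_weight_le_of_shell hs.le hξ)).trans_eq ?_
    rw [ENNReal.ofReal_mul (by positivity)]
    ring

/-- The vertical derivative of h costs at most 2^(q+1) on its shell. Since |η| ≥ 2^q / 4, it can be
exchanged for |η| on f. In the application f is the third component, for which |η| f is controlled
by horizontal derivatives. -/
lemma sum_farTerm_vertical_le {s : ℝ} (hs : 0 < s) (n : ℕ) {f g h : R3 → ℂ} (hf : IsBandLimited f)
    (hg : IsBandLimited g) (hh : IsBandLimited h) (S : Finset ℕ) :
    ∑ q ∈ S, ‖farTerm s n f g (mulCoord 2 h) q‖ₑ ≤ ENNReal.ofReal (4 * Real.pi) *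
      (11 * kernelMass * verticalInterp g) * ENNReal.ofReal (2 * 256 ^ s) *
      ENNReal.ofReal (blockConst s 5) * (sobolevQuartic s h *
        sobolevEnergy s (fun ξ => (‖ξ‖ : ℂ) * f ξ) ^ (1 / 2 : ℝ)) := by
  have hG : ∀ q, IsBandLimited fun ξ => (farFilter n q ξ : ℂ) * g ξ := fun q =>
    hg.mul_real (continuous_farFilter n q)
  have hm : ∀ q, Continuous fun ξ : R3 => (2 ^ q)⁻¹ * sobolevWeight s ξ * ξ 2 := fun q =>
    (continuous_const.mul (continuous_sobolevWeight s)).mul (by fun_prop)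
  have hH : ∀ q, IsBandLimited fun ξ => (((2 ^ q)⁻¹ * sobolevWeight s ξ * ξ 2 : ℝ) : ℂ) *
      ((shell q ξ : ℂ) * h ξ) := fun q => (hh.mul_real (continuous_shell q)).mul_real (hm q)
  have hF : ∀ q, IsBandLimited fun ξ => scaledHighPass q ξ * ((‖ξ‖ : ℂ) * f ξ) := fun q =>
    (hf.mul_real continuous_norm).mul_bounded (isSubordinate_scaledHighPass.measurable q)
      (isSubordinate_scaledHighPass.bound q)
  refine (Finset.sum_le_sum fun q _ => ?_).trans (sum_absTriple_le hs isSubordinate_shell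
    isSubordinate_scaledHighPass hh.measurable (hf.mul_real continuous_norm).measurable S hG hH hF
    (fun q => verticalInterp_farFilter_le hg n q) fun q => ?_)
  · rw [absTriple_rotate]
    refine le_trans (le_of_eq ?_) ((hF q).enorm_trilinear_le (hG q) (hH q))
    congr 1
    refine integral_congr_ae (Eventually.of_forall fun p => ?_)
    dsimp only
    by_cases h1 : farFilter n q p.2 = 0
    · simp [h1]
    by_cases h2 : shell q (p.1 + p.2) = 0
    · simp [h2]
    rw [scaledHighPass_mul_norm, highPass_eq_one (two_pow_le_norm_of_far h2 h1 rfl)]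
    simp only [mulCoord, map_mul, Complex.conj_ofReal]
    push_cast
    field_simp
  · refine (mul_le_mul' (quarticNorm_mul_le (c := 2 * 256 ^ s * blockWeight s q) fun ξ hξ => ?_)
      le_rfl).trans_eq ?_
    · have h1 := norm_weight_le_of_shell hs.le hξ
      have h2 : |ξ 2| ≤ 2 ^ q * 2 := by
        have h3 : |ξ 2| ≤ ‖ξ‖ := by simpa using PiLp.norm_apply_le ξ 2
        have h4 : shell q ξ ≠ 0 := fun h0 => hξ (by simp [h0])
        exact h3.trans ((norm_lt_of_shell_ne_zero h4).le.trans_eq (pow_succ _ _))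
      rw [Complex.norm_real, Real.norm_of_nonneg (sobolevWeight_pos s ξ).le] at h1
      rw [Complex.norm_real, norm_mul, norm_mul, Real.norm_of_nonneg (sobolevWeight_pos s ξ).le,
        Real.norm_of_nonneg (by positivity), Real.norm_eq_abs]
      have hb := blockWeight_pos s q
      calc _ ≤ (2 ^ q)⁻¹ * (256 ^ s * blockWeight s q) * (2 ^ q * 2) := by gcongr
        _ = _ := by field_simp
    · rw [ENNReal.ofReal_mul (by positivity)]
      ring

/-- The two weights are estimated separately, without cancellation: in the application h already
contains a horizontal derivative, so nothing has to be gained. -/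
lemma sum_nearTerm_le {s : ℝ} (hs : 0 < s) (n : ℕ) {f g h : R3 → ℂ} (hf : IsBandLimited f)
    (hg : IsBandLimited g) (hh : IsBandLimited h) (S : Finset ℕ) :
    ∑ q ∈ S, ‖nearTerm s n f g h q‖ₑ ≤ ENNReal.ofReal (4 * Real.pi) *
      verticalInterp f * ENNReal.ofReal (256 ^ s + 4096 ^ s) *
      ENNReal.ofReal (blockConst s 5) * (sobolevQuartic s g * sobolevEnergy s h ^ (1 / 2 : ℝ)) := by
  have hw := continuous_sobolevWeight s
  have hG : ∀ q, IsBandLimited fun ξ => (nearFilter n q ξ : ℂ) * g ξ := fun q =>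
    hg.mul_real (continuous_nearFilter n q)
  have hH : ∀ q, IsBandLimited fun ξ => (shell q ξ : ℂ) * h ξ := fun q =>
    hh.mul_real (continuous_shell q)
  have hwG : ∀ q, IsBandLimited fun ξ => (sobolevWeight s ξ : ℂ) * ((nearFilter n q ξ : ℂ) * g ξ) :=
    fun q => (hG q).mul_real hw
  have hwH : ∀ q, IsBandLimited fun ξ => (sobolevWeight s ξ : ℂ) * ((shell q ξ : ℂ) * h ξ) :=
    fun q => (hH q).mul_real hw
  have hsplit : ∀ q, ‖nearTerm s n f g h q‖ₑ ≤
      absTriple f (fun ξ => (nearFilter n q ξ : ℂ) * g ξ)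
        (fun ξ => (sobolevWeight s ξ : ℂ) * ((shell q ξ : ℂ) * h ξ)) +
      absTriple f (fun ξ => (sobolevWeight s ξ : ℂ) * ((nearFilter n q ξ : ℂ) * g ξ))
        (fun ξ => (shell q ξ : ℂ) * h ξ) := by
    intro q
    have e : nearTerm s n f g h q = trilinear f (fun ξ => (nearFilter n q ξ : ℂ) * g ξ)
        (fun ξ => (sobolevWeight s ξ : ℂ) * ((shell q ξ : ℂ) * h ξ)) -
        trilinear f (fun ξ => (sobolevWeight s ξ : ℂ) * ((nearFilter n q ξ : ℂ) * g ξ))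
        (fun ξ => (shell q ξ : ℂ) * h ξ) := by
      unfold trilinear nearTerm
      rw [← integral_sub (hf.integrable_trilinear (hG q) (hwH q))
        (hf.integrable_trilinear (hwG q) (hH q))]
      refine integral_congr_ae (Eventually.of_forall fun p => ?_)
      simp only [map_mul, Complex.conj_ofReal, Complex.ofReal_sub]
      ring
    rw [e]
    exact enorm_sub_le.trans (add_le_add (hf.enorm_trilinear_le (hG q) (hwH q))
      (hf.enorm_trilinear_le (hwG q) (hH q)))
  refine (Finset.sum_le_sum fun q _ => hsplit q).trans ?_
  rw [Finset.sum_add_distrib]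
  refine (add_le_add (sum_absTriple_le hs (isSubordinate_nearFilter n) isSubordinate_shell
    hg.measurable hh.measurable S (fun _ => hf) hG hwH (fun _ => le_rfl)
    (K := ENNReal.ofReal (256 ^ s)) fun q => ?_)
    (sum_absTriple_le hs (isSubordinate_nearFilter n) isSubordinate_shell
    hg.measurable hh.measurable S (fun _ => hf) hwG hH (fun _ => le_rfl)
    (K := ENNReal.ofReal (4096 ^ s)) fun q => ?_)).trans_eq ?_
  · refine (mul_le_mul' le_rfl (sqrt_energy_mul_le fun ξ hξ =>
      norm_weight_le_of_shell hs.le hξ)).trans_eq ?_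
    rw [ENNReal.ofReal_mul (by positivity)]
    ring
  · refine (mul_le_mul' (quarticNorm_mul_le (c := 4096 ^ s * blockWeight s q) fun ξ hξ => ?_)
      le_rfl).trans_eq ?_
    · rw [Complex.norm_real, Real.norm_of_nonneg (sobolevWeight_pos s ξ).le]
      refine sobolevWeight_le_of_symbol_le hs.le (by norm_num)
        (symbol_le_of_nearFilter_ne_zero (n := n) ?_)
      intro h0
      exact hξ (by simp [h0])
    · rw [ENNReal.ofReal_mul (by positivity)]
      ring
  · rw [ENNReal.ofReal_add (by positivity) (by positivity)]
    ring

/-- The vertical derivative of h costs 2^(q+1), and the commutator gains 1/√c = 1/(64 · 2^q) by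
moving a derivative to f. Afterwards the gradient of f is taken in the anisotropic supremum and both
other functions in the quartic norm. -/
lemma sum_nearTerm_vertical_le {s : ℝ} (hs : 0 < s) (n : ℕ) {f g h : R3 → ℂ}
    (hf : IsBandLimited f) (hg : IsBandLimited g) (hh : IsBandLimited h) {A : ℝ≥0∞}
    (hA : ∀ l, verticalSup (𝓕⁻ (mulCoord l f)) ≤ A) (S : Finset ℕ) :
    ∑ q ∈ S, ‖nearTerm s n f g (mulCoord 2 h) q‖ₑ ≤
      ENNReal.ofReal (4096 ^ s / 64 * schurConst s (1 - (4 ^ 9)⁻¹)) *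
      (ENNReal.ofReal (4 * Real.pi) * A * ENNReal.ofReal 2) * ENNReal.ofReal (blockConst s 5) *
      (sobolevQuartic s g * sobolevQuartic s h) := by
  have hG : ∀ q, IsBandLimited fun ξ => (nearFilter n q ξ : ℂ) * g ξ := fun q =>
    hg.mul_real (continuous_nearFilter n q)
  have hH : ∀ q, IsBandLimited fun ξ => (shell q ξ : ℂ) * h ξ := fun q =>
    hh.mul_real (continuous_shell q)
  have hH2 : ∀ q, IsBandLimited fun ξ => (shell q ξ : ℂ) * mulCoord 2 h ξ := fun q =>
    (hh.mulCoord 2).mul_real (continuous_shell q)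
  have hterm : ∀ q, ‖nearTerm s n f g (mulCoord 2 h) q‖ₑ ≤
      ENNReal.ofReal (4096 ^ s / 64 * schurConst s (1 - (4 ^ 9)⁻¹)) *
      (ENNReal.ofReal (4 * Real.pi) * A * ENNReal.ofReal 2) * (ENNReal.ofReal (blockWeight s q) *
        (quarticNorm (fun ξ => (nearFilter n q ξ : ℂ) * g ξ) *
          quarticNorm (fun ξ => (shell q ξ : ℂ) * h ξ))) := by
    intro q
    have hB : IsMultiplierBound f (fun ξ => (nearFilter n q ξ : ℂ) * g ξ)
        (fun ξ => (shell q ξ : ℂ) * mulCoord 2 h ξ) (ENNReal.ofReal (4 * Real.pi) *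
          (A * quarticNorm (fun ξ => (nearFilter n q ξ : ℂ) * g ξ) *
            (ENNReal.ofReal (2 ^ q * 2) * quarticNorm (fun ξ => (shell q ξ : ℂ) * h ξ)))) := by
      intro l μ ν hμ hν hμ1 hν1
      refine ((hf.mulCoord l).enorm_trilinear_le ((hG q).mul_bounded hμ hμ1)
        ((hH2 q).mul_bounded hν hν1)).trans ?_
      refine (absTriple_le_verticalSup (hf.mulCoord l) ((hG q).mul_bounded hμ hμ1)
        ((hH2 q).mul_bounded hν hν1)).trans ?_
      refine mul_le_mul' le_rfl (mul_le_mul' (mul_le_mul' (hA l) ?_) ?_)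
      · refine (quarticNorm_mul_le (c := 1) fun ξ _ => hμ1 ξ).trans_eq (by simp)
      · have e : (fun ξ => ν ξ * ((shell q ξ : ℂ) * mulCoord 2 h ξ)) =
            fun ξ => (ν ξ * (ξ 2 : ℂ)) * ((shell q ξ : ℂ) * h ξ) := by
          funext ξ
          simp only [mulCoord]
          ring
        rw [e]
        refine quarticNorm_mul_le fun ξ hξ => ?_
        have h3 : |ξ 2| ≤ ‖ξ‖ := by simpa using PiLp.norm_apply_le ξ 2
        have h4 : shell q ξ ≠ 0 := fun h0 => hξ (by simp [h0])
        rw [norm_mul, Complex.norm_real, Real.norm_eq_abs]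
        calc _ ≤ 1 * (2 ^ q * 2) := mul_le_mul (hν1 ξ)
              (h3.trans ((norm_lt_of_shell_ne_zero h4).le.trans_eq (pow_succ _ _)))
              (abs_nonneg _) zero_le_one
          _ = _ := one_mul _
    have h4q : (0 : ℝ) < 4 ^ q := by positivity
    -- On both supports the symbol lies between 4^q / 64 and 4096 · 4^q. The ratio of these bounds
    -- is 4^9, which determines r.
    have hmain := enorm_integral_weight_sub_le s hf (hG q) (hH2 q) (c := 4096 * 4 ^ q)
      (r := 1 - (4 ^ 9)⁻¹) (by positivity) (by norm_num) (by norm_num) (fun ξ hξ => ?_)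
      (fun ξ hξ => ?_) hB
    · refine hmain.trans_eq ?_
      have e1 : (4096 * 4 ^ q : ℝ) ^ s = 4096 ^ s * blockWeight s q := by
        rw [blockWeight_eq, Real.mul_rpow (by norm_num) (by positivity)]
      have e2 : √(4096 * 4 ^ q : ℝ) = 64 * 2 ^ q := by
        rw [show (4096 * 4 ^ q : ℝ) = (64 * 2 ^ q) ^ 2 by rw [four_pow_eq]; ring,
          Real.sqrt_sq (by positivity)]
      have e3 : (4096 * 4 ^ q : ℝ) ^ s / √(4096 * 4 ^ q : ℝ) * schurConst s (1 - (4 ^ 9)⁻¹) *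
          (2 ^ q * 2) = (4096 ^ s / 64 * schurConst s (1 - (4 ^ 9)⁻¹)) * 2 * blockWeight s q := by
        rw [e1, e2]
        field_simp
      have hsc : 0 ≤ schurConst s (1 - (4 ^ 9)⁻¹) := by
        unfold schurConst
        have : (0 : ℝ) ≤ 1 - (4 ^ 9)⁻¹ := by norm_num
        exact mul_nonneg (by positivity) (tsum_nonneg fun k => by positivity)
      have e4 : ENNReal.ofReal ((4096 * 4 ^ q : ℝ) ^ s / √(4096 * 4 ^ q : ℝ) *
          schurConst s (1 - (4 ^ 9)⁻¹)) * ENNReal.ofReal (2 ^ q * 2) =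
          ENNReal.ofReal (4096 ^ s / 64 * schurConst s (1 - (4 ^ 9)⁻¹)) * ENNReal.ofReal 2 *
            ENNReal.ofReal (blockWeight s q) := by
        rw [← ENNReal.ofReal_mul (by positivity), ← ENNReal.ofReal_mul (by positivity),
          ← ENNReal.ofReal_mul (by positivity), e3]
      calc _ = (ENNReal.ofReal ((4096 * 4 ^ q : ℝ) ^ s / √(4096 * 4 ^ q : ℝ) *
            schurConst s (1 - (4 ^ 9)⁻¹)) * ENNReal.ofReal (2 ^ q * 2)) *
            (ENNReal.ofReal (4 * Real.pi) * A * (quarticNorm (fun ξ => (nearFilter n q ξ : ℂ) * g ξ) *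
              quarticNorm (fun ξ => (shell q ξ : ℂ) * h ξ))) := by ring
        _ = _ := by rw [e4]; ring
    · have h1 : nearFilter n q ξ ≠ 0 := fun h0 => hξ (by simp [h0])
      have h2 := four_pow_le_of_nearFilter_ne_zero h1
      refine ⟨?_, symbol_le_of_nearFilter_ne_zero h1⟩
      norm_num
      linarith
    · have h1 : shell q ξ ≠ 0 := fun h0 => hξ (by simp [h0])
      have h2 := four_pow_le_of_shell_ne_zero h1
      have h3 := symbol_le_of_shell_ne_zero h1
      have h4 := symbol_pos ξ
      constructor
      · norm_num
        linarith
      · linarith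
  refine (Finset.sum_le_sum fun q _ => hterm q).trans ?_
  rw [← Finset.mul_sum, mul_assoc _ (ENNReal.ofReal (blockConst s 5))]
  exact mul_le_mul' le_rfl (sum_block_quartic_quartic_le hs (isSubordinate_nearFilter n)
    isSubordinate_shell hg.measurable hh.measurable S)

/-! ### The commutator estimate for band-limited fields -/

/-- The squared Sobolev norm of a family of functions on the frequency side. -/
noncomputable def fieldEnergy (s : ℝ) (U : Fin 3 → R3 → ℂ) : ℝ≥0∞ := ∑ i, sobolevEnergy s (U i)

/-- The squared Sobolev norm of the horizontal gradient of a family, up to the factor `(2π)²`. -/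
noncomputable def fieldHorizontalEnergy (s : ℝ) (U : Fin 3 → R3 → ℂ) : ℝ≥0∞ :=
  ∑ i, sobolevHorizontalEnergy s (U i)

lemma sobolevQuartic_le (s : ℝ) (U : Fin 3 → R3 → ℂ) (i : Fin 3) :
    sobolevQuartic s (U i) ≤ (fieldEnergy s U * fieldHorizontalEnergy s U) ^ (1 / 4 : ℝ) := by
  refine ENNReal.rpow_le_rpow (mul_le_mul' ?_ ?_) (by norm_num)
  · exact Finset.single_le_sum (f := fun i => sobolevEnergy s (U i)) (fun _ _ => zero_le)
      (Finset.mem_univ i)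
  · exact Finset.single_le_sum (f := fun i => sobolevHorizontalEnergy s (U i))
      (fun _ _ => zero_le) (Finset.mem_univ i)

lemma sobolevEnergy_mulCoord_le (s : ℝ) (U : Fin 3 → R3 → ℂ) (i : Fin 3) {j : Fin 3} (hj : j ≠ 2) :
    sobolevEnergy s (mulCoord j (U i)) ≤ fieldHorizontalEnergy s U := by
  have h1 : sobolevHorizontalEnergy s (U i) ≤ fieldHorizontalEnergy s U :=
    Finset.single_le_sum (f := fun i => sobolevHorizontalEnergy s (U i)) (fun _ _ => zero_le)
      (Finset.mem_univ i)
  refine le_trans ?_ h1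
  fin_cases j
  · exact le_self_add
  · exact le_add_self
  · exact absurd rfl hj

lemma mulCoord_two_eq {U : Fin 3 → R3 → ℂ} (hS : ∀ ξ : R3, ∑ j, (ξ j : ℂ) * U j ξ = 0) (ξ : R3) :
    mulCoord 2 (U 2) ξ = -(mulCoord 0 (U 0) ξ + mulCoord 1 (U 1) ξ) := by
  have h := hS ξ
  rw [Fin.sum_univ_three] at h
  simp only [mulCoord]
  linear_combination h

/-- The full gradient of u_3 is horizontal in disguise: its only vertical entry ∂_3 u_3 equals -(∂_1
u_1 + ∂_2 u_2). -/
lemma enorm_norm_mul_sq_le {U : Fin 3 → R3 → ℂ} (hS : ∀ ξ : R3, ∑ j, (ξ j : ℂ) * U j ξ = 0)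
    (ξ : R3) :
    ‖(‖ξ‖ : ℂ) * U 2 ξ‖ₑ ^ 2 ≤ 2 * ∑ i, (‖mulCoord 0 (U i) ξ‖ₑ ^ 2 + ‖mulCoord 1 (U i) ξ‖ₑ ^ 2) := by
  have h2 := mulCoord_two_eq hS ξ
  have h3 : ‖(‖ξ‖ : ℂ) * U 2 ξ‖ ^ 2 = ‖mulCoord 0 (U 2) ξ‖ ^ 2 + ‖mulCoord 1 (U 2) ξ‖ ^ 2 +
      ‖mulCoord 2 (U 2) ξ‖ ^ 2 := by
    simp only [mulCoord, norm_mul, Complex.norm_real, norm_norm, mul_pow,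
      EuclideanSpace.norm_sq_eq, Fin.sum_univ_three]
    ring
  have h4 : ‖mulCoord 2 (U 2) ξ‖ ^ 2 ≤ 2 * (‖mulCoord 0 (U 0) ξ‖ ^ 2 + ‖mulCoord 1 (U 1) ξ‖ ^ 2) := by
    rw [h2, norm_neg]
    have := norm_add_le (mulCoord 0 (U 0) ξ) (mulCoord 1 (U 1) ξ)
    have h5 := pow_le_pow_left₀ (norm_nonneg _) this 2
    nlinarith [sq_nonneg (‖mulCoord 0 (U 0) ξ‖ - ‖mulCoord 1 (U 1) ξ‖)]
  have h6 : ‖(‖ξ‖ : ℂ) * U 2 ξ‖ ^ 2 ≤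
      2 * ∑ i, (‖mulCoord 0 (U i) ξ‖ ^ 2 + ‖mulCoord 1 (U i) ξ‖ ^ 2) := by
    rw [h3, Fin.sum_univ_three]
    nlinarith [sq_nonneg ‖mulCoord 1 (U 0) ξ‖, sq_nonneg ‖mulCoord 0 (U 1) ξ‖,
      sq_nonneg ‖mulCoord 0 (U 2) ξ‖, sq_nonneg ‖mulCoord 1 (U 2) ξ‖]
  have h7 := ENNReal.ofReal_le_ofReal h6
  rw [ENNReal.ofReal_mul (by norm_num), ENNReal.ofReal_sum_of_nonneg fun i _ => by positivity] at h7
  simp only [ENNReal.ofReal_add (sq_nonneg _) (sq_nonneg _),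
    ENNReal.ofReal_pow (norm_nonneg _), ofReal_norm, ENNReal.ofReal_ofNat] at h7
  exact h7

lemma sobolevEnergy_norm_mul_le {s : ℝ} {U : Fin 3 → R3 → ℂ} (hU : ∀ i, Measurable (U i))
    (hS : ∀ ξ : R3, ∑ j, (ξ j : ℂ) * U j ξ = 0) :
    sobolevEnergy s (fun ξ => (‖ξ‖ : ℂ) * U 2 ξ) ≤ 2 * fieldHorizontalEnergy s U := by
  have hw : Measurable fun ξ => ENNReal.ofReal (sobolevWeight s ξ) :=
    ENNReal.measurable_ofReal.comp (continuous_sobolevWeight s).measurable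
  have hm : ∀ j i, Measurable (mulCoord j (U i)) := fun j i => by
    have : Measurable fun ξ : R3 => (ξ j : ℂ) := by fun_prop
    exact this.mul (hU i)
  have hmm : ∀ j i, Measurable fun ξ => ENNReal.ofReal (sobolevWeight s ξ) *
    ‖mulCoord j (U i) ξ‖ₑ ^ 2 := fun j i => hw.mul ((hm j i).enorm.pow_const 2)
  have hma : ∀ i, Measurable fun ξ => ENNReal.ofReal (sobolevWeight s ξ) *
      ‖mulCoord 0 (U i) ξ‖ₑ ^ 2 + ENNReal.ofReal (sobolevWeight s ξ) *
      ‖mulCoord 1 (U i) ξ‖ₑ ^ 2 := fun i => (hmm 0 i).add (hmm 1 i)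
  have h1 : 2 * fieldHorizontalEnergy s U = ∫⁻ ξ, 2 * ∑ i, (ENNReal.ofReal (sobolevWeight s ξ) *
      ‖mulCoord 0 (U i) ξ‖ₑ ^ 2 + ENNReal.ofReal (sobolevWeight s ξ) *
      ‖mulCoord 1 (U i) ξ‖ₑ ^ 2) := by
    rw [lintegral_const_mul' _ _ (by finiteness),
      lintegral_finsetSum _ fun i _ => hma i]
    simp only [fieldHorizontalEnergy, sobolevHorizontalEnergy, sobolevEnergy]
    congr 1
    refine Finset.sum_congr rfl fun i _ => ?_
    rw [lintegral_add_left (hmm 0 i)]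
  rw [h1]
  refine lintegral_mono fun ξ => ?_
  refine (mul_le_mul' le_rfl (enorm_norm_mul_sq_le hS ξ)).trans_eq ?_
  simp only [← mul_add, ← Finset.mul_sum]
  ring

lemma sqrt_two_mul_le (x : ℝ≥0∞) : (2 * x) ^ (1 / 2 : ℝ) ≤ 2 * x ^ (1 / 2 : ℝ) := by
  rw [ENNReal.mul_rpow_of_nonneg _ _ (by norm_num)]
  gcongr
  calc (2 : ℝ≥0∞) ^ (1 / 2 : ℝ) ≤ 2 ^ (1 : ℝ) :=
        ENNReal.rpow_le_rpow_of_exponent_le one_le_two (by norm_num)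
    _ = 2 := ENNReal.rpow_one 2

/-- The right-hand side of the commutator estimate. -/
noncomputable def commutatorBound (A₀ A₁ e₀ e₁ : ℝ≥0∞) : ℝ≥0∞ :=
  (A₀ * A₁) ^ (1 / 2 : ℝ) * ((e₀ * e₁) ^ (1 / 4 : ℝ) * e₁ ^ (1 / 2 : ℝ)) +
    A₁ * (e₀ * e₁) ^ (1 / 2 : ℝ)

/-- The near interaction with a vertical derivative is bounded by Q, and the three other kinds by P.
The field enters only through energies and suprema, so the constant does not depend on the band
limit n. -/
theorem exists_enorm_commutator_le {s : ℝ} (hs : 0 < s) :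
    ∃ K : ℝ≥0∞, K ≠ ⊤ ∧ ∀ (U : Fin 3 → R3 → ℂ) (n : ℕ), (∀ i, IsBandLimited (U i)) →
      IsSolenoidal U → (∀ i ξ, U i ξ ≠ 0 → lowPass n ξ = 1) → ∀ A₀ A₁ : ℝ≥0∞,
      (∀ i, verticalSup (𝓕⁻ (U i)) ≤ A₀) →
      (∀ i j, j ≠ 2 → verticalSup (𝓕⁻ (mulCoord j (U i))) ≤ A₁) →
      ‖∫ p : R3 × R3, ((sobolevWeight s (p.1 + p.2) - sobolevWeight s p.2 : ℝ) : ℂ) *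
        advectionDensity U p‖ₑ ≤
        K * commutatorBound A₀ A₁ (fieldEnergy s U) (fieldHorizontalEnergy s U) := by
  have hkm := kernelMass_ne_top
  let b := ENNReal.ofReal (blockConst s 5)
  let p4 := ENNReal.ofReal (4 * Real.pi)
  let cN := p4 * 2 * ENNReal.ofReal (256 ^ s + 4096 ^ s) * b
  let cF := p4 * (11 * kernelMass * 2) * ENNReal.ofReal (256 ^ s) * b
  let cN2 := ENNReal.ofReal (4096 ^ s / 64 * schurConst s (1 - (4 ^ 9)⁻¹)) *
      (p4 * 2 * ENNReal.ofReal 2) * b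
  let cF2 := p4 * (11 * kernelMass * 2) * ENNReal.ofReal (2 * 256 ^ s) * b * 2
  have hcN : cN ≠ ⊤ := by finiteness
  have hcF : cF ≠ ⊤ := by finiteness
  have hcN2 : cN2 ≠ ⊤ := by finiteness
  have hcF2 : cF2 ≠ ⊤ := by finiteness
  -- The factor 9 counts the pairs (i, j); the far terms appear twice by antisymmetry.
  refine ⟨9 * (cN + 2 * cF + (cN2 + 2 * cF2)), by finiteness, ?_⟩
  intro U n hU hS hn A₀ A₁ hA₀ hA₁
  set e₀ := fieldEnergy s U
  set e₁ := fieldHorizontalEnergy s U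
  set X := (e₀ * e₁) ^ (1 / 4 : ℝ) with hX
  have hXX : X * X = (e₀ * e₁) ^ (1 / 2 : ℝ) := by
    rw [hX, ← ENNReal.rpow_add_of_nonneg _ _ (by norm_num) (by norm_num)]
    norm_num
  have hinterp : ∀ i, verticalInterp (U i) ≤ 2 * (A₀ * A₁) ^ (1 / 2 : ℝ) := by
    intro i
    refine le_trans ?_ (sqrt_two_mul_le _)
    refine ENNReal.rpow_le_rpow ?_ (by norm_num)
    refine (mul_le_mul' (hA₀ i) (add_le_add (hA₁ i 0 (by decide)) (hA₁ i 1 (by decide)))).trans_eq ?_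
    ring
  set P := (A₀ * A₁) ^ (1 / 2 : ℝ) * (X * e₁ ^ (1 / 2 : ℝ)) with hP
  set Q := A₁ * (e₀ * e₁) ^ (1 / 2 : ℝ) with hQ
  -- Every derivative of u_3 is controlled by horizontal ones; for ∂_3 u_3 the divergence condition
  -- yields two summands, hence the 2.
  have hvert : ∀ l, verticalSup (𝓕⁻ (mulCoord l (U 2))) ≤ 2 * A₁ := by
    intro l
    by_cases hl : l = 2
    · subst hl
      have e : mulCoord 2 (U 2) = fun ξ => (-1 : ℂ) * (mulCoord 0 (U 0) ξ + mulCoord 1 (U 1) ξ) := by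
        funext ξ
        rw [mulCoord_two_eq hS.div_eq_zero]
        ring
      rw [e, verticalSup_const_mul, enorm_neg, enorm_one, one_mul, two_mul]
      exact (verticalSup_add_le ((hU 0).mulCoord 0) ((hU 1).mulCoord 1)).trans
        (add_le_add (hA₁ 0 0 (by decide)) (hA₁ 1 1 (by decide)))
    · exact (hA₁ 2 l hl).trans (le_mul_of_one_le_left' one_le_two)
  have hterm : ∀ i j, ‖∑ q ∈ Finset.range (n + 1), (nearTerm s n (U j) (U i) (mulCoord j (U i)) q +
      2 * farTerm s n (U j) (U i) (mulCoord j (U i)) q)‖ₑ ≤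
      (cN + 2 * cF + (cN2 + 2 * cF2)) * (P + Q) := by
    intro i j
    have h2 : ‖(2 : ℂ)‖ₑ = 2 := by
      rw [← ofReal_norm, Complex.norm_two]
      norm_num
    have h0 : ‖∑ q ∈ Finset.range (n + 1), (nearTerm s n (U j) (U i) (mulCoord j (U i)) q +
        2 * farTerm s n (U j) (U i) (mulCoord j (U i)) q)‖ₑ ≤
        ∑ q ∈ Finset.range (n + 1), ‖nearTerm s n (U j) (U i) (mulCoord j (U i)) q‖ₑ +
        2 * ∑ q ∈ Finset.range (n + 1), ‖farTerm s n (U j) (U i) (mulCoord j (U i)) q‖ₑ := by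
      rw [Finset.mul_sum, ← Finset.sum_add_distrib]
      refine (enorm_sum_le _ _).trans (Finset.sum_le_sum fun q _ => ?_)
      refine (enorm_add_le _ _).trans_eq ?_
      rw [enorm_mul, h2]
    refine h0.trans ?_
    by_cases hj : j = 2
    · subst hj
      have hE : sobolevEnergy s (fun ξ => (‖ξ‖ : ℂ) * U 2 ξ) ^ (1 / 2 : ℝ) ≤ 2 * e₁ ^ (1 / 2 : ℝ) :=
        (ENNReal.rpow_le_rpow (sobolevEnergy_norm_mul_le (fun i => (hU i).measurable)
          hS.div_eq_zero) (by norm_num)).trans (sqrt_two_mul_le _)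
      have hnear : ∑ q ∈ Finset.range (n + 1), ‖nearTerm s n (U 2) (U i) (mulCoord 2 (U i)) q‖ₑ ≤
          cN2 * Q := by
        refine (sum_nearTerm_vertical_le hs n (hU 2) (hU i) (hU i) hvert _).trans ?_
        refine (mul_le_mul' le_rfl (mul_le_mul' (sobolevQuartic_le s U i)
          (sobolevQuartic_le s U i))).trans_eq ?_
        change _ * (X * X) = _
        rw [hXX]
        simp only [cN2, hQ, p4, b]
        ring
      have hfar : ∑ q ∈ Finset.range (n + 1), ‖farTerm s n (U 2) (U i) (mulCoord 2 (U i)) q‖ₑ ≤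
          cF2 * P := by
        refine (sum_farTerm_vertical_le hs n (hU 2) (hU i) (hU i) _).trans ?_
        have h1 := hinterp i
        have h3 : sobolevQuartic s (U i) ≤ X := sobolevQuartic_le s U i
        calc _ ≤ p4 * (11 * kernelMass * (2 * (A₀ * A₁) ^ (1 / 2 : ℝ))) *
              ENNReal.ofReal (2 * 256 ^ s) * b * (X * (2 * e₁ ^ (1 / 2 : ℝ))) := by gcongr
          _ = _ := by simp only [cF2, hP]; ring
      calc _ ≤ cN2 * Q + 2 * (cF2 * P) := add_le_add hnear (mul_le_mul' le_rfl hfar)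
        _ ≤ cN2 * (P + Q) + 2 * (cF2 * (P + Q)) := by
          gcongr
          · exact le_add_self
          · exact le_self_add
        _ = (cN2 + 2 * cF2) * (P + Q) := by ring
        _ ≤ _ := mul_le_mul' le_add_self le_rfl
    · have hE : sobolevEnergy s (mulCoord j (U i)) ^ (1 / 2 : ℝ) ≤ e₁ ^ (1 / 2 : ℝ) :=
        ENNReal.rpow_le_rpow (sobolevEnergy_mulCoord_le s U i hj) (by norm_num)
      have hnear : ∑ q ∈ Finset.range (n + 1), ‖nearTerm s n (U j) (U i) (mulCoord j (U i)) q‖ₑ ≤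
          cN * P := by
        refine (sum_nearTerm_le hs n (hU j) (hU i) ((hU i).mulCoord j) _).trans ?_
        have h1 := hinterp j
        have h3 : sobolevQuartic s (U i) ≤ X := sobolevQuartic_le s U i
        calc _ ≤ p4 * (2 * (A₀ * A₁) ^ (1 / 2 : ℝ)) *
              ENNReal.ofReal (256 ^ s + 4096 ^ s) * b * (X * e₁ ^ (1 / 2 : ℝ)) := by gcongr
          _ = _ := by simp only [cN, hP]; ring
      have hfar : ∑ q ∈ Finset.range (n + 1), ‖farTerm s n (U j) (U i) (mulCoord j (U i)) q‖ₑ ≤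
          cF * P := by
        refine (sum_farTerm_le hs n (hU j) (hU i) ((hU i).mulCoord j) _).trans ?_
        have h1 := hinterp i
        have h3 : sobolevQuartic s (U j) ≤ X := sobolevQuartic_le s U j
        calc _ ≤ p4 * (11 * kernelMass * (2 * (A₀ * A₁) ^ (1 / 2 : ℝ))) *
              ENNReal.ofReal (256 ^ s) * b * (X * e₁ ^ (1 / 2 : ℝ)) := by gcongr
          _ = _ := by simp only [cF, hP]; ring
      calc _ ≤ cN * P + 2 * (cF * P) := add_le_add hnear (mul_le_mul' le_rfl hfar)
        _ ≤ cN * (P + Q) + 2 * (cF * (P + Q)) := by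
          gcongr
          · exact le_self_add
          · exact le_self_add
        _ = (cN + 2 * cF) * (P + Q) := by ring
        _ ≤ _ := mul_le_mul' le_self_add le_rfl
  rw [integral_weight_sub_advectionDensity hU hS s hn]
  refine (enorm_sum_le _ _).trans ((Finset.sum_le_sum fun i _ => (enorm_sum_le _ _).trans
    (Finset.sum_le_sum fun j _ => hterm i j)).trans_eq ?_)
  simp only [Finset.sum_const, Finset.card_univ, Fintype.card_fin, nsmul_eq_mul]
  change _ = 9 * _ * (P + Q)
  push_cast
  ring

/-! ### Radial multipliers of the size of the Sobolev weight -/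

/-- The Sobolev weight as a function of `|ξ|`. -/
noncomputable def radialWeight (s r : ℝ) : ℝ := (1 + (2 * Real.pi * r) ^ 2) ^ s

lemma radialWeight_pos (s r : ℝ) : 0 < radialWeight s r :=
  Real.rpow_pos_of_pos (by positivity) s

lemma radialWeight_mono {s : ℝ} (hs : 0 ≤ s) {x y : ℝ} (hx : 0 ≤ x) (hxy : x ≤ y) :
    radialWeight s x ≤ radialWeight s y :=
  Real.rpow_le_rpow (by positivity) (by gcongr) hs

/-- A differentiable radial function which is bounded, together with its logarithmic derivative,
by the Sobolev weight. -/
structure IsRadialMultiplier (s C : ℝ) (μ : ℝ → ℝ) : Prop where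
  differentiable : Differentiable ℝ μ
  bound : ∀ z, 0 ≤ z → |μ z| ≤ C * radialWeight s z
  deriv_bound : ∀ z, 0 ≤ z → z * |deriv μ z| ≤ C * radialWeight s z

/-- In the mean value theorem the intermediate radius z is at least the smaller radius x, so x
|μ'(z)| ≤ z |μ'(z)|. The smaller radius is exactly what cancels the derivative in the transport
term. -/
lemma IsRadialMultiplier.abs_sub_mul_min_le {s C : ℝ} {μ : ℝ → ℝ} (hμ : IsRadialMultiplier s C μ)
    (hs : 0 ≤ s) (hC : 0 ≤ C) {x y : ℝ} (hx : 0 ≤ x) (hxy : x ≤ y) :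
    |μ y - μ x| * x ≤ C * (y - x) * radialWeight s y := by
  rcases hxy.eq_or_lt with rfl | hlt
  · simp
  obtain ⟨z, hz, hz'⟩ := exists_deriv_eq_slope μ hlt hμ.differentiable.continuous.continuousOn
    hμ.differentiable.differentiableOn
  have h1 : μ y - μ x = deriv μ z * (y - x) := by
    rw [hz', div_mul_cancel₀ _ (sub_ne_zero.2 hlt.ne')]
  have hz0 : 0 ≤ z := hx.trans hz.1.le
  rw [h1, abs_mul, abs_of_pos (sub_pos.2 hlt)]
  have h2 : x * |deriv μ z| ≤ C * radialWeight s y :=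
    calc x * |deriv μ z| ≤ z * |deriv μ z| := by gcongr; exact hz.1.le
      _ ≤ C * radialWeight s z := hμ.deriv_bound z hz0
      _ ≤ C * radialWeight s y := by gcongr; exact radialWeight_mono hs hz0 hz.2.le
  calc _ = (y - x) * (x * |deriv μ z|) := by ring
    _ ≤ (y - x) * (C * radialWeight s y) := by
      have := sub_pos.2 hlt
      gcongr
    _ = _ := by ring

lemma hasDerivAt_radialWeight (s z : ℝ) : HasDerivAt (radialWeight s)
    (s * (1 + (2 * Real.pi * z) ^ 2) ^ (s - 1) * (2 * (2 * Real.pi) ^ 2 * z)) z := by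
  have h1 : HasDerivAt (fun z : ℝ => 1 + (2 * Real.pi * z) ^ 2) (2 * (2 * Real.pi) ^ 2 * z) z := by
    have := (((hasDerivAt_id z).const_mul (2 * Real.pi)).pow 2).const_add 1
    exact this.congr_deriv (by simp; ring)
  have h2 := h1.rpow_const (p := s) (Or.inl (by positivity))
  exact h2.congr_deriv (by ring)

lemma abs_mul_deriv_radialWeight_le {s : ℝ} (hs : 0 ≤ s) (z : ℝ) :
    |z * (s * (1 + (2 * Real.pi * z) ^ 2) ^ (s - 1) * (2 * (2 * Real.pi) ^ 2 * z))| ≤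
      2 * s * radialWeight s z := by
  have hp : 0 < 1 + (2 * Real.pi * z) ^ 2 := by positivity
  have h1 : z * (s * (1 + (2 * Real.pi * z) ^ 2) ^ (s - 1) * (2 * (2 * Real.pi) ^ 2 * z)) =
      2 * s * ((1 + (2 * Real.pi * z) ^ 2) ^ (s - 1) * (2 * Real.pi * z) ^ 2) := by ring
  rw [h1, abs_of_nonneg (by positivity)]
  refine mul_le_mul_of_nonneg_left ?_ (by positivity)
  calc _ ≤ (1 + (2 * Real.pi * z) ^ 2) ^ (s - 1) * (1 + (2 * Real.pi * z) ^ 2) := by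
        gcongr
        linarith
    _ = radialWeight s z := by
        rw [radialWeight, Real.rpow_sub_one hp.ne', div_mul_cancel₀ _ hp.ne']

lemma isRadialMultiplier_radialWeight {s : ℝ} (hs : 0 ≤ s) :
    IsRadialMultiplier s (1 + 2 * s) (radialWeight s) where
  differentiable z := (hasDerivAt_radialWeight s z).differentiableAt
  bound z _ := by
    have := radialWeight_pos s z
    rw [abs_of_pos this]
    nlinarith
  deriv_bound z hz := by
    have h1 := abs_mul_deriv_radialWeight_le hs z
    have := radialWeight_pos s z
    rw [(hasDerivAt_radialWeight s z).deriv]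
    rw [abs_mul, abs_of_nonneg hz] at h1
    linarith

/-- The constant is independent of R because z d/dz is scale invariant: the cutoff contributes (z/R)
χ'(z/R), which is bounded. -/
lemma exists_isRadialMultiplier_cutoff {s : ℝ} (hs : 0 ≤ s) {χ : ℝ → ℝ} (hχ : IsCutoff χ) :
    ∃ C, 0 ≤ C ∧ ∀ R, 0 < R → IsRadialMultiplier s C fun z => χ (z / R) * radialWeight s z := by
  obtain ⟨hd, hc, -⟩ := hχ
  obtain ⟨B₀, hB₀⟩ := hd.continuous.bounded_above_of_compact_support hc
  have hcd : Continuous (deriv χ) := hd.continuous_deriv (by simp)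
  obtain ⟨B₁, hB₁⟩ := (continuous_id.mul hcd).bounded_above_of_compact_support
    (hc.deriv.mul_left (f := id))
  have hB₀0 : 0 ≤ B₀ := (norm_nonneg _).trans (hB₀ 0)
  have hB₁0 : 0 ≤ B₁ := (norm_nonneg _).trans (hB₁ 0)
  refine ⟨B₀ + B₁ + B₀ * (2 * s), by positivity, fun R hR => ?_⟩
  have hder : ∀ z, HasDerivAt (fun z => χ (z / R) * radialWeight s z)
      (deriv χ (z / R) * (1 / R) * radialWeight s z + χ (z / R) *
        (s * (1 + (2 * Real.pi * z) ^ 2) ^ (s - 1) * (2 * (2 * Real.pi) ^ 2 * z))) z := fun z => by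
    have h1 : HasDerivAt χ (deriv χ (z / R)) (z / R) :=
      (hd.differentiable (by simp) _).hasDerivAt
    exact (h1.comp z ((hasDerivAt_id z).div_const R)).mul (hasDerivAt_radialWeight s z)
  refine ⟨fun z => (hder z).differentiableAt, fun z hz => ?_, fun z hz => ?_⟩
  · have hw := radialWeight_pos s z
    rw [abs_mul, abs_of_pos hw]
    have := hB₀ (z / R)
    rw [Real.norm_eq_abs] at this
    gcongr
    have : 0 ≤ B₀ * (2 * s) := by positivity
    linarith
  · have hw := radialWeight_pos s z
    rw [(hder z).deriv, ← abs_of_nonneg hz, ← abs_mul, abs_of_nonneg hz, mul_add]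
    have h0 := hB₀ (z / R)
    have h1 := hB₁ (z / R)
    have h2 := abs_mul_deriv_radialWeight_le hs z
    simp only [Pi.mul_apply, id, Real.norm_eq_abs] at h0 h1
    refine (abs_add_le _ _).trans ?_
    have e1 : z * (deriv χ (z / R) * (1 / R) * radialWeight s z) =
        (z / R * deriv χ (z / R)) * radialWeight s z := by ring
    have e2 : z * (χ (z / R) *
        (s * (1 + (2 * Real.pi * z) ^ 2) ^ (s - 1) * (2 * (2 * Real.pi) ^ 2 * z))) = χ (z / R) *
        (z * (s * (1 + (2 * Real.pi * z) ^ 2) ^ (s - 1) * (2 * (2 * Real.pi) ^ 2 * z))) := by ring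
    rw [e1, e2, abs_mul, abs_mul (χ _), abs_of_pos hw]
    calc _ ≤ B₁ * radialWeight s z + B₀ * (2 * s * radialWeight s z) := by gcongr
      _ ≤ _ := by nlinarith [mul_nonneg hB₀0 hw.le]

/-! ### Pointwise domination of the advection density -/

/-- The size of a family at a point. -/
noncomputable def amplitude (V : Fin 3 → R3 → ℂ) (ξ : R3) : ℝ := ∑ i, ‖V i ξ‖

/-- The size of the horizontal frequency. -/
def horizontalSize (ξ : R3) : ℝ := |ξ 0| + |ξ 1|

/-- The square root of the Sobolev weight. -/
noncomputable def sqrtWeight (s : ℝ) (ξ : R3) : ℝ := symbol ξ ^ (s / 2)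

lemma amplitude_nonneg (V : Fin 3 → R3 → ℂ) (ξ : R3) : 0 ≤ amplitude V ξ :=
  Finset.sum_nonneg fun _ _ => norm_nonneg _

lemma norm_le_amplitude (V : Fin 3 → R3 → ℂ) (i : Fin 3) (ξ : R3) : ‖V i ξ‖ ≤ amplitude V ξ :=
  Finset.single_le_sum (f := fun i => ‖V i ξ‖) (fun _ _ => norm_nonneg _) (Finset.mem_univ i)

lemma horizontalSize_nonneg (ξ : R3) : 0 ≤ horizontalSize ξ := by
  unfold horizontalSize
  positivity

lemma horizontalSize_add_le (ξ η : R3) :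
    horizontalSize (ξ + η) ≤ horizontalSize ξ + horizontalSize η := by
  unfold horizontalSize
  have h0 := abs_add_le (ξ 0) (η 0)
  have h1 := abs_add_le (ξ 1) (η 1)
  simp only [PiLp.add_apply]
  linarith

lemma horizontalSize_neg (ξ : R3) : horizontalSize (-ξ) = horizontalSize ξ := by
  simp [horizontalSize]

lemma sqrtWeight_pos (s : ℝ) (ξ : R3) : 0 < sqrtWeight s ξ := Real.rpow_pos_of_pos (symbol_pos ξ) _

lemma sqrtWeight_sq (s : ℝ) (ξ : R3) : sqrtWeight s ξ ^ 2 = sobolevWeight s ξ := by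
  rw [sqrtWeight, sobolevWeight_eq, ← Real.rpow_natCast, ← Real.rpow_mul (symbol_pos ξ).le]
  norm_num

lemma sqrtWeight_neg (s : ℝ) (ξ : R3) : sqrtWeight s (-ξ) = sqrtWeight s ξ := by
  rw [sqrtWeight, sqrtWeight, symbol_neg]

lemma symbol_add_le (ξ η : R3) : symbol (ξ + η) ≤ 4 * max (symbol ξ) (symbol η) := by
  have h1 : ‖ξ + η‖ ^ 2 ≤ 2 * ‖ξ‖ ^ 2 + 2 * ‖η‖ ^ 2 := by
    have := pow_le_pow_left₀ (norm_nonneg _) (norm_add_le ξ η) 2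
    nlinarith [sq_nonneg (‖ξ‖ - ‖η‖)]
  have h2 : symbol (ξ + η) ≤ 2 * symbol ξ + 2 * symbol η := by
    unfold symbol
    have : (2 * Real.pi) ^ 2 * ‖ξ + η‖ ^ 2 ≤ (2 * Real.pi) ^ 2 * (2 * ‖ξ‖ ^ 2 + 2 * ‖η‖ ^ 2) := by
      gcongr
    rw [mul_pow, mul_pow _ ‖ξ‖, mul_pow _ ‖η‖]
    linarith
  have h3 := le_max_left (symbol ξ) (symbol η)
  have h4 := le_max_right (symbol ξ) (symbol η)
  linarith

lemma sqrtWeight_add_le {s : ℝ} (hs : 0 ≤ s) (ξ η : R3) :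
    sqrtWeight s (ξ + η) ≤ 4 ^ (s / 2) * (sqrtWeight s ξ + sqrtWeight s η) := by
  have h1 : sqrtWeight s (ξ + η) ≤ 4 ^ (s / 2) * (max (symbol ξ) (symbol η)) ^ (s / 2) := by
    rw [← Real.mul_rpow (by norm_num) (le_max_of_le_left (symbol_pos ξ).le)]
    exact Real.rpow_le_rpow (symbol_pos _).le (symbol_add_le ξ η) (by positivity)
  refine h1.trans ?_
  gcongr
  rcases le_total (symbol ξ) (symbol η) with h | h
  · rw [max_eq_right h]
    exact le_add_of_nonneg_left (sqrtWeight_pos s ξ).le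
  · rw [max_eq_left h]
    exact le_add_of_nonneg_right (sqrtWeight_pos s η).le

/-- None of the three quantities can dominate the other two. So a double weight on one frequency can
be spread over two frequencies, and the horizontal factor can be placed on one of these two; the
third frequency is left bare for an L¹ bound. -/
lemma sum_sq_mul_sum_le {C v₁ v₂ v₃ h₁ h₂ h₃ : ℝ} (hv₁ : 0 ≤ v₁) (hv₂ : 0 ≤ v₂)
    (hv₃ : 0 ≤ v₃) (hh₁ : 0 ≤ h₁) (hh₂ : 0 ≤ h₂) (hh₃ : 0 ≤ h₃) (hC : 0 ≤ C)
    (a₁ : v₁ ≤ C * (v₂ + v₃)) (a₂ : v₂ ≤ C * (v₁ + v₃)) (a₃ : v₃ ≤ C * (v₁ + v₂))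
    (b₁ : h₁ ≤ h₂ + h₃) (b₂ : h₂ ≤ h₁ + h₃) (b₃ : h₃ ≤ h₁ + h₂) :
    (v₁ ^ 2 + v₂ ^ 2 + v₃ ^ 2) * (h₁ + h₂ + h₃) ≤
      4 * C * (v₁ * v₂ * (h₁ + h₂) + v₁ * v₃ * (h₁ + h₃) + v₂ * v₃ * (h₂ + h₃)) := by
  have h1 : v₁ ^ 2 + v₂ ^ 2 + v₃ ^ 2 ≤ 2 * C * (v₁ * v₂ + v₁ * v₃ + v₂ * v₃) := by
    nlinarith [mul_le_mul_of_nonneg_left a₁ hv₁, mul_le_mul_of_nonneg_left a₂ hv₂,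
      mul_le_mul_of_nonneg_left a₃ hv₃]
  have e1 : v₁ * v₂ * (h₁ + h₂ + h₃) ≤ v₁ * v₂ * (2 * (h₁ + h₂)) :=
    mul_le_mul_of_nonneg_left (by linarith) (by positivity)
  have e2 : v₁ * v₃ * (h₁ + h₂ + h₃) ≤ v₁ * v₃ * (2 * (h₁ + h₃)) :=
    mul_le_mul_of_nonneg_left (by linarith) (by positivity)
  have e3 : v₂ * v₃ * (h₁ + h₂ + h₃) ≤ v₂ * v₃ * (2 * (h₂ + h₃)) :=
    mul_le_mul_of_nonneg_left (by linarith) (by positivity)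
  calc _ ≤ 2 * C * (v₁ * v₂ + v₁ * v₃ + v₂ * v₃) * (h₁ + h₂ + h₃) := by gcongr
    _ = 2 * C * (v₁ * v₂ * (h₁ + h₂ + h₃) + v₁ * v₃ * (h₁ + h₂ + h₃) +
        v₂ * v₃ * (h₁ + h₂ + h₃)) := by ring
    _ ≤ 2 * C * (v₁ * v₂ * (2 * (h₁ + h₂)) + v₁ * v₃ * (2 * (h₁ + h₃)) +
        v₂ * v₃ * (2 * (h₂ + h₃))) := by gcongr
    _ = _ := by ring

/-- An integrable majorant of the truncated commutators. -/
noncomputable def dominator (s : ℝ) (V : Fin 3 → R3 → ℂ) (p : R3 × R3) : ℝ :=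
  (sqrtWeight s p.1 * sqrtWeight s p.2 * (horizontalSize p.1 + horizontalSize p.2) +
    sqrtWeight s p.1 * sqrtWeight s (p.1 + p.2) * (horizontalSize p.1 + horizontalSize (p.1 + p.2)) +
    sqrtWeight s p.2 * sqrtWeight s (p.1 + p.2) *
      (horizontalSize p.2 + horizontalSize (p.1 + p.2))) *
  (amplitude V p.1 * amplitude V p.2 * amplitude V (p.1 + p.2))

lemma weight_mul_horizontalSize_le {s : ℝ} (hs : 0 ≤ s) (V : Fin 3 → R3 → ℂ) (p : R3 × R3) :
    (sobolevWeight s p.1 + sobolevWeight s p.2 + sobolevWeight s (p.1 + p.2)) *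
      (horizontalSize p.1 + horizontalSize p.2 + horizontalSize (p.1 + p.2)) *
      (amplitude V p.1 * amplitude V p.2 * amplitude V (p.1 + p.2)) ≤
      4 * 4 ^ (s / 2) * dominator s V p := by
  obtain ⟨η, ζ⟩ := p
  have e1 : η = (η + ζ) + -ζ := by abel
  have e2 : ζ = (η + ζ) + -η := by abel
  have v1 : sqrtWeight s η ≤ 4 ^ (s / 2) * (sqrtWeight s ζ + sqrtWeight s (η + ζ)) := by
    have := sqrtWeight_add_le hs (η + ζ) (-ζ)
    rwa [← e1, sqrtWeight_neg, add_comm (sqrtWeight s (η + ζ))] at this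
  have v2 : sqrtWeight s ζ ≤ 4 ^ (s / 2) * (sqrtWeight s η + sqrtWeight s (η + ζ)) := by
    have := sqrtWeight_add_le hs (η + ζ) (-η)
    rwa [← e2, sqrtWeight_neg, add_comm (sqrtWeight s (η + ζ))] at this
  have h1 : horizontalSize η ≤ horizontalSize ζ + horizontalSize (η + ζ) := by
    have := horizontalSize_add_le (η + ζ) (-ζ)
    rwa [← e1, horizontalSize_neg, add_comm (horizontalSize (η + ζ))] at this
  have h2 : horizontalSize ζ ≤ horizontalSize η + horizontalSize (η + ζ) := by
    have := horizontalSize_add_le (η + ζ) (-η)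
    rwa [← e2, horizontalSize_neg, add_comm (horizontalSize (η + ζ))] at this
  have h := sum_sq_mul_sum_le (sqrtWeight_pos s η).le (sqrtWeight_pos s ζ).le
    (sqrtWeight_pos s (η + ζ)).le (horizontalSize_nonneg η) (horizontalSize_nonneg ζ)
    (horizontalSize_nonneg (η + ζ)) (C := 4 ^ (s / 2)) (by positivity) v1 v2
    (sqrtWeight_add_le hs η ζ) h1 h2 (horizontalSize_add_le η ζ)
  simp only [sqrtWeight_sq] at h
  unfold dominator
  rw [← mul_assoc (4 * 4 ^ (s / 2))]
  exact mul_le_mul_of_nonneg_right h (mul_nonneg (mul_nonneg (amplitude_nonneg _ _)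
    (amplitude_nonneg _ _)) (amplitude_nonneg _ _))

lemma norm_sum_coord_mul_le (V : Fin 3 → R3 → ℂ) (κ η : R3) :
    ‖∑ j, (κ j : ℂ) * V j η‖ ≤ horizontalSize κ * amplitude V η + ‖κ‖ * ‖V 2 η‖ := by
  have h2 : |κ 2| ≤ ‖κ‖ := by simpa using PiLp.norm_apply_le κ 2
  rw [Fin.sum_univ_three]
  refine norm_add₃_le.trans ?_
  simp only [norm_mul, Complex.norm_real, Real.norm_eq_abs]
  unfold horizontalSize
  rw [add_mul]
  have e0 := norm_le_amplitude V 0 η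
  have e1 := norm_le_amplitude V 1 η
  gcongr

/-- The vertical part of |η| acting on V_3 is exchanged for horizontal frequencies by the divergence
condition. -/
lemma norm_mul_norm_le {V : Fin 3 → R3 → ℂ} (hS : ∀ ξ : R3, ∑ j, (ξ j : ℂ) * V j ξ = 0) (η : R3) :
    ‖η‖ * ‖V 2 η‖ ≤ 2 * horizontalSize η * amplitude V η := by
  have h1 : ‖η‖ ≤ |η 0| + |η 1| + |η 2| := by
    rw [EuclideanSpace.norm_eq, Fin.sum_univ_three]
    refine Real.sqrt_le_iff.2 ⟨by positivity, ?_⟩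
    simp only [Real.norm_eq_abs]
    nlinarith [abs_nonneg (η 0), abs_nonneg (η 1), abs_nonneg (η 2),
      mul_nonneg (abs_nonneg (η 0)) (abs_nonneg (η 1)),
      mul_nonneg (abs_nonneg (η 0)) (abs_nonneg (η 2)),
      mul_nonneg (abs_nonneg (η 1)) (abs_nonneg (η 2))]
  have e0 := norm_le_amplitude V 0 η
  have e1 := norm_le_amplitude V 1 η
  have e2 := norm_le_amplitude V 2 η
  have h2 : |η 2| * ‖V 2 η‖ ≤ |η 0| * ‖V 0 η‖ + |η 1| * ‖V 1 η‖ := by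
    have h := mulCoord_two_eq hS η
    have h' := norm_add_le (mulCoord 0 (V 0) η) (mulCoord 1 (V 1) η)
    rw [← norm_neg (mulCoord 0 (V 0) η + _), ← h] at h'
    simpa only [mulCoord, norm_mul, Complex.norm_real, Real.norm_eq_abs] using h'
  unfold horizontalSize
  calc _ ≤ (|η 0| + |η 1| + |η 2|) * ‖V 2 η‖ := by gcongr
    _ = |η 0| * ‖V 2 η‖ + |η 1| * ‖V 2 η‖ + |η 2| * ‖V 2 η‖ := by ring
    _ ≤ |η 0| * ‖V 2 η‖ + |η 1| * ‖V 2 η‖ + (|η 0| * ‖V 0 η‖ + |η 1| * ‖V 1 η‖) := by gcongr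
    _ ≤ |η 0| * amplitude V η + |η 1| * amplitude V η +
        (|η 0| * amplitude V η + |η 1| * amplitude V η) := by gcongr
    _ = _ := by ring

lemma norm_sum_mul_conj_le (V : Fin 3 → R3 → ℂ) (ζ ξ : R3) :
    ‖∑ i, V i ζ * conj (V i ξ)‖ ≤ amplitude V ζ * amplitude V ξ := by
  refine (norm_sum_le _ _).trans ?_
  rw [amplitude, Finset.sum_mul]
  refine Finset.sum_le_sum fun i _ => ?_
  rw [norm_mul, RCLike.norm_conj]
  gcongr
  exact norm_le_amplitude V i ξ

/-- Horizontal components of the transport factor are already of the size of a horizontal frequency.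
For the vertical one, the difference of the multipliers turns the frequency κ into η, and |η|
|V_3(η)| is again horizontal. -/
lemma IsRadialMultiplier.norm_sub_mul_advectionDensity_le {s C : ℝ} {μ : ℝ → ℝ}
    (hμ : IsRadialMultiplier s C μ) (hs : 0 ≤ s) (hC : 0 ≤ C) {V : Fin 3 → R3 → ℂ}
    (hS : IsSolenoidal V) (p : R3 × R3) :
    |μ ‖p.1 + p.2‖ - μ ‖p.2‖| * ‖advectionDensity V p‖ ≤
      C * (8 * 4 ^ (s / 2) * dominator s V p) := by
  have hkey := weight_mul_horizontalSize_le hs V p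
  obtain ⟨η, ζ⟩ := p
  dsimp only at *
  set ξ := η + ζ with hξ
  have hw1 := (sobolevWeight_pos s ξ).le
  have hw2 := (sobolevWeight_pos s ζ).le
  have hw3 := (sobolevWeight_pos s η).le
  have hh1 := horizontalSize_nonneg ξ
  have hh2 := horizontalSize_nonneg ζ
  have hh3 := horizontalSize_nonneg η
  have ha1 := amplitude_nonneg V η
  have hΔ : |μ ‖ξ‖ - μ ‖ζ‖| ≤ C * (sobolevWeight s ξ + sobolevWeight s ζ) := by
    refine (abs_sub _ _).trans ?_
    rw [mul_add]
    exact add_le_add (hμ.bound _ (norm_nonneg _)) (hμ.bound _ (norm_nonneg _))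
  -- As η·V(η) = 0, the transport factor may use either ξ or ζ; κ is the shorter of the two, as the
  -- mean value bound requires.
  obtain ⟨κ, hκT, hκh, hκ⟩ : ∃ κ : R3, ∑ j, (ξ j : ℂ) * V j η = ∑ j, (κ j : ℂ) * V j η ∧
      horizontalSize κ ≤ horizontalSize ξ + horizontalSize ζ ∧
      |μ ‖ξ‖ - μ ‖ζ‖| * ‖κ‖ ≤ C * ‖η‖ * (sobolevWeight s ξ + sobolevWeight s ζ) := by
    rcases le_total ‖ζ‖ ‖ξ‖ with h | h
    · refine ⟨ζ, hS.sum_add_coord η ζ, by linarith, ?_⟩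
      refine (hμ.abs_sub_mul_min_le hs hC (norm_nonneg _) h).trans ?_
      have h1 : ‖ξ‖ - ‖ζ‖ ≤ ‖η‖ := by
        have := norm_sub_norm_le ξ ζ
        rwa [hξ, add_sub_cancel_right, ← hξ] at this
      have h2 : radialWeight s ‖ξ‖ ≤ sobolevWeight s ξ + sobolevWeight s ζ :=
        le_add_of_nonneg_right hw2
      have h3 : 0 ≤ ‖ξ‖ - ‖ζ‖ := by linarith
      have h4 := (radialWeight_pos s ‖ξ‖).le
      gcongr
    · refine ⟨ξ, rfl, by linarith, ?_⟩
      rw [abs_sub_comm]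
      refine (hμ.abs_sub_mul_min_le hs hC (norm_nonneg _) h).trans ?_
      have h1 : ‖ζ‖ - ‖ξ‖ ≤ ‖η‖ := by
        have := norm_sub_norm_le ζ ξ
        rwa [norm_sub_rev, hξ, add_sub_cancel_right, ← hξ] at this
      have h2 : radialWeight s ‖ζ‖ ≤ sobolevWeight s ξ + sobolevWeight s ζ :=
        le_add_of_nonneg_left hw1
      have h3 : 0 ≤ ‖ζ‖ - ‖ξ‖ := by linarith
      have h4 := (radialWeight_pos s ‖ζ‖).le
      gcongr
  have hT : |μ ‖ξ‖ - μ ‖ζ‖| * ‖∑ j, (ξ j : ℂ) * V j η‖ ≤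
      C * 2 * ((sobolevWeight s η + sobolevWeight s ζ + sobolevWeight s ξ) *
        (horizontalSize η + horizontalSize ζ + horizontalSize ξ) * amplitude V η) := by
    rw [hκT]
    calc _ ≤ |μ ‖ξ‖ - μ ‖ζ‖| * (horizontalSize κ * amplitude V η + ‖κ‖ * ‖V 2 η‖) := by
          gcongr
          exact norm_sum_coord_mul_le V κ η
      _ = |μ ‖ξ‖ - μ ‖ζ‖| * horizontalSize κ * amplitude V η +
          |μ ‖ξ‖ - μ ‖ζ‖| * ‖κ‖ * ‖V 2 η‖ := by ring
      _ ≤ C * (sobolevWeight s ξ + sobolevWeight s ζ) * (horizontalSize ξ + horizontalSize ζ) *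
          amplitude V η + C * ‖η‖ * (sobolevWeight s ξ + sobolevWeight s ζ) * ‖V 2 η‖ := by
          have := horizontalSize_nonneg κ
          gcongr
      _ = C * (sobolevWeight s ξ + sobolevWeight s ζ) * ((horizontalSize ξ + horizontalSize ζ) *
          amplitude V η + ‖η‖ * ‖V 2 η‖) := by ring
      _ ≤ C * (sobolevWeight s ξ + sobolevWeight s ζ) * ((horizontalSize ξ + horizontalSize ζ) *
          amplitude V η + 2 * horizontalSize η * amplitude V η) := by
          have := norm_mul_norm_le hS.div_eq_zero η
          exact mul_le_mul_of_nonneg_left (by linarith) (by positivity)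
      _ = C * ((sobolevWeight s ξ + sobolevWeight s ζ) * (horizontalSize ξ + horizontalSize ζ +
          2 * horizontalSize η) * amplitude V η) := by ring
      _ ≤ C * ((sobolevWeight s η + sobolevWeight s ζ + sobolevWeight s ξ) *
          (2 * (horizontalSize η + horizontalSize ζ + horizontalSize ξ)) * amplitude V η) := by
          refine mul_le_mul_of_nonneg_left (mul_le_mul_of_nonneg_right (mul_le_mul ?_ ?_ ?_ ?_)
            ha1) hC
          · linarith
          · linarith
          · positivity
          · positivity
      _ = _ := by ring
  rw [advectionDensity_eq, norm_mul]
  dsimp only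
  rw [← hξ, ← mul_assoc]
  have ha2 := amplitude_nonneg V ζ
  have ha3 := amplitude_nonneg V ξ
  calc _ ≤ C * 2 * ((sobolevWeight s η + sobolevWeight s ζ + sobolevWeight s ξ) *
        (horizontalSize η + horizontalSize ζ + horizontalSize ξ) * amplitude V η) *
        (amplitude V ζ * amplitude V ξ) := by
        gcongr
        exact norm_sum_mul_conj_le V ζ ξ
    _ = C * 2 * ((sobolevWeight s η + sobolevWeight s ζ + sobolevWeight s ξ) *
        (horizontalSize η + horizontalSize ζ + horizontalSize ξ) *
        (amplitude V η * amplitude V ζ * amplitude V ξ)) := by ring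
    _ ≤ C * 2 * (4 * 4 ^ (s / 2) * dominator s V (η, ζ)) := by gcongr
    _ = _ := by ring

/-! ### Integrability of fields of finite anisotropic energy -/

/-- A field in `H^s` with horizontal gradient in `H^s`, on the frequency side. -/
structure HasFiniteEnergy (s : ℝ) (V : Fin 3 → R3 → ℂ) : Prop where
  measurable : ∀ i, Measurable (V i)
  energy_ne_top : fieldEnergy s V ≠ ⊤
  horizontalEnergy_ne_top : fieldHorizontalEnergy s V ≠ ⊤

lemma HasFiniteEnergy.sobolevEnergy_ne_top {s : ℝ} {V : Fin 3 → R3 → ℂ} (hV : HasFiniteEnergy s V)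
    (i : Fin 3) : sobolevEnergy s (V i) ≠ ⊤ :=
  ENNReal.sum_ne_top.1 hV.energy_ne_top i (Finset.mem_univ i)

lemma HasFiniteEnergy.sobolevEnergy_mulCoord_ne_top {s : ℝ} {V : Fin 3 → R3 → ℂ}
    (hV : HasFiniteEnergy s V) (i : Fin 3) {j : Fin 3} (hj : j ≠ 2) :
    sobolevEnergy s (mulCoord j (V i)) ≠ ⊤ :=
  ne_top_of_le_ne_top hV.horizontalEnergy_ne_top (sobolevEnergy_mulCoord_le s V i hj)

/-! ### Integrability of the profiles and of the majorant. -/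

lemma integrable_inv_one_add_sq {a : ℝ} (ha : 1 / 2 < a) :
    Integrable fun t : ℝ => ((1 + t ^ 2) ^ a)⁻¹ := by
  have h := integrable_rpow_neg_one_add_norm_sq (E := ℝ) (μ := volume) (r := 2 * a)
    (by simp; linarith)
  refine h.congr (Eventually.of_forall fun t => ?_)
  dsimp only
  rw [Real.norm_eq_abs, sq_abs, ← Real.rpow_neg (by positivity)]
  congr 1
  ring

lemma integrable_inv_anisotropic_weight {s : ℝ} (hs : 1 / 2 < s) :
    Integrable fun ξ : R3 => (sobolevWeight s ξ * (1 + ξ 0 ^ 2 + ξ 1 ^ 2))⁻¹ := by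
  -- The exponents s of the Sobolev weight and 1 of the horizontal weight are distributed equally
  -- over the three coordinates: 3a = s + 1. Each one-dimensional factor is integrable when a > 1/2,
  -- that is, s > 1/2.
  set a := (1 + s) / 3 with ha
  have ha2 : 1 / 2 < a := by rw [ha]; linarith
  have h1 : Integrable fun x : Fin 3 → ℝ => ∏ k, ((1 + x k ^ 2) ^ a)⁻¹ :=
    Integrable.fintype_prod (f := fun _ (t : ℝ) => ((1 + t ^ 2) ^ a)⁻¹)
      fun _ => integrable_inv_one_add_sq ha2
  have h2 : Integrable fun ξ : R3 => ∏ k, ((1 + ξ k ^ 2) ^ a)⁻¹ := by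
    rw [← (PiLp.volume_preserving_toLp (Fin 3)).integrable_comp_emb
      (MeasurableEquiv.toLp 2 _).measurableEmbedding]
    exact h1
  have hm : Measurable fun ξ : R3 => (sobolevWeight s ξ * (1 + ξ 0 ^ 2 + ξ 1 ^ 2))⁻¹ := by
    have := (continuous_sobolevWeight s).measurable
    fun_prop
  refine h2.mono' hm.aestronglyMeasurable (Eventually.of_forall fun ξ => ?_)
  have hw := sobolevWeight_pos s ξ
  rw [Real.norm_of_nonneg (by positivity), Finset.prod_inv_distrib]
  refine inv_anti₀ (by positivity) ?_
  have hY : ∀ k, 1 + ξ k ^ 2 ≤ symbol ξ := fun k => by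
    have h3 : |ξ k| ≤ ‖ξ‖ := by simpa using PiLp.norm_apply_le ξ k
    have h4 : ξ k ^ 2 ≤ ‖ξ‖ ^ 2 := sq_le_sq' (by linarith [neg_abs_le (ξ k)]) ((le_abs_self _).trans h3)
    have h5 : ‖ξ‖ ^ 2 ≤ (2 * Real.pi * ‖ξ‖) ^ 2 := by
      have : 1 ≤ 2 * Real.pi := by linarith [Real.pi_gt_three]
      refine pow_le_pow_left₀ (norm_nonneg _) ?_ 2
      exact le_mul_of_one_le_left (norm_nonneg _) this
    unfold symbol
    linarith
  have hs3 : s = a + (a - 1 / 2) + (a - 1 / 2) := by rw [ha]; ring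
  have hY0 : ∀ k, 0 < 1 + ξ k ^ 2 := fun k => by positivity
  have e1 : (1 + ξ 2 ^ 2) ^ a * (1 + ξ 0 ^ 2) ^ (a - 1 / 2) * (1 + ξ 1 ^ 2) ^ (a - 1 / 2) ≤
      sobolevWeight s ξ := by
    have hsplit : symbol ξ ^ s = symbol ξ ^ a * symbol ξ ^ (a - 1 / 2) * symbol ξ ^ (a - 1 / 2) := by
      rw [← Real.rpow_add (symbol_pos ξ), ← Real.rpow_add (symbol_pos ξ), ← hs3]
    rw [sobolevWeight_eq, hsplit]
    have := symbol_pos ξ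
    have ha0 : 0 ≤ a := by linarith
    have ha1 : 0 ≤ a - 1 / 2 := by linarith
    have y0 := hY 0
    have y1 := hY 1
    have y2 := hY 2
    gcongr
  have e2 : (1 + ξ 0 ^ 2) ^ (1 / 2 : ℝ) * (1 + ξ 1 ^ 2) ^ (1 / 2 : ℝ) ≤ 1 + ξ 0 ^ 2 + ξ 1 ^ 2 := by
    have hp : 0 < 1 + ξ 0 ^ 2 + ξ 1 ^ 2 := by positivity
    calc _ ≤ (1 + ξ 0 ^ 2 + ξ 1 ^ 2) ^ (1 / 2 : ℝ) * (1 + ξ 0 ^ 2 + ξ 1 ^ 2) ^ (1 / 2 : ℝ) := by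
          have h0 := sq_nonneg (ξ 0)
          have h1 := sq_nonneg (ξ 1)
          exact mul_le_mul (Real.rpow_le_rpow (hY0 0).le (by linarith) (by norm_num))
            (Real.rpow_le_rpow (hY0 1).le (by linarith) (by norm_num)) (by positivity)
            (by positivity)
      _ = _ := by rw [← Real.rpow_add hp]; norm_num
  calc ∏ k, (1 + ξ k ^ 2) ^ a = ((1 + ξ 2 ^ 2) ^ a * (1 + ξ 0 ^ 2) ^ (a - 1 / 2) *
      (1 + ξ 1 ^ 2) ^ (a - 1 / 2)) * ((1 + ξ 0 ^ 2) ^ (1 / 2 : ℝ) * (1 + ξ 1 ^ 2) ^ (1 / 2 : ℝ)) := by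
        have h0 : (1 + ξ 0 ^ 2) ^ a = (1 + ξ 0 ^ 2) ^ (a - 1 / 2) * (1 + ξ 0 ^ 2) ^ (1 / 2 : ℝ) := by
          rw [← Real.rpow_add (hY0 0)]; congr 1; ring
        have h1 : (1 + ξ 1 ^ 2) ^ a = (1 + ξ 1 ^ 2) ^ (a - 1 / 2) * (1 + ξ 1 ^ 2) ^ (1 / 2 : ℝ) := by
          rw [← Real.rpow_add (hY0 1)]; congr 1; ring
        rw [Fin.prod_univ_three, h0, h1]
        ring
    _ ≤ _ := by gcongr

lemma memLp_sqrtWeight_mul {s : ℝ} {f : R3 → ℂ} (hf : Measurable f) (h : sobolevEnergy s f ≠ ⊤) :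
    MemLp (fun ξ => sqrtWeight s ξ * ‖f ξ‖) 2 := by
  have hm : Measurable (sqrtWeight s) := by
    have := continuous_symbol.measurable
    unfold sqrtWeight
    fun_prop
  refine ⟨(hm.mul hf.norm).aestronglyMeasurable, ?_⟩
  rw [eLpNorm_lt_top_iff_lintegral_rpow_enorm_lt_top (by norm_num) (by norm_num)]
  refine lt_of_le_of_lt (le_of_eq ?_) h.lt_top
  refine lintegral_congr fun ξ => ?_
  rw [← sqrtWeight_sq, ENNReal.ofReal_pow (sqrtWeight_pos s ξ).le, ENNReal.toReal_ofNat,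
    ENNReal.rpow_ofNat, ← mul_pow, enorm_mul, enorm_norm, Real.enorm_eq_ofReal (sqrtWeight_pos s ξ).le]

lemma HasFiniteEnergy.memLp {s : ℝ} (hs : 0 ≤ s) {V : Fin 3 → R3 → ℂ} (hV : HasFiniteEnergy s V)
    (i : Fin 3) : MemLp (V i) 2 := by
  refine (memLp_sqrtWeight_mul (hV.measurable i) (hV.sobolevEnergy_ne_top i)).of_le
    (hV.measurable i).aestronglyMeasurable (Eventually.of_forall fun ξ => ?_)
  rw [norm_mul, norm_norm, Real.norm_of_nonneg (sqrtWeight_pos s ξ).le]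
  exact le_mul_of_one_le_left (norm_nonneg _)
    (Real.one_le_rpow (one_le_symbol ξ) (by positivity))

/-- Cauchy–Schwarz with the weight ω(ξ)(1+|ξ_h|²), which the energies of the field and of its
horizontal gradient control. The threshold s > 1/2 is needed here only. -/
lemma HasFiniteEnergy.integrable {s : ℝ} (hs : 1 / 2 < s) {V : Fin 3 → R3 → ℂ}
    (hV : HasFiniteEnergy s V) (i : Fin 3) : Integrable (V i) := by
  have hm := hV.measurable i
  have hwm := (continuous_sobolevWeight s).measurable
  refine ⟨hm.aestronglyMeasurable, ?_⟩
  set ϖ : R3 → ℝ := fun ξ => sobolevWeight s ξ * (1 + ξ 0 ^ 2 + ξ 1 ^ 2) with hϖ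
  have hϖ0 : ∀ ξ, 0 < ϖ ξ := fun ξ => by
    have := sobolevWeight_pos s ξ
    simp only [hϖ]
    positivity
  have hϖm : Measurable ϖ := by fun_prop
  have h1 : ∫⁻ ξ, (ENNReal.ofReal (√(ϖ ξ))⁻¹) ^ 2 ≠ ⊤ := by
    refine ne_of_lt (lt_of_le_of_lt (le_of_eq ?_)
      (integrable_inv_anisotropic_weight hs).hasFiniteIntegral)
    refine lintegral_congr fun ξ => ?_
    have := hϖ0 ξ
    rw [← ENNReal.ofReal_pow (by positivity), inv_pow, Real.sq_sqrt (hϖ0 ξ).le,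
      Real.enorm_eq_ofReal (inv_nonneg.2 (hϖ0 ξ).le)]
  have h2 : ∫⁻ ξ, (ENNReal.ofReal (√(ϖ ξ)) * ‖V i ξ‖ₑ) ^ 2 ≠ ⊤ := by
    have e : ∀ ξ, (ENNReal.ofReal (√(ϖ ξ)) * ‖V i ξ‖ₑ) ^ 2 =
        ENNReal.ofReal (sobolevWeight s ξ) * ‖V i ξ‖ₑ ^ 2 +
        (ENNReal.ofReal (sobolevWeight s ξ) * ‖mulCoord 0 (V i) ξ‖ₑ ^ 2 +
        ENNReal.ofReal (sobolevWeight s ξ) * ‖mulCoord 1 (V i) ξ‖ₑ ^ 2) := by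
      intro ξ
      have hw := (sobolevWeight_pos s ξ).le
      rw [mul_pow, ← ENNReal.ofReal_pow (Real.sqrt_nonneg _), Real.sq_sqrt (hϖ0 ξ).le]
      simp only [mulCoord, enorm_mul, mul_pow, hϖ]
      have h3 : ∀ t : ℝ, ‖(t : ℂ)‖ₑ ^ 2 = ENNReal.ofReal (t ^ 2) := fun t => by
        rw [← ofReal_norm, Complex.norm_real, ← ENNReal.ofReal_pow (norm_nonneg _), Real.norm_eq_abs,
          sq_abs]
      rw [h3, h3, ENNReal.ofReal_mul hw, ENNReal.ofReal_add (by positivity) (by positivity),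
        ENNReal.ofReal_add (by positivity) (by positivity), ENNReal.ofReal_one]
      ring
    simp_rw [e]
    have hmc : ∀ j, Measurable (mulCoord j (V i)) := fun j => by
      have : Measurable fun ξ : R3 => (ξ j : ℂ) := by fun_prop
      exact this.mul hm
    rw [lintegral_add_left (by fun_prop), lintegral_add_left (by fun_prop)]
    exact ENNReal.add_ne_top.2 ⟨hV.sobolevEnergy_ne_top i, ENNReal.add_ne_top.2
      ⟨hV.sobolevEnergy_mulCoord_ne_top i (by decide),
        hV.sobolevEnergy_mulCoord_ne_top i (by decide)⟩⟩
  have h3 := lintegral_mul_le_sqrt (μ := volume) (F := fun ξ => ENNReal.ofReal (√(ϖ ξ))⁻¹)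
    (G := fun ξ => ENNReal.ofReal (√(ϖ ξ)) * ‖V i ξ‖ₑ) (by fun_prop) (by fun_prop)
  refine lt_of_le_of_lt (lintegral_mono fun ξ => le_of_eq ?_) (h3.trans_lt ?_)
  · have := Real.sqrt_pos.2 (hϖ0 ξ)
    dsimp only
    rw [← mul_assoc, ← ENNReal.ofReal_mul (by positivity), inv_mul_cancel₀ this.ne',
      ENNReal.ofReal_one, one_mul]
  · exact ENNReal.mul_lt_top (ENNReal.rpow_lt_top_of_nonneg (by norm_num) h1)
      (ENNReal.rpow_lt_top_of_nonneg (by norm_num) h2)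

lemma lintegral_enorm_sq_ne_top_real {f : R3 → ℝ} (hf : MemLp f 2) : ∫⁻ x, ‖f x‖ₑ ^ 2 ≠ ⊤ := by
  have h := hf.2
  rw [eLpNorm_lt_top_iff_lintegral_rpow_enorm_lt_top (by norm_num) (by norm_num)] at h
  simpa using h.ne

lemma integrable_triple {F G H : R3 → ℝ} (hF : Measurable F) (hG : Measurable G)
    (hH : Measurable H)
    (h : ∫⁻ p : R3 × R3, ‖F p.1‖ₑ * ‖G p.2‖ₑ * ‖H (p.1 + p.2)‖ₑ ≠ ⊤) :
    Integrable fun p : R3 × R3 => F p.1 * G p.2 * H (p.1 + p.2) := by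
  refine ⟨Measurable.aestronglyMeasurable (by fun_prop), ?_⟩
  refine lt_of_le_of_lt (le_of_eq ?_) h.lt_top
  simp [enorm_mul]

/-- The majorant consists of six products, each with a factor F₀, a factor F₁, both in L², and the
bare amplitude in L¹. The slot of the amplitude decides which trilinear bound applies. -/
lemma HasFiniteEnergy.integrable_dominator {s : ℝ} (hs : 1 / 2 < s) {V : Fin 3 → R3 → ℂ}
    (hV : HasFiniteEnergy s V) : Integrable (dominator s V) := by
  let F₀ : R3 → ℝ := fun ξ => ∑ i, sqrtWeight s ξ * ‖V i ξ‖
  let F₁ : R3 → ℝ := fun ξ => ∑ i, (sqrtWeight s ξ * ‖mulCoord 0 (V i) ξ‖ +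
    sqrtWeight s ξ * ‖mulCoord 1 (V i) ξ‖)
  have hvm : Measurable (sqrtWeight s) := by
    have := continuous_symbol.measurable
    unfold sqrtWeight
    fun_prop
  have hVm := hV.measurable
  have hmc : ∀ j i, Measurable (mulCoord j (V i)) := fun j i => by
    have : Measurable fun ξ : R3 => (ξ j : ℂ) := by fun_prop
    exact this.mul (hVm i)
  have hF₀ : MemLp F₀ 2 := memLp_finsetSum _ fun i _ =>
    memLp_sqrtWeight_mul (hVm i) (hV.sobolevEnergy_ne_top i)
  have hF₁ : MemLp F₁ 2 := memLp_finsetSum _ fun i _ =>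
    (memLp_sqrtWeight_mul (hmc 0 i) (hV.sobolevEnergy_mulCoord_ne_top i (by decide))).add
      (memLp_sqrtWeight_mul (hmc 1 i) (hV.sobolevEnergy_mulCoord_ne_top i (by decide)))
  have ha : Integrable (amplitude V) := integrable_finsetSum _ fun i _ => (hV.integrable hs i).norm
  have hF₀m : Measurable F₀ := by fun_prop
  have hF₁m : Measurable F₁ := by fun_prop
  have ham : Measurable (amplitude V) := by unfold amplitude; fun_prop
  have h₀ := lintegral_enorm_sq_ne_top_real hF₀
  have h₁ := lintegral_enorm_sq_ne_top_real hF₁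
  have h₂ : ∫⁻ ξ, ‖amplitude V ξ‖ₑ ≠ ⊤ := ha.2.ne
  have hF₀e : ∀ ξ, F₀ ξ = sqrtWeight s ξ * amplitude V ξ := fun ξ => by
    simp only [F₀, amplitude, Finset.mul_sum]
  have hF₁e : ∀ ξ, F₁ ξ = sqrtWeight s ξ * horizontalSize ξ * amplitude V ξ := fun ξ => by
    simp only [F₁, amplitude, Finset.mul_sum, horizontalSize, mulCoord, norm_mul, Complex.norm_real,
      Real.norm_eq_abs]
    refine Finset.sum_congr rfl fun i _ => ?_
    ring
  have hsum : ∀ {F G : R3 → ℝ}, Measurable F → Measurable G → ∫⁻ ξ, ‖F ξ‖ₑ ^ 2 ≠ ⊤ →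
      ∫⁻ ξ, ‖G ξ‖ₑ ^ 2 ≠ ⊤ →
      Integrable (fun p : R3 × R3 => F p.1 * G p.2 * amplitude V (p.1 + p.2)) ∧
      Integrable (fun p : R3 × R3 => F p.1 * amplitude V p.2 * G (p.1 + p.2)) ∧
      Integrable (fun p : R3 × R3 => amplitude V p.1 * F p.2 * G (p.1 + p.2)) := by
    intro F G hF hG hF2 hG2
    refine ⟨integrable_triple hF hG ham (ne_top_of_le_ne_top ?_
      (lintegral_trilinear_le_sum hF.enorm hG.enorm ham.enorm)),
      integrable_triple hF ham hG (ne_top_of_le_ne_top ?_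
      (lintegral_trilinear_le_right hF.enorm ham.enorm hG.enorm)),
      integrable_triple ham hF hG (ne_top_of_le_ne_top ?_
      (lintegral_trilinear_le_left ham.enorm hF.enorm hG.enorm))⟩ <;>
    exact ENNReal.mul_ne_top (ENNReal.mul_ne_top (by finiteness) (by finiteness)) (by finiteness)
  obtain ⟨a1, a2, a3⟩ := hsum hF₀m hF₁m h₀ h₁
  obtain ⟨b1, b2, b3⟩ := hsum hF₁m hF₀m h₁ h₀
  refine (((a1.add b1).add (a2.add b2)).add (a3.add b3)).congr (Eventually.of_forall fun p => ?_)
  simp only [Pi.add_apply, hF₀e, hF₁e, dominator]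
  ring

/-! ### The truncated pairing and its limit -/

/-- The Fourier transform of the components of `u · ∇ u`. -/
noncomputable def transportSymbol (V : Fin 3 → R3 → ℂ) (i : Fin 3) (ξ : R3) : ℂ :=
  ∑ j, 2 * Real.pi * Complex.I * (ξ j : ℂ) * freqConv (V j) (V i) ξ

/-- The commutator integral. -/
noncomputable def commutator (s : ℝ) (V : Fin 3 → R3 → ℂ) : ℂ :=
  ∫ p : R3 × R3, ((sobolevWeight s (p.1 + p.2) - sobolevWeight s p.2 : ℝ) : ℂ) *
    advectionDensity V p

lemma measurable_advectionDensity {V : Fin 3 → R3 → ℂ} (hV : ∀ i, Measurable (V i)) :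
    Measurable (advectionDensity V) := by
  have hc : ∀ j : Fin 3, Measurable fun ξ : R3 => (ξ j : ℂ) := fun j => by fun_prop
  refine Finset.measurable_sum _ fun i _ => Finset.measurable_sum _ fun j _ => ?_
  have h1 : Measurable fun ξ => conj (mulCoord j (V i) ξ) :=
    Complex.continuous_conj.measurable.comp ((hc j).mul (hV i))
  have h2 := hV j
  have h3 := hV i
  exact ((h2.comp measurable_fst).mul (h3.comp measurable_snd)).mul
    (h1.comp (measurable_fst.add measurable_snd))

lemma isBandLimited_mul_of_compactSupport {f : R3 → ℂ} (hf : Measurable f) (hf2 : MemLp f 2)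
    {m : R3 → ℝ} (hm : Continuous m) (hc : HasCompactSupport m) :
    IsBandLimited fun ξ => (m ξ : ℂ) * f ξ := by
  obtain ⟨C, hC⟩ := hm.bounded_above_of_compact_support hc
  have hmc : Measurable fun ξ => (m ξ : ℂ) := (Complex.continuous_ofReal.comp hm).measurable
  refine ⟨hmc.mul hf, hf2.of_le_mul (c := C) (hmc.mul hf).aestronglyMeasurable
    (Eventually.of_forall fun ξ => ?_), ?_⟩
  · rw [norm_mul, Complex.norm_real]
    gcongr
    exact hC ξ
  · obtain ⟨R, hR⟩ := hc.isCompact.isBounded.subset_closedBall (0 : R3)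
    refine ⟨R, fun ξ hξ => ?_⟩
    have : m ξ = 0 := by
      by_contra h
      have := hR (subset_tsupport m h)
      rw [mem_closedBall_zero_iff] at this
      linarith
    simp [this]

section Truncation

variable {s : ℝ} {V : Fin 3 → R3 → ℂ}

lemma integrable_mul_trilinear_of_compactSupport (hs : 1 / 2 < s) (hV : HasFiniteEnergy s V)
    {m : R3 → ℝ} (hm : Continuous m) (hc : HasCompactSupport m) (i j : Fin 3) :
    Integrable fun p : R3 × R3 => (m (p.1 + p.2) : ℂ) *
      (V j p.1 * V i p.2 * conj (mulCoord j (V i) (p.1 + p.2))) := by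
  have h := ((isBandLimited_mul_of_compactSupport (hV.measurable i) (hV.memLp (by linarith) i)
    hm hc).mulCoord j)
  refine (integrable_trilinear_left (hV.measurable j) (hV.measurable i) h.measurable
    (hV.integrable hs j) (hV.memLp (by linarith) i) h.memLp).congr
    (Eventually.of_forall fun p => ?_)
  simp only [mulCoord, map_mul, Complex.conj_ofReal]
  ring

lemma integrable_mul_advectionDensity_of_compactSupport (hs : 1 / 2 < s)
    (hV : HasFiniteEnergy s V) {m : R3 → ℝ} (hm : Continuous m) (hc : HasCompactSupport m) :
    Integrable fun p : R3 × R3 => (m (p.1 + p.2) : ℂ) * advectionDensity V p := by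
  simp only [advectionDensity, Finset.mul_sum]
  exact integrable_finsetSum _ fun i _ => integrable_finsetSum _ fun j _ =>
    integrable_mul_trilinear_of_compactSupport hs hV hm hc i j

lemma integral_mul_transportSymbol (hs : 1 / 2 < s) (hV : HasFiniteEnergy s V)
    {m : R3 → ℝ} (hm : Continuous m) (hc : HasCompactSupport m) :
    ∫ ξ, (m ξ : ℂ) * ∑ i, transportSymbol V i ξ * conj (V i ξ) =
      2 * Real.pi * Complex.I * ∫ p : R3 × R3, (m (p.1 + p.2) : ℂ) * advectionDensity V p := by
  have h2 : ∀ i, MemLp (V i) 2 := hV.memLp (by linarith)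
  have hb : ∀ i j, IsBandLimited (mulCoord j fun ξ => (m ξ : ℂ) * V i ξ) := fun i j =>
    (isBandLimited_mul_of_compactSupport (hV.measurable i) (h2 i) hm hc).mulCoord j
  have hint : ∀ i j, Integrable fun ξ =>
      freqConv (V j) (V i) ξ * conj (mulCoord j (fun ξ => (m ξ : ℂ) * V i ξ) ξ) := by
    intro i j
    obtain ⟨C, hC⟩ := exists_norm_freqConv_le (hV.measurable j) (hV.measurable i) (h2 j) (h2 i)
    have hconj : Integrable fun ξ => conj (mulCoord j (fun ξ => (m ξ : ℂ) * V i ξ) ξ) :=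
      Complex.conjCLE.toContinuousLinearMap.integrable_comp (hb i j).integrable
    exact hconj.bdd_mul (integrable_freqConv (hV.integrable hs j) (hV.integrable hs i)).1
      (Eventually.of_forall hC)
  have hpt : ∀ ξ, (m ξ : ℂ) * ∑ i, transportSymbol V i ξ * conj (V i ξ) =
      2 * Real.pi * Complex.I * ∑ i, ∑ j, freqConv (V j) (V i) ξ *
        conj (mulCoord j (fun ξ => (m ξ : ℂ) * V i ξ) ξ) := by
    intro ξ
    simp only [transportSymbol, Finset.mul_sum, Finset.sum_mul, mulCoord, map_mul,
      Complex.conj_ofReal]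
    refine Finset.sum_congr rfl fun i _ => Finset.sum_congr rfl fun j _ => ?_
    ring
  have hi := integrable_mul_trilinear_of_compactSupport hs hV hm hc
  simp_rw [hpt]
  rw [integral_const_mul, integral_finsetSum _ fun i _ => integrable_finsetSum _ fun j _ => hint i j]
  congr 1
  simp only [advectionDensity, Finset.mul_sum]
  rw [integral_finsetSum _ fun i _ => integrable_finsetSum _ fun j _ => hi i j]
  refine Finset.sum_congr rfl fun i _ => ?_
  rw [integral_finsetSum _ fun j _ => hint i j, integral_finsetSum _ fun j _ => hi i j]
  refine Finset.sum_congr rfl fun j _ => ?_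
  rw [← trilinear_eq_integral_freqConv (hV.measurable j) (hV.measurable i) (hb i j).measurable
    (hV.integrable hs j) (h2 i) (hb i j).memLp]
  unfold trilinear
  refine integral_congr_ae (Eventually.of_forall fun p => ?_)
  simp only [mulCoord, map_mul, Complex.conj_ofReal]
  ring

/-- Averaging the integral with its reflected copy halves the factor 2πi and produces the difference
of the multipliers. Compact support of m keeps both halves integrable separately. -/
lemma integral_mul_transportSymbol_eq_commutator (hs : 1 / 2 < s) (hV : HasFiniteEnergy s V)
    (hS : IsSolenoidal V) {m : R3 → ℝ} (hm : Continuous m) (hc : HasCompactSupport m)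
    (heven : ∀ ξ, m (-ξ) = m ξ) :
    ∫ ξ, (m ξ : ℂ) * ∑ i, transportSymbol V i ξ * conj (V i ξ) =
      Real.pi * Complex.I *
        ∫ p : R3 × R3, ((m (p.1 + p.2) - m p.2 : ℝ) : ℂ) * advectionDensity V p := by
  rw [integral_mul_transportSymbol hs hV hm hc]
  have h1 := integrable_mul_advectionDensity_of_compactSupport hs hV hm hc
  have h2 : Integrable fun p : R3 × R3 => (m p.2 : ℂ) * advectionDensity V p := by
    have h := (measurePreserving_reflect.integrable_comp_emb
      reflect.measurableEmbedding).2 h1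
    refine h.neg.congr (Eventually.of_forall fun p => ?_)
    simp only [Pi.neg_apply, Function.comp_apply]
    rw [fst_add_snd_reflect, hS.advectionDensity_reflect, heven]
    ring
  have h3 := hS.integral_swap (k := fun ξ _ => (m ξ : ℂ)) fun ξ _ => by rw [heven]
  have h4 : ∫ p : R3 × R3, ((m (p.1 + p.2) - m p.2 : ℝ) : ℂ) * advectionDensity V p =
      (∫ p : R3 × R3, (m (p.1 + p.2) : ℂ) * advectionDensity V p) -
        ∫ p : R3 × R3, (m p.2 : ℂ) * advectionDensity V p := by
    rw [← integral_sub h1 h2]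
    refine integral_congr_ae (Eventually.of_forall fun p => ?_)
    simp only [Complex.ofReal_sub]
    ring
  rw [h4, h3]
  ring

lemma IsCutoff.tendsto_comp_div {χ : ℝ → ℝ} (hχ : IsCutoff χ) (x : ℝ) :
    ∀ᶠ R : ℝ in atTop, χ (x / R) = 1 :=
  (tendsto_const_nhds.div_atTop tendsto_id).eventually hχ.2.2

lemma IsCutoff.hasCompactSupport_radial {χ : ℝ → ℝ} (hχ : IsCutoff χ) {R : ℝ} (hR : 0 < R)
    (w : R3 → ℝ) : HasCompactSupport fun ξ : R3 => χ (‖ξ‖ / R) * w ξ := by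
  obtain ⟨T, hT⟩ := hχ.2.1.isCompact.isBounded.subset_closedBall (0 : ℝ)
  refine HasCompactSupport.intro (isCompact_closedBall (0 : R3) (T * R)) fun ξ hξ => ?_
  rw [mem_closedBall_zero_iff, not_le] at hξ
  have : χ (‖ξ‖ / R) = 0 := by
    by_contra h
    have h1 := hT (subset_tsupport χ h)
    rw [mem_closedBall_zero_iff, Real.norm_of_nonneg (by positivity), div_le_iff₀ hR] at h1
    linarith
  rw [this, zero_mul]

/-- The truncated pairings converge to the commutator integral. -/
lemma tendsto_integral_transportSymbol (hs : 1 / 2 < s) (hV : HasFiniteEnergy s V)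
    (hS : IsSolenoidal V) {χ : ℝ → ℝ} (hχ : IsCutoff χ) :
    Tendsto (fun R : ℝ => ∫ ξ : R3, ((χ (‖ξ‖ / R) * sobolevWeight s ξ : ℝ) : ℂ) *
        ∑ i, transportSymbol V i ξ * conj (V i ξ)) atTop
      (𝓝 (Real.pi * Complex.I * commutator s V)) := by
  obtain ⟨C, hC, hμ⟩ := exists_isRadialMultiplier_cutoff (by linarith : 0 ≤ s) hχ
  have hcont : ∀ R, Continuous fun ξ : R3 => χ (‖ξ‖ / R) * sobolevWeight s ξ := fun R =>
    (hχ.1.continuous.comp (continuous_norm.div_const R)).mul (continuous_sobolevWeight s)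
  have hmain : Tendsto (fun R : ℝ => ∫ p : R3 × R3, ((χ (‖p.1 + p.2‖ / R) *
      sobolevWeight s (p.1 + p.2) - χ (‖p.2‖ / R) * sobolevWeight s p.2 : ℝ) : ℂ) *
        advectionDensity V p) atTop (𝓝 (commutator s V)) := by
    refine tendsto_integral_filter_of_dominated_convergence
      (fun p => C * (8 * 4 ^ (s / 2) * dominator s V p)) ?_ ?_
      (((hV.integrable_dominator hs).const_mul _).const_mul _) ?_
    · refine Eventually.of_forall fun R => ?_
      have h1 : Continuous fun p : R3 × R3 => ((χ (‖p.1 + p.2‖ / R) *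
          sobolevWeight s (p.1 + p.2) - χ (‖p.2‖ / R) * sobolevWeight s p.2 : ℝ) : ℂ) :=
        Complex.continuous_ofReal.comp (((hcont R).comp continuous_add).sub
          ((hcont R).comp continuous_snd))
      exact (h1.measurable.mul (measurable_advectionDensity hV.measurable)).aestronglyMeasurable
    · filter_upwards [eventually_gt_atTop 0] with R hR
      refine Eventually.of_forall fun p => ?_
      rw [norm_mul, Complex.norm_real]
      exact (hμ R hR).norm_sub_mul_advectionDensity_le (by linarith) hC hS p
    · refine Eventually.of_forall fun p => ?_
      refine tendsto_const_nhds.congr' ?_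
      filter_upwards [hχ.tendsto_comp_div ‖p.1 + p.2‖, hχ.tendsto_comp_div ‖p.2‖] with R h1 h2
      rw [h1, h2, one_mul, one_mul]
  refine (hmain.const_mul (Real.pi * Complex.I)).congr' ?_
  filter_upwards [eventually_gt_atTop 0] with R hR
  exact (integral_mul_transportSymbol_eq_commutator hs hV hS (hcont R)
    (hχ.hasCompactSupport_radial hR _) fun ξ => by rw [norm_neg, sobolevWeight_neg]).symm

/-! ### Passing to the limit in the commutator estimate -/

/-- The field truncated to the frequencies of size about `2 ^ n`. -/
noncomputable def truncate (n : ℕ) (V : Fin 3 → R3 → ℂ) (i : Fin 3) (ξ : R3) : ℂ :=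
  (lowPass n ξ : ℂ) * V i ξ

lemma IsSolenoidal.truncate (hS : IsSolenoidal V) (n : ℕ) : IsSolenoidal (truncate n V) where
  div_eq_zero ξ := by
    have : ∀ j, (ξ j : ℂ) * AnisotropicFluid.truncate n V j ξ = lowPass n ξ * ((ξ j : ℂ) * V j ξ) :=
      fun j => by
        simp only [AnisotropicFluid.truncate]
        ring
    simp only [this, ← Finset.mul_sum, hS.div_eq_zero, mul_zero]
  map_neg i ξ := by
    simp only [AnisotropicFluid.truncate, lowPass_neg, hS.map_neg, map_mul, Complex.conj_ofReal]

lemma advectionDensity_truncate (n : ℕ) (p : R3 × R3) :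
    advectionDensity (truncate n V) p =
      ((lowPass n p.1 * lowPass n p.2 * lowPass n (p.1 + p.2) : ℝ) : ℂ) * advectionDensity V p := by
  simp only [advectionDensity, Finset.mul_sum]
  refine Finset.sum_congr rfl fun i _ => Finset.sum_congr rfl fun j _ => ?_
  simp only [truncate, mulCoord, map_mul, Complex.conj_ofReal, Complex.ofReal_mul]
  ring

lemma eventually_lowPass_eq_one (ξ : R3) : ∀ᶠ n : ℕ in atTop, lowPass n ξ = 1 := by
  filter_upwards [(tendsto_pow_atTop_atTop_of_one_lt (one_lt_two (α := ℝ))).eventually_ge_atTop ‖ξ‖]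
    with n hn
  exact lowPass_eq_one hn

/-- The filters only multiply the density by a number between 0 and 1, so the majorant for the
untruncated weight dominates all truncations. -/
lemma tendsto_commutator_truncate (hs : 1 / 2 < s) (hV : HasFiniteEnergy s V)
    (hS : IsSolenoidal V) :
    Tendsto (fun n => commutator s (truncate n V)) atTop (𝓝 (commutator s V)) := by
  have hs0 : 0 ≤ s := by linarith
  have hw := continuous_sobolevWeight s
  refine tendsto_integral_of_dominated_convergence
      (fun p => (1 + 2 * s) * (8 * 4 ^ (s / 2) * dominator s V p)) ?_
      (((hV.integrable_dominator hs).const_mul _).const_mul _) ?_ ?_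
  · intro n
    have h1 : Continuous fun p : R3 × R3 =>
        ((sobolevWeight s (p.1 + p.2) - sobolevWeight s p.2 : ℝ) : ℂ) :=
      Complex.continuous_ofReal.comp ((hw.comp continuous_add).sub (hw.comp continuous_snd))
    refine (h1.measurable.mul (measurable_advectionDensity fun i => ?_)).aestronglyMeasurable
    exact (Complex.continuous_ofReal.comp (continuous_lowPass n)).measurable.mul (hV.measurable i)
  · intro n
    refine Eventually.of_forall fun p => ?_
    have h1 := (isRadialMultiplier_radialWeight hs0).norm_sub_mul_advectionDensity_le hs0
      (by positivity) hS p
    refine le_trans ?_ h1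
    rw [advectionDensity_truncate, norm_mul, norm_mul, Complex.norm_real, Complex.norm_real]
    refine mul_le_mul_of_nonneg_left (mul_le_of_le_one_left (norm_nonneg _) ?_) (norm_nonneg _)
    have a1 := lowPass_nonneg n p.1
    have a2 := lowPass_nonneg n p.2
    have a3 := lowPass_nonneg n (p.1 + p.2)
    rw [Real.norm_of_nonneg (by positivity)]
    exact mul_le_one₀ (mul_le_one₀ (lowPass_le_one _ _) a2 (lowPass_le_one _ _)) a3
      (lowPass_le_one _ _)
  · refine Eventually.of_forall fun p => ?_
    refine tendsto_const_nhds.congr' ?_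
    filter_upwards [eventually_lowPass_eq_one p.1, eventually_lowPass_eq_one p.2,
      eventually_lowPass_eq_one (p.1 + p.2)] with n h1 h2 h3
    rw [advectionDensity_truncate, h1, h2, h3]
    simp

lemma sobolevEnergy_mono {f g : R3 → ℂ} (h : ∀ ξ, ‖f ξ‖ₑ ≤ ‖g ξ‖ₑ) :
    sobolevEnergy s f ≤ sobolevEnergy s g :=
  lintegral_mono fun ξ => by
    have := h ξ
    gcongr

lemma enorm_truncate_le (n : ℕ) (i : Fin 3) (ξ : R3) : ‖truncate n V i ξ‖ₑ ≤ ‖V i ξ‖ₑ := by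
  rw [truncate, enorm_mul]
  refine mul_le_of_le_one_left' ?_
  rw [← ofReal_norm, Complex.norm_real, Real.norm_of_nonneg (lowPass_nonneg _ _)]
  exact ENNReal.ofReal_le_one.2 (lowPass_le_one _ _)

lemma fieldEnergy_truncate_le (n : ℕ) : fieldEnergy s (truncate n V) ≤ fieldEnergy s V :=
  Finset.sum_le_sum fun i _ => sobolevEnergy_mono (enorm_truncate_le n i)

lemma fieldHorizontalEnergy_truncate_le (n : ℕ) :
    fieldHorizontalEnergy s (truncate n V) ≤ fieldHorizontalEnergy s V := by
  have h : ∀ j i ξ, ‖mulCoord j (truncate n V i) ξ‖ₑ ≤ ‖mulCoord j (V i) ξ‖ₑ := fun j i ξ => by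
    simp only [mulCoord, enorm_mul]
    gcongr
    exact enorm_truncate_le n i ξ
  exact Finset.sum_le_sum fun i _ => add_le_add (sobolevEnergy_mono (h 0 i))
    (sobolevEnergy_mono (h 1 i))

end Truncation

/-- The commutator estimate, for fields of finite anisotropic energy. -/
theorem exists_enorm_commutator_le_of_hasFiniteEnergy {s : ℝ} (hs : 1 / 2 < s) :
    ∃ K : ℝ≥0∞, K ≠ ⊤ ∧ ∀ V : Fin 3 → R3 → ℂ, HasFiniteEnergy s V → IsSolenoidal V →
      ∀ A₀ A₁ : ℝ≥0∞, (∀ n i, verticalSup (𝓕⁻ (truncate n V i)) ≤ A₀) →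
      (∀ n i j, j ≠ 2 → verticalSup (𝓕⁻ (mulCoord j (truncate n V i))) ≤ A₁) →
      ‖commutator s V‖ₑ ≤
        K * commutatorBound A₀ A₁ (fieldEnergy s V) (fieldHorizontalEnergy s V) := by
  obtain ⟨K, hK, h⟩ := exists_enorm_commutator_le (by linarith : 0 < s)
  refine ⟨K, hK, fun V hV hS A₀ A₁ hA₀ hA₁ => ?_⟩
  refine le_of_tendsto (continuous_enorm.tendsto _ |>.comp (tendsto_commutator_truncate hs hV hS))
    (Eventually.of_forall fun n => ?_)
  -- The filter n lives on |ξ| ≤ 2^(n+1), where it is the filter n + 1 that equals 1.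
  refine (h (truncate n V) (n + 1) (fun i => isBandLimited_lowPass_mul (hV.measurable i)
    (hV.memLp (by linarith) i) n) (hS.truncate n) (fun i ξ hξ => ?_) A₀ A₁ (hA₀ n) (hA₁ n)).trans ?_
  · refine lowPass_eq_one (le_of_not_gt fun h' => hξ ?_)
    rw [truncate, lowPass_eq_zero h'.le]
    simp
  · have e0 := fieldEnergy_truncate_le (s := s) (V := V) n
    have e1 := fieldHorizontalEnergy_truncate_le (s := s) (V := V) n
    unfold commutatorBound
    gcongr

/-! ### From tempered distributions to the frequency side -/

/-- The Fourier transform of a real square-integrable function. -/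
noncomputable def freqSide (u : L2) : R3 → ℂ :=
  ((𝓕 (complexify u) : Lp ℂ 2 (volume : Measure R3)) : R3 → ℂ)

lemma measurable_freqSide (u : L2) : Measurable (freqSide u) := (Lp.stronglyMeasurable _).measurable

lemma memLp_freqSide (u : L2) : MemLp (freqSide u) 2 := Lp.memLp _

/-- Multiplication of a test function by a coordinate. -/
noncomputable def coordMul (j : Fin 3) (φ : 𝓢(R3, ℂ)) : 𝓢(R3, ℂ) :=
  SchwartzMap.smulLeftCLM ℂ
    (fun ξ : R3 => ((inner ℝ ξ (EuclideanSpace.single j (1 : ℝ) : R3) : ℝ) : ℂ)) φ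

lemma coordMul_apply (j : Fin 3) (φ : 𝓢(R3, ℂ)) (ξ : R3) : coordMul j φ ξ = (ξ j : ℂ) * φ ξ := by
  have h : (fun ξ : R3 =>
      ((inner ℝ ξ (EuclideanSpace.single j (1 : ℝ) : R3) : ℝ) : ℂ)).HasTemperateGrowth := by fun_prop
  rw [coordMul, SchwartzMap.smulLeftCLM_apply_apply h]
  simp [EuclideanSpace.inner_single_right]

lemma fourier_partialDeriv_apply (j : Fin 3) (T : 𝓢'(R3, ℂ)) (φ : 𝓢(R3, ℂ)) :
    (𝓕 (partialDeriv j T)) φ = 2 * Real.pi * Complex.I * (𝓕 T) (coordMul j φ) := by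
  rw [partialDeriv, TemperedDistribution.fourier_lineDerivOp_eq]
  rfl

lemma fourier_toDistribution_apply (u : L2) (φ : 𝓢(R3, ℂ)) :
    (𝓕 (toDistribution u)) φ = ∫ ξ, φ ξ * freqSide u ξ := by
  rw [toDistribution, Lp.fourier_toTemperedDistribution_eq, Lp.toTemperedDistribution_apply]
  rfl

lemma integrable_schwartz_mul {f : R3 → ℂ} (hf : MemLp f 2) (φ : 𝓢(R3, ℂ)) :
    Integrable fun ξ => φ ξ * f ξ :=
  (φ.memLp 2 volume).integrable_mul hf

lemma locallyIntegrable_coord_mul {f : R3 → ℂ} (hf : MemLp f 2) (j : Fin 3) :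
    LocallyIntegrable fun ξ : R3 => (ξ j : ℂ) * f ξ := by
  have h := (hf.locallyIntegrable (by norm_num)).locallyIntegrableOn Set.univ
  have hc : ContinuousOn (fun ξ : R3 => (ξ j : ℂ)) Set.univ := by fun_prop
  exact locallyIntegrableOn_univ.1 (h.continuousOn_mul hc isOpen_univ.isLocallyClosed)

lemma HasFourierTransform.of_ae {u : L2} {F : R3 → ℂ} (h : F =ᵐ[volume] freqSide u) :
    HasFourierTransform (toDistribution u) F := by
  have hF : MemLp F 2 := (memLp_congr_ae h).2 (memLp_freqSide u)
  refine ⟨hF.locallyIntegrable (by norm_num), fun φ => ⟨integrable_schwartz_mul hF φ, ?_⟩⟩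
  rw [fourier_toDistribution_apply]
  refine integral_congr_ae ?_
  filter_upwards [h] with ξ hξ
  rw [hξ]

/-- On the Fourier side each derivative moves a coordinate onto the test function; cancelling 2πi
leaves a locally integrable function orthogonal to all test functions. -/
lemma IsDivFree.ae_eq_zero {u : Fin 3 → L2} (hu : IsDivFree u) :
    ∀ᵐ ξ : R3, ∑ j, (ξ j : ℂ) * freqSide (u j) ξ = 0 := by
  refine ae_eq_of_forall_schwartz (F := fun ξ : R3 => ∑ j, (ξ j : ℂ) * freqSide (u j) ξ)
    (G := fun _ => 0) ?_ ?_ fun φ => ?_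
  · have := locallyIntegrable_finsetSum (μ := volume) Finset.univ
      (f := fun (j : Fin 3) (ξ : R3) => (ξ j : ℂ) * freqSide (u j) ξ)
      fun j _ => locallyIntegrable_coord_mul (memLp_freqSide (u j)) j
    simpa using this
  · exact locallyIntegrable_zero
  · have h1 : (𝓕 (∑ j, partialDeriv j (toDistribution (u j)))) φ =
        2 * Real.pi * Complex.I * ∑ j, ∫ ξ : R3, φ ξ * ((ξ j : ℂ) * freqSide (u j) ξ) := by
      have e : (𝓕 (∑ j, partialDeriv j (toDistribution (u j)))) φ =
          ∑ j, (𝓕 (partialDeriv j (toDistribution (u j)))) φ := by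
        simp only [TemperedDistribution.fourier_apply]
        simp
      rw [e, Finset.mul_sum]
      refine Finset.sum_congr rfl fun j _ => ?_
      rw [fourier_partialDeriv_apply, fourier_toDistribution_apply]
      congr 1
      refine integral_congr_ae (Eventually.of_forall fun ξ => ?_)
      simp only [coordMul_apply]
      ring
    rw [hu] at h1
    have h2 : (𝓕 (0 : 𝓢'(R3, ℂ))) φ = 0 := by
      rw [TemperedDistribution.fourier_apply]
      rfl
    rw [h2] at h1
    have h3 : ∑ j, ∫ ξ : R3, φ ξ * ((ξ j : ℂ) * freqSide (u j) ξ) = 0 :=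
      (mul_eq_zero.1 h1.symm).resolve_left (by simp [Real.pi_ne_zero])
    rw [← integral_finsetSum] at h3
    · simpa [Finset.mul_sum] using h3
    · intro j _
      refine (integrable_schwartz_mul (memLp_freqSide (u j)) (coordMul j φ)).congr
        (Eventually.of_forall fun ξ => ?_)
      simp only [coordMul_apply]
      ring

lemma freqSide_ae_eq_of_partialDeriv {u g : L2} {j : Fin 3}
    (h : partialDeriv j (toDistribution u) = toDistribution g) :
    (fun ξ => 2 * Real.pi * Complex.I * mulCoord j (freqSide u) ξ) =ᵐ[volume] freqSide g := by
  refine ae_eq_of_forall_schwartz ?_ ((memLp_freqSide g).locallyIntegrable (by norm_num)) fun φ => ?_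
  · exact (locallyIntegrable_coord_mul (memLp_freqSide u) j).smul (2 * Real.pi * Complex.I)
  · have h1 := congrArg (fun T : 𝓢'(R3, ℂ) => (𝓕 T) φ) h
    rw [fourier_partialDeriv_apply, fourier_toDistribution_apply, fourier_toDistribution_apply] at h1
    rw [← h1, ← integral_const_mul]
    refine integral_congr_ae (Eventually.of_forall fun ξ => ?_)
    simp only [coordMul_apply, mulCoord]
    ring

lemma complexify_ae (u : L2) : (complexify u : R3 → ℂ) =ᵐ[volume] fun x => (u x : ℂ) :=
  Complex.ofRealCLM.coeFn_compLp u

lemma fourierInv_freqSide_ae {u : L2} (h : Integrable (freqSide u)) :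
    𝓕⁻ (freqSide u) =ᵐ[volume] fun x => (u x : ℂ) := by
  have h1 := fourierInv_toLp_ae h (memLp_freqSide u)
  have h2 : (memLp_freqSide u).toLp = (𝓕 (complexify u) : Lp ℂ 2 (volume : Measure R3)) :=
    Lp.toLp_coeFn _ _
  rw [h2, FourierTransform.fourierInv_fourier_eq] at h1
  exact h1.symm.trans (complexify_ae u)

lemma fourierInv_conj_comp_neg (f : R3 → ℂ) (x : R3) :
    𝓕⁻ (fun ξ => conj (f (-ξ))) x = conj (𝓕⁻ f x) := by
  rw [Real.fourierInv_eq, Real.fourierInv_eq, ← integral_conj, ← integral_neg_eq_self]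
  refine integral_congr_ae (Eventually.of_forall fun ξ => ?_)
  simp only [Circle.smul_def, smul_eq_mul, map_mul, neg_neg, inner_neg_left]
  congr 1
  rw [← Circle.coe_inv_eq_conj, ← AddChar.map_neg_eq_inv]

/-- The reflected conjugate profile has inverse transform conj u = u, and the transform is injective
on L². -/
lemma freqSide_neg_ae {u : L2} (h : Integrable (freqSide u)) :
    ∀ᵐ ξ, freqSide u (-ξ) = conj (freqSide u ξ) := by
  have hk1 : Integrable fun ξ => conj (freqSide u (-ξ)) :=
    Complex.conjCLE.toContinuousLinearMap.integrable_comp h.comp_neg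
  have hk2 : MemLp (fun ξ => conj (freqSide u (-ξ))) 2 := by
    have h1 : MemLp (fun ξ => freqSide u (-ξ)) 2 :=
      (memLp_freqSide u).comp_measurePreserving (Measure.measurePreserving_neg volume)
    exact Complex.conjCLE.toContinuousLinearMap.comp_memLp' h1
  have h1 : ((𝓕⁻ hk2.toLp : Lp ℂ 2 (volume : Measure R3)) : R3 → ℂ) =ᵐ[volume]
      ((𝓕⁻ (memLp_freqSide u).toLp : Lp ℂ 2 (volume : Measure R3)) : R3 → ℂ) := by
    filter_upwards [fourierInv_toLp_ae hk1 hk2, fourierInv_toLp_ae h (memLp_freqSide u),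
      fourierInv_freqSide_ae h] with x h1 h2 h3
    rw [h1, h2, fourierInv_conj_comp_neg, h3, Complex.conj_ofReal]
  have h2 : hk2.toLp = (memLp_freqSide u).toLp := by
    have := congrArg (fun v : Lp ℂ 2 (volume : Measure R3) => 𝓕 v) (Lp.ext h1)
    simpa only [FourierTransform.fourier_fourierInv_eq] using this
  filter_upwards [(MemLp.toLp_eq_toLp_iff hk2 (memLp_freqSide u)).1 h2] with ξ hξ
  rw [← hξ, Complex.conj_conj]

/-- A solenoidal field, up to a null set, is almost everywhere equal to one that is solenoidal
everywhere. -/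
lemma exists_isSolenoidal_ae_eq {W : Fin 3 → R3 → ℂ} (hW : ∀ i, Measurable (W i))
    (hdiv : ∀ᵐ ξ : R3, ∑ j, (ξ j : ℂ) * W j ξ = 0)
    (hneg : ∀ i, ∀ᵐ ξ, W i (-ξ) = conj (W i ξ)) :
    ∃ V : Fin 3 → R3 → ℂ, (∀ i, Measurable (V i)) ∧ IsSolenoidal V ∧ ∀ i, V i =ᵐ[volume] W i := by
  classical
  let G : Set R3 := {ξ | ∑ j, (ξ j : ℂ) * W j ξ = 0} ∩ ⋂ i, {ξ | W i (-ξ) = conj (W i ξ)}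
  have hGm : MeasurableSet G := by
    refine MeasurableSet.inter (measurableSet_eq_fun ?_ measurable_const)
      (MeasurableSet.iInter fun i => measurableSet_eq_fun ((hW i).comp measurable_neg)
        (Complex.continuous_conj.measurable.comp (hW i)))
    exact Finset.measurable_sum _ fun j _ => by
      have : Measurable fun ξ : R3 => (ξ j : ℂ) := by fun_prop
      exact this.mul (hW j)
  have hGae : ∀ᵐ ξ, ξ ∈ G := by
    filter_upwards [hdiv, ae_all_iff.2 hneg] with ξ h1 h2
    exact ⟨h1, Set.mem_iInter.2 h2⟩
  -- The good set is symmetric, so setting the field to zero outside it preserves the reality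
  -- condition at every point.
  have hGneg : ∀ ξ, ξ ∈ G → -ξ ∈ G := by
    rintro ξ ⟨h1, h2⟩
    have h2' : ∀ i, W i (-ξ) = conj (W i ξ) := Set.mem_iInter.1 h2
    refine ⟨?_, Set.mem_iInter.2 fun i => ?_⟩
    · have h3 := congrArg conj h1
      simp only [map_sum, map_mul, Complex.conj_ofReal, map_zero] at h3
      simp only [Set.mem_ofPred_eq, PiLp.neg_apply, Complex.ofReal_neg, neg_mul, h2',
        Finset.sum_neg_distrib, h3, neg_zero]
    · simp only [Set.mem_ofPred_eq, neg_neg, h2', Complex.conj_conj]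
  refine ⟨fun i ξ => if ξ ∈ G then W i ξ else 0, fun i => Measurable.ite hGm (hW i) measurable_const,
    ⟨fun ξ => ?_, fun i ξ => ?_⟩, fun i => ?_⟩
  · by_cases h : ξ ∈ G
    · simp only [if_pos h]
      exact h.1
    · simp [if_neg h]
  · by_cases h : ξ ∈ G
    · simp only [if_pos h, if_pos (hGneg ξ h)]
      exact Set.mem_iInter.1 h.2 i
    · have h' : -ξ ∉ G := fun h' => h (by simpa using hGneg _ h')
      simp [if_neg h, if_neg h']
  · filter_upwards [hGae] with ξ h
    simp [if_pos h]

/-! ### The Fourier transform of the advection term -/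

lemma freqConv_congr_ae {f f' g g' : R3 → ℂ} (hf : f =ᵐ[volume] f') (hg : g =ᵐ[volume] g') :
    freqConv f g = freqConv f' g' := by
  funext ξ
  have h2 : ∀ᵐ η, g (ξ - η) = g' (ξ - η) :=
    (Measure.measurePreserving_sub_left volume ξ).quasiMeasurePreserving.ae hg
  refine integral_congr_ae ?_
  filter_upwards [hf, h2] with η h1 h2
  rw [h1, h2]

/-- Integrable profiles allow Fourier inversion for both factors, so the convolution theorem
describes their product in L¹. -/
lemma smul_complexify_ae {u v : L2} (hu : Integrable (freqSide u)) (hv : Integrable (freqSide v)) :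
    ((complexify u • complexify v : Lp ℂ 1 (volume : Measure R3)) : R3 → ℂ) =ᵐ[volume]
      𝓕⁻ (freqConv (freqSide u) (freqSide v)) := by
  filter_upwards [Lp.coeFn_lpSMul (r := 1) (complexify u) (complexify v), complexify_ae u,
    complexify_ae v, fourierInv_freqSide_ae hu, fourierInv_freqSide_ae hv] with x h1 h2 h3 h4 h5
  rw [h1, fourierInv_freqConv hu hv, h4, h5, Pi.smul_apply', h2, h3, smul_eq_mul]

lemma fourier_partialDeriv_product_apply {u v : L2} (hu : Integrable (freqSide u))
    (hv : Integrable (freqSide v)) (j : Fin 3) (φ : 𝓢(R3, ℂ)) :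
    (𝓕 (partialDeriv j (((complexify u • complexify v : Lp ℂ 1 (volume : Measure R3))) :
      𝓢'(R3, ℂ)))) φ =
      ∫ ξ : R3, φ ξ * (2 * Real.pi * Complex.I * (ξ j : ℂ) *
        freqConv (freqSide u) (freqSide v) ξ) := by
  have hp := integrable_freqConv hu hv
  rw [fourier_partialDeriv_apply, TemperedDistribution.fourier_apply,
    Lp.toTemperedDistribution_apply, ← integral_const_mul]
  set ψ := coordMul j φ
  have h1 : ∫ x, (𝓕 ψ) x • (complexify u • complexify v : Lp ℂ 1 (volume : Measure R3)) x =
      ∫ ξ, freqConv (freqSide u) (freqSide v) ξ * ψ ξ := by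
    have h2 := integral_fourierInv_mul hp (𝓕 ψ : 𝓢(R3, ℂ)).integrable
    have h3 : 𝓕⁻ ((𝓕 ψ : 𝓢(R3, ℂ)) : R3 → ℂ) = ψ := by
      rw [← SchwartzMap.fourierInv_coe, FourierTransform.fourierInv_fourier_eq]
    rw [h3] at h2
    rw [← h2]
    refine integral_congr_ae ?_
    filter_upwards [smul_complexify_ae hu hv] with x hx
    rw [hx, smul_eq_mul, mul_comm]
  rw [integral_const_mul, h1, ← integral_const_mul]
  refine integral_congr_ae (Eventually.of_forall fun ξ => ?_)
  simp only [ψ, coordMul_apply]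
  ring

/-- The convolutions are integrable, and the unbounded coordinate is absorbed by the Schwartz
function. The field V may differ from the profiles on a null set, which convolutions do not see. -/
lemma hasFourierTransform_advection {u : Fin 3 → L2} (hu : ∀ i, Integrable (freqSide (u i)))
    {V : Fin 3 → R3 → ℂ} (hV : ∀ i, V i =ᵐ[volume] freqSide (u i)) (i : Fin 3) :
    HasFourierTransform (advection u i) (transportSymbol V i) := by
  have hVi : ∀ i, Integrable (V i) := fun i => (hu i).congr (hV i).symm
  have hconv : ∀ j, freqConv (V j) (V i) = freqConv (freqSide (u j)) (freqSide (u i)) := fun j =>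
    freqConv_congr_ae (hV j) (hV i)
  have hp : ∀ j, Integrable (freqConv (V j) (V i)) := fun j => integrable_freqConv (hVi j) (hVi i)
  have hint : ∀ (φ : 𝓢(R3, ℂ)) (j : Fin 3), Integrable fun ξ : R3 =>
      φ ξ * (2 * Real.pi * Complex.I * (ξ j : ℂ) * freqConv (V j) (V i) ξ) := by
    intro φ j
    have hC := (coordMul j φ).toBoundedContinuousFunction.norm_coe_le_norm
    have h1 := ((hp j).bdd_mul (coordMul j φ).continuous.aestronglyMeasurable
      (Eventually.of_forall hC)).const_mul (2 * Real.pi * Complex.I)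
    refine h1.congr (Eventually.of_forall fun ξ => ?_)
    simp only [coordMul_apply]
    ring
  refine ⟨?_, fun φ => ?_⟩
  · refine (locallyIntegrable_finsetSum (μ := volume) Finset.univ
      (f := fun (j : Fin 3) (ξ : R3) => 2 * Real.pi * Complex.I * (ξ j : ℂ) *
        freqConv (V j) (V i) ξ) fun j _ => ?_).congr (Eventually.of_forall fun ξ => ?_)
    · have hc : ContinuousOn (fun ξ : R3 => 2 * Real.pi * Complex.I * (ξ j : ℂ)) Set.univ := by
        fun_prop
      exact locallyIntegrableOn_univ.1 (((hp j).locallyIntegrable.locallyIntegrableOn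
        Set.univ).continuousOn_mul hc isOpen_univ.isLocallyClosed)
    · simp [transportSymbol]
  · have e : ∀ ξ, φ ξ * transportSymbol V i ξ =
        ∑ j, φ ξ * (2 * Real.pi * Complex.I * (ξ j : ℂ) * freqConv (V j) (V i) ξ) := fun ξ => by
      rw [transportSymbol, Finset.mul_sum]
    refine ⟨?_, ?_⟩
    · simp_rw [e]
      exact integrable_finsetSum _ fun j _ => hint φ j
    · simp_rw [e]
      rw [integral_finsetSum _ fun j _ => hint φ j]
      have h1 : (𝓕 (advection u i)) φ = ∑ j, (𝓕 (partialDeriv j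
          (((complexify (u j) • complexify (u i) : Lp ℂ 1 (volume : Measure R3))) :
            𝓢'(R3, ℂ)))) φ := by
        simp only [TemperedDistribution.fourier_apply, advection]
        simp
      rw [h1]
      refine Finset.sum_congr rfl fun j _ => ?_
      rw [fourier_partialDeriv_product_apply (hu j) (hu i), hconv]

lemma locallyIntegrable_transportSymbol_mul_conj {V : Fin 3 → R3 → ℂ}
    (hV : ∀ i, Measurable (V i)) (hV1 : ∀ i, Integrable (V i)) (hV2 : ∀ i, MemLp (V i) 2)
    (i : Fin 3) : LocallyIntegrable fun ξ => transportSymbol V i ξ * conj (V i ξ) := by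
  have h : ∀ j, Integrable fun ξ => freqConv (V j) (V i) ξ * conj (V i ξ) := by
    intro j
    obtain ⟨C, hC⟩ := exists_norm_freqConv_le (hV j) (hV i) (hV2 j) (hV2 i)
    have hconj : Integrable fun ξ => conj (V i ξ) :=
      Complex.conjCLE.toContinuousLinearMap.integrable_comp (hV1 i)
    exact hconj.bdd_mul (integrable_freqConv (hV1 j) (hV1 i)).1 (Eventually.of_forall hC)
  refine (locallyIntegrable_finsetSum (μ := volume) Finset.univ
    (f := fun (j : Fin 3) (ξ : R3) => 2 * Real.pi * Complex.I * (ξ j : ℂ) *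
      (freqConv (V j) (V i) ξ * conj (V i ξ))) fun j _ => ?_).congr (Eventually.of_forall fun ξ => ?_)
  · have hc : ContinuousOn (fun ξ : R3 => 2 * Real.pi * Complex.I * (ξ j : ℂ)) Set.univ := by
      fun_prop
    exact locallyIntegrableOn_univ.1 (((h j).locallyIntegrable.locallyIntegrableOn
      Set.univ).continuousOn_mul hc isOpen_univ.isLocallyClosed)
  · simp only [transportSymbol, Finset.sum_mul]
    exact Finset.sum_congr rfl fun j _ => by ring

/-! ### Comparison of norms -/

lemma verticalSup_complexify_le {ι : Type} [Fintype ι] (u : ι → L2) (i : ι) :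
    verticalSup (complexify (u i)) ≤ mixedNorm ⊤ 2 u := by
  rw [verticalSup_congr_ae (complexify_ae (u i))]
  refine eLpNorm_mono_enorm fun z => ?_
  simp only [enorm_eq_self]
  refine eLpNorm_mono fun y => ?_
  rw [Complex.norm_real]
  exact PiLp.norm_apply_le (WithLp.toLp 2 fun i => u i (joinPoint y z)) i

lemma sobolevEnergy_congr_ae {s : ℝ} {f g : R3 → ℂ} (h : f =ᵐ[volume] g) :
    sobolevEnergy s f = sobolevEnergy s g := by
  refine lintegral_congr_ae ?_
  filter_upwards [h] with ξ hξ
  rw [hξ]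

lemma sum_sobolevEnergy_freqSide {ι : Type} [Fintype ι] (s : ℝ) (u : ι → L2) :
    ∑ i, sobolevEnergy s (freqSide (u i)) = sobolevNorm s u ^ 2 := (sqrt_sq _).symm

lemma one_le_enorm_two_pi_I : 1 ≤ ‖(2 * Real.pi * Complex.I : ℂ)‖ₑ := by
  rw [enorm_two_pi_I, ENNReal.one_le_ofReal]
  linarith [Real.pi_gt_three]

lemma mulCoord_congr_ae {f g : R3 → ℂ} (h : f =ᵐ[volume] g) (j : Fin 3) :
    mulCoord j f =ᵐ[volume] mulCoord j g := by
  filter_upwards [h] with ξ hξ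
  rw [mulCoord, mulCoord, hξ]

lemma sobolevEnergy_mulCoord_le_of_partialDeriv (s : ℝ) {u g : L2} {j : Fin 3}
    (h : partialDeriv j (toDistribution u) = toDistribution g) :
    sobolevEnergy s (mulCoord j (freqSide u)) ≤ sobolevEnergy s (freqSide g) := by
  rw [← sobolevEnergy_congr_ae (freqSide_ae_eq_of_partialDeriv h)]
  refine sobolevEnergy_mono fun ξ => ?_
  rw [enorm_mul]
  -- The energies on the frequency side omit the factor 2π of the derivative; as 2π ≥ 1, omitting it
  -- only decreases them.
  exact le_mul_of_one_le_left' one_le_enorm_two_pi_I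

lemma sum_sobolevHorizontalEnergy_le (s : ℝ) {u : Fin 3 → L2} {g : Fin 2 × Fin 3 → L2}
    (hg : IsHorizontalGradient u g) :
    ∑ i, sobolevHorizontalEnergy s (freqSide (u i)) ≤ sobolevNorm s g ^ 2 := by
  rw [← sum_sobolevEnergy_freqSide, Fintype.sum_prod_type, Fin.sum_univ_two,
    ← Finset.sum_add_distrib]
  exact Finset.sum_le_sum fun i _ => add_le_add
    (sobolevEnergy_mulCoord_le_of_partialDeriv s (hg 0 i))
    (sobolevEnergy_mulCoord_le_of_partialDeriv s (hg 1 i))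

lemma verticalSup_lowPass_freqSide_le {ι : Type} [Fintype ι] (u : ι → L2) (i : ι) (n : ℕ) :
    verticalSup (𝓕⁻ fun ξ => (lowPass n ξ : ℂ) * freqSide (u i) ξ) ≤
      kernelMass * mixedNorm ⊤ 2 u :=
  (verticalSup_lowPass_le n (complexify (u i))).trans
    (mul_le_mul' le_rfl (verticalSup_complexify_le u i))

lemma verticalSup_truncate_le {u : Fin 3 → L2} {V : Fin 3 → R3 → ℂ}
    (hV : ∀ i, V i =ᵐ[volume] freqSide (u i)) (n : ℕ) (i : Fin 3) :
    verticalSup (𝓕⁻ (truncate n V i)) ≤ kernelMass * mixedNorm ⊤ 2 u := by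
  refine le_trans (le_of_eq ?_) (verticalSup_lowPass_freqSide_le u i n)
  rw [fourierInv_congr_ae]
  filter_upwards [hV i] with ξ hξ
  rw [truncate, hξ]

lemma verticalSup_mulCoord_truncate_le {u : Fin 3 → L2} {g : Fin 2 × Fin 3 → L2}
    (hg : IsHorizontalGradient u g) {V : Fin 3 → R3 → ℂ}
    (hV : ∀ i, V i =ᵐ[volume] freqSide (u i)) (n : ℕ) (i j : Fin 3) (hj : j ≠ 2) :
    verticalSup (𝓕⁻ (mulCoord j (truncate n V i))) ≤ kernelMass * mixedNorm ⊤ 2 g := by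
  obtain ⟨k, rfl⟩ : ∃ k : Fin 2, k.castSucc = j := ⟨j.castPred hj, Fin.castSucc_castPred j hj⟩
  refine le_trans ?_ (verticalSup_lowPass_freqSide_le g (k, i) n)
  have h1 : 𝓕⁻ (fun ξ => (lowPass n ξ : ℂ) * freqSide (g (k, i)) ξ) =
      𝓕⁻ fun ξ => 2 * Real.pi * Complex.I * mulCoord k.castSucc (truncate n V i) ξ := by
    refine fourierInv_congr_ae ?_
    filter_upwards [freqSide_ae_eq_of_partialDeriv (hg k i), hV i] with ξ h1 h2
    rw [← h1]
    simp only [mulCoord, truncate, h2]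
    ring
  rw [h1, verticalSup_const_mul]
  exact le_mul_of_one_le_left' one_le_enorm_two_pi_I

/-- Both terms are homogeneous of degree one in the pair of suprema, so the kernel mass comes out
exactly once. -/
lemma commutatorBound_const_mul (k a₀ a₁ x y : ℝ≥0∞) :
    commutatorBound (k * a₀) (k * a₁) (x ^ 2) (y ^ 2) =
      k * (a₀ ^ (1 / 2 : ℝ) * a₁ ^ (1 / 2 : ℝ) * x ^ (1 / 2 : ℝ) * y ^ (3 / 2 : ℝ) +
        a₁ * x * y) := by
  have h1 : (k * a₀ * (k * a₁)) ^ (1 / 2 : ℝ) = k * (a₀ ^ (1 / 2 : ℝ) * a₁ ^ (1 / 2 : ℝ)) := by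
    rw [show k * a₀ * (k * a₁) = k ^ 2 * (a₀ * a₁) by ring,
      ENNReal.mul_rpow_of_nonneg _ _ (by norm_num), sq_sqrt,
      ENNReal.mul_rpow_of_nonneg _ _ (by norm_num)]
  have h2 : (x ^ 2 * y ^ 2) ^ (1 / 4 : ℝ) = x ^ (1 / 2 : ℝ) * y ^ (1 / 2 : ℝ) := by
    rw [ENNReal.mul_rpow_of_nonneg _ _ (by norm_num), ← ENNReal.rpow_natCast, ← ENNReal.rpow_natCast,
      ← ENNReal.rpow_mul, ← ENNReal.rpow_mul]
    norm_num
  have h3 : y ^ (3 / 2 : ℝ) = y ^ (1 / 2 : ℝ) * y := by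
    rw [show (3 / 2 : ℝ) = 1 / 2 + 1 by norm_num,
      ENNReal.rpow_add_of_nonneg _ _ (by norm_num) (by norm_num), ENNReal.rpow_one]
  have h4 : (x ^ 2 * y ^ 2) ^ (1 / 2 : ℝ) = x * y := by
    rw [← mul_pow, sq_sqrt]
  unfold commutatorBound
  rw [h1, h2, h3, h4, sq_sqrt]
  ring

lemma commutatorBound_mono {A₀ A₁ e₀ e₀' e₁ e₁' : ℝ≥0∞} (h₀ : e₀ ≤ e₀') (h₁ : e₁ ≤ e₁') :
    commutatorBound A₀ A₁ e₀ e₁ ≤ commutatorBound A₀ A₁ e₀' e₁' := by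
  unfold commutatorBound
  gcongr

end AnisotropicFluid

open AnisotropicFluid
theorem lemma3p1 (s : ℝ) (hs : 1 / 2 < s) :
    ∃ C : ℝ, 0 < C ∧
      ∀ (u : Fin 3 → L2) (gradh_u : Fin 2 × Fin 3 → L2),
        IsDivFree u →
        IsHorizontalGradient u gradh_u →
        sobolevNorm s u < ⊤ →
        sobolevNorm s gradh_u < ⊤ →
        ∃ L : ℂ,
          HasSobolevInner s (advection u)
            (fun i => toDistribution (u i)) L ∧
          ENNReal.ofReal ‖L‖ ≤ ENNReal.ofReal C *
            (mixedNorm ⊤ 2 u ^ (1 / 2 : ℝ) *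
                mixedNorm ⊤ 2 gradh_u ^ (1 / 2 : ℝ) *
                sobolevNorm s u ^ (1 / 2 : ℝ) *
                sobolevNorm s gradh_u ^ (3 / 2 : ℝ) +
              mixedNorm ⊤ 2 gradh_u *
                sobolevNorm s u *
                sobolevNorm s gradh_u) := by
  obtain ⟨K, hK, hmain⟩ := exists_enorm_commutator_le_of_hasFiniteEnergy hs
  set B : ℝ≥0∞ := ENNReal.ofReal Real.pi * (K * kernelMass) with hB
  have hBtop : B ≠ ⊤ :=
    ENNReal.mul_ne_top ENNReal.ofReal_ne_top (ENNReal.mul_ne_top hK kernelMass_ne_top)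
  -- The added 1 only ensures a positive constant.
  refine ⟨B.toReal + 1, by positivity, fun u g hdiv hgrad hu hg => ?_⟩
  have hW : HasFiniteEnergy s fun i => freqSide (u i) := by
    refine ⟨fun i => measurable_freqSide (u i), ?_, ?_⟩
    · exact (sum_sobolevEnergy_freqSide s u).trans_ne (ENNReal.pow_ne_top hu.ne)
    · exact ne_top_of_le_ne_top (ENNReal.pow_ne_top hg.ne) (sum_sobolevHorizontalEnergy_le s hgrad)
  have hint : ∀ i, Integrable (freqSide (u i)) := hW.integrable hs
  obtain ⟨V, hVm, hS, hVae⟩ := exists_isSolenoidal_ae_eq hW.measurable hdiv.ae_eq_zero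
    fun i => freqSide_neg_ae (hint i)
  have he₀ : fieldEnergy s V = sobolevNorm s u ^ 2 := by
    rw [← sum_sobolevEnergy_freqSide]
    exact Finset.sum_congr rfl fun i _ => sobolevEnergy_congr_ae (hVae i)
  have he₁ : fieldHorizontalEnergy s V ≤ sobolevNorm s g ^ 2 := by
    refine le_trans (le_of_eq ?_) (sum_sobolevHorizontalEnergy_le s hgrad)
    refine Finset.sum_congr rfl fun i _ => ?_
    unfold sobolevHorizontalEnergy
    rw [sobolevEnergy_congr_ae (mulCoord_congr_ae (hVae i) 0),
      sobolevEnergy_congr_ae (mulCoord_congr_ae (hVae i) 1)]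
  have hV : HasFiniteEnergy s V := ⟨hVm, he₀.trans_ne (ENNReal.pow_ne_top hu.ne),
    ne_top_of_le_ne_top (ENNReal.pow_ne_top hg.ne) he₁⟩
  -- The profiles are replaced by V, which is solenoidal at every frequency, because the reflection
  -- argument is pointwise. The factor π here is the one in B.
  refine ⟨Real.pi * Complex.I * commutator s V, ⟨transportSymbol V, V,
    hasFourierTransform_advection hint hVae, fun i => HasFourierTransform.of_ae (hVae i),
    locallyIntegrable_transportSymbol_mul_conj hVm (hV.integrable hs) (hV.memLp (by linarith)),
    fun χ hχ => tendsto_integral_transportSymbol hs hV hS hχ⟩, ?_⟩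
  have h1 := hmain V hV hS (kernelMass * mixedNorm ⊤ 2 u) (kernelMass * mixedNorm ⊤ 2 g)
    (fun n i => verticalSup_truncate_le hVae n i)
    (fun n i j hj => verticalSup_mulCoord_truncate_le hgrad hVae n i j hj)
  have h2 := h1.trans (mul_le_mul' le_rfl (commutatorBound_mono he₀.le he₁))
  rw [commutatorBound_const_mul, ← mul_assoc] at h2
  have h3 : ENNReal.ofReal ‖Real.pi * Complex.I * commutator s V‖ =
      ENNReal.ofReal Real.pi * ‖commutator s V‖ₑ := by
    rw [norm_mul, norm_mul, Complex.norm_I, mul_one, Complex.norm_real,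
      Real.norm_of_nonneg Real.pi_pos.le, ENNReal.ofReal_mul Real.pi_pos.le, ofReal_norm]
  rw [h3]
  refine (mul_le_mul' le_rfl h2).trans ?_
  rw [← mul_assoc]
  refine mul_le_mul' ?_ le_rfl
  rw [← hB, ← ENNReal.ofReal_toReal hBtop]
  exact ENNReal.ofReal_le_ofReal (by
    rw [ENNReal.toReal_ofReal ENNReal.toReal_nonneg]
    linarith)
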